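/- Let $p$ be a prime and let $(R,\mathfrak m)$ be a commutative Noetherian local ring of characteristic $p$. Let $M$ be a finitely generated $R$-module, let $I_1, I_2$ be $\mathfrak m$-primary ideals of $R$, and let $s>0$ be a real number. For a commutative Noetherian local ring $A$ of characteristic $p$, ideals $I,J$ of $A$ that are primary to its maximal ideal and a finitely generated $A$-module $N$, put $$h_s(I,J;N)=\lim_{e\to\infty}\frac{\ell_A\big(N/(I^{\lceil sp^e\rceil}+J^{[p^e]})N\big)}{p^{e\dim A}},$$ where $\ell_A$ denotes length and $J^{[p^e]}$ is the ideal generated by the $p^e$-th powers of the elements of $J$. Let $R\ltimes M$ be the idealization (trivial extension) of $M$, that is $R\oplus M$ with the product $(r,m)(r',m')=(rr',rm'+r'm)$. For an ideal $I$ of $R$ let $I\ltimes IM=\{(r,m): r\in I,\ m\in IM\}$, an ideal of $R\ltimes M$, and put $J_i=I_i\ltimes I_iM$ for $i=1,2$. Then the limits defining $h_s(I_1,I_2;R)$, $h_s(I_1,I_2;M)$ and $h_s(J_1,J_2;R\ltimes M)$ (the last one over the ring $R\ltimes M$) exist, and, with $d=\dim R$, $$h_s(J_1,J_2;R\ltimes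 M)=h_s(I_1,I_2;R)+h_s(I_1,I_2;M)=\lim_{e\to\infty}\frac{\ell_R\Big((R\ltimes M)\big/\big((I_1^{\lceil sp^e\rceil}+I_2^{[p^e]})\ltimes(I_1^{\lceil sp^e\rceil}+I_2^{[p^e]})M\big)\Big)}{p^{ed}},$$ where the last limit exists as well. -/

import Mathlib

open Filter Topology

noncomputable section

/-- An ideal of a local ring that is primary to the maximal ideal. -/
def IsMaximalPrimary {R : Type*} [CommRing R] [IsLocalRing R] (I : Ideal R) : Prop :=
  I.IsPrimary ∧ I.radical = IsLocalRing.maximalIdeal R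

/-- The ideal `J^[q]` generated by the `q`-th powers of the elements of `J`
(the Frobenius power of `J` when `q` is a power of the characteristic). -/
def bracketPower {R : Type*} [CommRing R] (J : Ideal R) (q : ℕ) : Ideal R :=
  Ideal.span {x | ∃ a ∈ J, x = a ^ q}

/-- The ideal `I^⌈s p^e⌉ + J^[p^e]`. -/
def mixedPower {R : Type*} [CommRing R] (p : ℕ) (s : ℝ) (I J : Ideal R) (e : ℕ) : Ideal R :=
  I ^ ⌈s * (p : ℝ) ^ e⌉₊ + bracketPower J (p ^ e)

/-- The Krull dimension of a ring as a natural number. It agrees with `ringKrullDim` for Noetherian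
local rings, whose dimension is finite. -/
def natDim (R : Type*) [CommRing R] : ℕ :=
  ((ringKrullDim R).unbotD 0).toNat

/-- The length of an `R`-module as a real number (used only for modules of finite length). -/
def realLength (R M : Type*) [CommRing R] [AddCommGroup M] [Module R M] : ℝ :=
  ((Module.length R M).toNat : ℝ)

/-- The `e`-th term `ℓ_R(M / (I^⌈s p^e⌉ + J^[p^e]) M) / p^(e d)`, where `d = dim R`. -/
def hSeq (R M : Type*) [CommRing R] [AddCommGroup M] [Module R M]
    (p : ℕ) (s : ℝ) (I J : Ideal R) (e : ℕ) : ℝ :=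
  realLength R (M ⧸ (mixedPower p s I J e • (⊤ : Submodule R M))) / (p : ℝ) ^ (e * natDim R)

/-- The `h`-function `h_s(I, J; M)` of the `R`-module `M`: the limit of `hSeq`. -/
def hFunction (R M : Type*) [CommRing R] [AddCommGroup M] [Module R M]
    (p : ℕ) (s : ℝ) (I J : Ideal R) : ℝ :=
  limUnder atTop (hSeq R M p s I J)

/-- The ideal `I ⋉ IM = {(r, m) | r ∈ I, m ∈ IM}` of the idealization `R ⋉ M`, which is
`TrivSqZeroExt R M` in Mathlib. -/
def idealizationIdeal {R : Type*} (M : Type*) [CommRing R] [AddCommGroup M] [Module R M]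
    [Module Rᵐᵒᵖ M] [IsCentralScalar R M] (I : Ideal R) : Ideal (TrivSqZeroExt R M) where
  carrier := {x | x.fst ∈ I ∧ x.snd ∈ I • (⊤ : Submodule R M)}
  zero_mem' := ⟨I.zero_mem, Submodule.zero_mem _⟩
  add_mem' := fun hx hy => ⟨I.add_mem hx.1 hy.1, Submodule.add_mem _ hx.2 hy.2⟩
  smul_mem' := fun c x hx => by
    refine ⟨?_, ?_⟩
    · simpa using I.mul_mem_left c.fst hx.1
    · simpa using Submodule.add_mem _ (Submodule.smul_mem _ c.fst hx.2)
        (Submodule.smul_mem_smul hx.1 (Submodule.mem_top (x := c.snd)))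

end

/-! Write `T = R ⋉ M`. The ideal `J_i` is the extension of `I_i` to `T`, so the mixed power of `J₁,
J₂` is the extension of the mixed power `𝔞` of `I₁, I₂`, that is `𝔞 ⋉ 𝔞M`, and the quotient of `T`
by it is `R/𝔞 ⊕ M/𝔞M` over `R`. Lengths over `T` and over `R` agree because the residue fields do,
and `dim T = dim R` because `0 ⋉ M` has square zero. Hence the sequence for `T` is, term by term,
the sum of those for `R` and `M` (`hSeq_trivSqZeroExt`), and the whole difficulty is the existence
of the limits (`exists_tendsto_hSeq`).

For that, `R` is replaced by a complete local extension with perfect residue field and the same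
lengths of quotients by powers of the maximal ideal (`exists_complete_extension`); this preserves
the dimension and all lengths involved. Now `F_*M` is finite, and its colength with respect to `𝔞`
is that of `M` with respect to `𝔞^[p]`. Let `f_e(M)` be the numerator for `M`, `q = p^e` and `d =
dim R`. The ideals `(I^n)^[p]` and `I^(pn)` differ by a bounded shift of the exponent, and one step
`I^n M / I^(n+1) M` costs `O(n^(d-1))` by Hilbert function theory, so `f_(e+1)(M) = f_e(F_*M) +
O(q^(d-1))` (`mixedColen_succ_sub_isBigO`).

Over a domain, `F_*R` is free of some rank `ρ` up to torsion, and torsion contributes `O(q^(d-1))`.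
Thus `v_e = f_e(R)/q^d` satisfies `v_(e+1) = (ρ/p^d) v_e + O(p^(-e))`. Since `v_e` lies between two
positive constants, `ρ = p^d` is forced, and `v` is a Cauchy sequence (`exists_tendsto_of_ratio`).
Any finite module over a domain is free up to torsion; a module killed by the nilradical agrees up
to torsion with the product of the `M/PM` over the minimal primes `P`; and a power of `F_*` turns
every finite module into one killed by the nilradical. -/

/-! ### Formal smoothness of field extensions of perfect fields -/

section FormallySmoothField
open Algebra MvPolynomial

variable {F L : Type*} [Field F] [Field L] [Algebra F L]

/-- Every field extension of a perfect field is formally smooth. -/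
theorem formallySmooth_of_perfectField [PerfectField F] : Algebra.FormallySmooth F L := by
  refine ⟨inferInstance, ?_⟩
  rw [Algebra.H1Cotangent, Extension.subsingleton_h1Cotangent, injective_iff_map_eq_zero]
  intro y hy
  obtain ⟨⟨x, hxk⟩, rfl⟩ := Extension.Cotangent.mk_surjective y
  change MvPolynomial L F at x
  -- A class in `H1Cotangent` is represented by one polynomial `x`, whose variables generate a
  -- finitely generated subfield `E`. The class comes from `E`, where formal smoothness over the
  -- perfect field is available.
  let E : IntermediateField F L := IntermediateField.adjoin F (x.vars : Set L)
  have : Algebra.EssFiniteType F E :=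
    IntermediateField.essFiniteType_iff.mpr ⟨x.vars, rfl⟩
  have hE : Algebra.FormallySmooth F E := inferInstance
  have hmem : (x.vars : Set L) ⊆ Set.range (algebraMap E L) := fun a ha =>
    ⟨⟨a, IntermediateField.subset_adjoin F _ ha⟩, rfl⟩
  obtain ⟨x₀, hx₀⟩ := MvPolynomial.exists_rename_eq_of_vars_subset_range x
    (algebraMap E L) (algebraMap E L).injective hmem
  have haev : ∀ z : MvPolynomial E F, aeval (R := F) (id : L → L) (rename (algebraMap E L) z) =
      algebraMap E L (aeval (id : E → E) z) := by
    intro z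
    rw [aeval_rename]
    have := MvPolynomial.aeval_algebraMap_apply (A := E) L (R := F) (id : E → E) z
    simpa using this
  have hxk' : aeval (R := F) (id : L → L) x = 0 := by
    have := (Generators.self F L).ker_eq_ker_aeval_val
    exact (Generators.self F L).aeval_val_eq_zero hxk
  have hx₀k : x₀ ∈ (Generators.self F E).ker := by
    rw [Generators.ker_eq_ker_aeval_val, RingHom.mem_ker]
    apply (algebraMap E L).injective
    rw [map_zero, ← hxk', ← hx₀]
    exact (haev x₀).symm
  have key := hE.subsingleton_h1Cotangent
  rw [Algebra.H1Cotangent, Extension.subsingleton_h1Cotangent, injective_iff_map_eq_zero] at key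
  have hz := key (Extension.Cotangent.mk ⟨x₀, hx₀k⟩) ?_
  · rw [Extension.Cotangent.mk_eq_zero_iff] at hz ⊢
    have hle : (Generators.self F E).toExtension.ker ≤
        ((Generators.self F L).toExtension.ker).comap (rename (algebraMap E L) :
          MvPolynomial E F →ₐ[F] MvPolynomial L F).toRingHom := by
      intro z hz
      have hz' := (Generators.self F E).aeval_val_eq_zero hz
      change _ ∈ (Generators.self F L).ker
      rw [Generators.ker_eq_ker_aeval_val]
      change aeval (R := F) (id : L → L) (rename (algebraMap E L) z) = 0
      refine (haev z).trans ?_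
      erw [hz']
      simp
    have := (Ideal.pow_right_mono hle 2).trans (Ideal.le_comap_pow _ 2) hz
    have hmem' : ∀ w : MvPolynomial L F, w = x →
        w ∈ ((Generators.self F L).toExtension.ker ^ 2 : Ideal (MvPolynomial L F)) →
        x ∈ ((Generators.self F L).toExtension.ker ^ 2 : Ideal (MvPolynomial L F)) :=
      fun w h hw => h ▸ hw
    exact hmem' _ hx₀ this
  -- The cotangent complex is read off in coordinates as partial derivatives, and these commute with
  -- the injective renaming of variables.
  · rw [Extension.cotangentComplex_mk] at hy ⊢
    apply (Generators.self F E).cotangentSpaceBasis.repr.injective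
    rw [map_zero]
    ext i
    have h1 := congrArg (fun t => (Generators.self F L).cotangentSpaceBasis.repr t
      (algebraMap E L i)) hy
    simp only [map_zero] at h1
    erw [Generators.cotangentSpaceBasis_repr_one_tmul] at h1 ⊢
    apply congrArg Subtype.val
    apply (algebraMap E L).injective
    rw [Finsupp.zero_apply, map_zero]
    refine (haev _).symm.trans ?_
    rw [← pderiv_rename (algebraMap E L).injective, hx₀]
    exact h1

end FormallySmoothField

/-! ### Completions of local rings: Noetherianity and lengths -/

section LocalExtension
open IsLocalRing TensorProduct

/-- A complete local ring with finitely generated maximal ideal which contains a field of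
representatives is Noetherian. -/
theorem isNoetherianRing_of_isAdicComplete {K S : Type*} [Field K] [CommRing S] [IsLocalRing S]
    [IsAdicComplete (maximalIdeal S) S] (hfg : (maximalIdeal S).FG) (ι : K →+* S)
    (hι : ∀ s, ∃ y, s - ι y ∈ maximalIdeal S) : IsNoetherianRing S := by
  obtain ⟨r, g, hg⟩ := Submodule.fg_iff_exists_fin_generating_family.mp hfg
  let I := MvPolynomial.idealOfVars (Fin r) K
  let φ : MvPolynomial (Fin r) K →+* S := MvPolynomial.eval₂Hom ι g
  have hφ : I ≤ (maximalIdeal S).comap φ := by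
    refine Ideal.span_le.mpr ?_
    rintro _ ⟨i, rfl⟩
    simp only [φ, SetLike.mem_coe, Ideal.mem_comap, MvPolynomial.coe_eval₂Hom,
      MvPolynomial.eval₂_X]
    rw [← hg]
    exact Submodule.subset_span ⟨i, rfl⟩
  -- The compatible maps `ψ n` lift to a map `Φ` from the completed polynomial ring, a power series
  -- ring. `Φ` carries the variables to generators of the maximal ideal and hits every residue
  -- class, so it is surjective by completeness.
  let ψ (n : ℕ) : AdicCompletion I (MvPolynomial (Fin r) K) →+* S ⧸ maximalIdeal S ^ n :=
    (Ideal.quotientMap _ φ ((Ideal.pow_right_mono hφ n).trans (Ideal.le_comap_pow φ n))).comp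
      (AdicCompletion.evalₐ I n).toRingHom
  have hψ : ∀ {m n : ℕ} (hle : m ≤ n),
      (Ideal.Quotient.factorPow (maximalIdeal S) hle).comp (ψ n) = ψ m := by
    intro m n hle
    ext x
    obtain ⟨x, rfl⟩ := AdicCompletion.mk_surjective _ _ x
    simp only [ψ, RingHom.comp_apply, AlgHom.toRingHom_eq_coe, RingHom.coe_coe,
      AdicCompletion.evalₐ_mk, Ideal.quotientMap_mk]
    have h := x.2 hle
    change Ideal.Quotient.mk _ _ = _
    rw [Ideal.Quotient.eq, ← map_sub]
    refine ((Ideal.pow_right_mono hφ m).trans (Ideal.le_comap_pow φ m)) ?_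
    have h' := (SModEq.symm h)
    rw [SModEq.sub_mem] at h'
    simpa using h'
  let Φ : AdicCompletion I (MvPolynomial (Fin r) K) →+* S :=
    IsAdicComplete.liftRingHom (maximalIdeal S) ψ hψ
  have hΦ (x) : Φ (algebraMap _ _ x) = φ x := by
    apply IsHausdorff.eq_iff_smodEq (I := maximalIdeal S).mpr
    intro n
    rw [SModEq.sub_mem, smul_eq_mul, Ideal.mul_top, ← Ideal.Quotient.eq]
    rw [IsAdicComplete.mk_liftRingHom]
    simp [ψ]
  have hmap : (I.map (algebraMap _ (AdicCompletion I (MvPolynomial (Fin r) K)))).map Φ =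
      maximalIdeal S := by
    rw [Ideal.map_map]
    have : Φ.comp (algebraMap _ _) = φ := RingHom.ext hΦ
    rw [this]
    apply le_antisymm (Ideal.map_le_iff_le_comap.mpr hφ)
    rw [← hg, Submodule.span_le]
    rintro _ ⟨i, rfl⟩
    have := Ideal.mem_map_of_mem φ (Ideal.subset_span ⟨i, rfl⟩ : MvPolynomial.X i ∈ I)
    simpa [φ] using this
  have : IsAdicComplete (I.map (algebraMap _ (AdicCompletion I (MvPolynomial (Fin r) K))))
      (AdicCompletion I (MvPolynomial (Fin r) K)) :=
    AdicCompletion.isAdicComplete_self _ (MvPolynomial.idealOfVars_fg _ _)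
  have : IsHausdorff ((I.map (algebraMap _ (AdicCompletion I (MvPolynomial (Fin r) K)))).map Φ)
      S := by rw [hmap]; infer_instance
  have : IsNoetherianRing (AdicCompletion I (MvPolynomial (Fin r) K)) :=
    isNoetherianRing_of_ringEquiv (MvPowerSeries (Fin r) K)
      (MvPowerSeries.toAdicCompletionAlgEquiv (Fin r) K).toRingEquiv
  refine isNoetherianRing_of_surjective _ S Φ (surjective_of_mk_map_comp_surjective
    (I := I.map (algebraMap _ (AdicCompletion I (MvPolynomial (Fin r) K)))) Φ ?_)
  intro x
  obtain ⟨x, rfl⟩ := Ideal.Quotient.mk_surjective x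
  obtain ⟨y, hy⟩ := hι x
  refine ⟨algebraMap (MvPolynomial (Fin r) K) (AdicCompletion I (MvPolynomial (Fin r) K))
    (MvPolynomial.C y), ?_⟩
  rw [RingHom.comp_apply, hΦ, eq_comm, Ideal.Quotient.eq, hmap]
  simpa [φ] using hy

/-- Lengths of quotients by powers of the maximal ideal do not change under completion. -/
theorem AdicCompletion.length_quotient_pow {R : Type*} [CommRing R] [IsLocalRing R]
    (fg : (maximalIdeal R).FG) (c : ℕ) :
    Module.length (AdicCompletion (maximalIdeal R) R) (AdicCompletion (maximalIdeal R) R ⧸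
      ((maximalIdeal R).map (algebraMap R (AdicCompletion (maximalIdeal R) R))) ^ c) =
    Module.length R (R ⧸ maximalIdeal R ^ c) := by
  set m := maximalIdeal R
  set C := AdicCompletion m R
  have hker : (m.map (algebraMap R C)) ^ c = RingHom.ker (AdicCompletion.evalₐ m c).toRingHom := by
    ext x
    rw [← Ideal.map_pow, ← Submodule.restrictScalars_mem R, ← Ideal.smul_top_eq_map,
      AdicCompletion.pow_smul_top_eq_ker_eval fg, LinearMap.mem_ker, RingHom.mem_ker]
    simp only [AlgHom.toRingHom_eq_coe, RingHom.coe_coe]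
    rw [← AdicCompletion.factor_eval_eq_evalₐ m x (by simp)]
    have : m ^ c • (⊤ : Submodule R R) = m ^ c := by simp
    constructor
    · intro h; rw [h]; exact LinearMap.map_zero (Submodule.factor this.le)
    · intro h
      obtain ⟨y, hy⟩ := Submodule.Quotient.mk_surjective _ (AdicCompletion.eval m R c x)
      rw [← hy] at h ⊢
      rw [Submodule.Quotient.mk_eq_zero, this]
      exact (Submodule.Quotient.mk_eq_zero _).mp h
  let e : (C ⧸ (m.map (algebraMap R C)) ^ c) ≃ₐ[R] R ⧸ m ^ c :=
    (Ideal.quotientEquivAlgOfEq R hker).trans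
      (Ideal.quotientKerAlgEquivOfSurjective (AdicCompletion.surjective_evalₐ m c))
  rw [← e.toLinearEquiv.length_eq, Module.length_eq_of_surjective
    (R := C ⧸ (m.map (algebraMap R C)) ^ c) (S := C) (M := C ⧸ (m.map (algebraMap R C)) ^ c)
    Ideal.Quotient.mk_surjective, Module.length_eq_of_surjective
    (R := C ⧸ (m.map (algebraMap R C)) ^ c) (S := R) (M := C ⧸ (m.map (algebraMap R C)) ^ c)]
  intro x
  obtain ⟨y, hy⟩ := Ideal.Quotient.mk_surjective (e x)
  exact ⟨y, e.injective (by rw [AlgEquiv.commutes, ← hy]; rfl)⟩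

end LocalExtension

/-! ### Purely inseparable extension of a field of representatives -/

section ResidueExtension
open IsLocalRing TensorProduct

variable {k K B : Type*} [Field k] [Field K] [Algebra k K] [CommRing B]
  [Algebra k B]

/-- In a purely inseparable base change every element has a `p`-power in the original ring. -/
theorem exists_pow_eq_one_tmul (p : ℕ) [Fact p.Prime] [CharP k p] [IsPurelyInseparable k K]
    (x : K ⊗[k] B) :
    ∃ (n : ℕ) (b : B), x ^ p ^ n = 1 ⊗ₜ b := by
  rcases subsingleton_or_nontrivial (K ⊗[k] B) with hs | hn
  · exact ⟨0, 0, Subsingleton.elim _ _⟩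
  have : CharP (K ⊗[k] B) p := charP_of_injective_algebraMap (algebraMap k (K ⊗[k] B)).injective p
  have : ExpChar k p := .prime Fact.out
  induction x with
  | zero => exact ⟨0, 0, by simp⟩
  | tmul y b =>
    obtain ⟨n, z, hz⟩ := IsPurelyInseparable.pow_mem k p y
    refine ⟨n, z • b ^ p ^ n, ?_⟩
    rw [Algebra.TensorProduct.tmul_pow, ← hz, Algebra.algebraMap_eq_smul_one,
      TensorProduct.smul_tmul]
  | add x y hx hy =>
    obtain ⟨n, b, hb⟩ := hx
    obtain ⟨m, c, hc⟩ := hy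
    refine ⟨n + m, b ^ p ^ m + c ^ p ^ n, ?_⟩
    rw [add_pow_char_pow, TensorProduct.tmul_add]
    congr 1
    · rw [pow_add, pow_mul, hb, Algebra.TensorProduct.tmul_pow, one_pow]
    · rw [pow_add, mul_comm, pow_mul, hc, Algebra.TensorProduct.tmul_pow, one_pow]

/-- An inverse `w` of `1 ⊗ b` has a power `w ^ p ^ n = 1 ⊗ c`; then `b ^ p ^ n * c = 1`, because `B
→ K ⊗ B` is injective. -/
theorem isUnit_one_tmul_iff (p : ℕ) [Fact p.Prime] [CharP k p] [IsPurelyInseparable k K] (b : B) :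
    IsUnit ((1 : K) ⊗ₜ[k] b) ↔ IsUnit b := by
  constructor
  · intro h
    obtain ⟨w, hw⟩ := h.exists_right_inv
    obtain ⟨n, c, hc⟩ := exists_pow_eq_one_tmul p w
    have h1 : (1 : K) ⊗ₜ[k] (b ^ p ^ n * c) = 1 ⊗ₜ 1 := by
      have := congrArg (· ^ p ^ n) hw
      simp only [mul_pow, hc, Algebra.TensorProduct.tmul_pow, one_pow,
        Algebra.TensorProduct.tmul_mul_tmul, mul_one] at this
      exact this
    have h2 := Algebra.TensorProduct.includeRight_injective (R := k) (A := K) (B := B)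
      (algebraMap k K).injective h1
    have h3 : IsUnit (b ^ p ^ n) := IsUnit.of_mul_eq_one _ h2
    exact (isUnit_pow_iff (pow_ne_zero _ (Fact.out : p.Prime).ne_zero)).mp h3
  · intro h
    exact h.map (Algebra.TensorProduct.includeRight : B →ₐ[k] K ⊗[k] B)

/-- A purely inseparable base change of a local ring is local. -/
theorem isLocalRing_tensorProduct_of_isPurelyInseparable (p : ℕ) [Fact p.Prime] [CharP k p]
    [IsPurelyInseparable k K]
    [IsLocalRing B] : IsLocalRing (K ⊗[k] B) := by
  have hnt : Nontrivial (K ⊗[k] B) :=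
    (Algebra.TensorProduct.includeRight_injective (R := k) (A := K) (B := B)
      (algebraMap k K).injective).nontrivial
  have : CharP (K ⊗[k] B) p := charP_of_injective_algebraMap (algebraMap k (K ⊗[k] B)).injective p
  refine IsLocalRing.of_nonunits_add ?_
  intro x y hx hy hxy
  obtain ⟨n, b, hb⟩ := exists_pow_eq_one_tmul p x
  obtain ⟨m, c, hc⟩ := exists_pow_eq_one_tmul p y
  have hp : ∀ l, p ^ l ≠ 0 := fun l => pow_ne_zero _ (Fact.out : p.Prime).ne_zero
  have hbn : b ∈ nonunits B := fun h => hx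
    ((isUnit_pow_iff (hp n)).mp (hb ▸ (isUnit_one_tmul_iff p b).mpr h))
  have hcn : c ∈ nonunits B := fun h => hy
    ((isUnit_pow_iff (hp m)).mp (hc ▸ (isUnit_one_tmul_iff p c).mpr h))
  have h1 : (x + y) ^ p ^ (n + m) = (1 : K) ⊗ₜ[k] (b ^ p ^ m + c ^ p ^ n) := by
    rw [add_pow_char_pow, TensorProduct.tmul_add]
    congr 1
    · rw [pow_add, pow_mul, hb, Algebra.TensorProduct.tmul_pow, one_pow]
    · rw [pow_add, mul_comm, pow_mul, hc, Algebra.TensorProduct.tmul_pow, one_pow]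
  have h2 : IsUnit (b ^ p ^ m + c ^ p ^ n) :=
    (isUnit_one_tmul_iff (K := K) (k := k) p _).mp (h1 ▸ hxy.pow _)
  rw [← mem_maximalIdeal] at hbn hcn
  exact (mem_maximalIdeal _).mp (Ideal.add_mem _ (Ideal.pow_mem_of_mem _ hbn _ (hp m).bot_lt)
    (Ideal.pow_mem_of_mem _ hcn _ (hp n).bot_lt)) h2

/-- If `k` is a field of representatives of `B`, then `K` represents `K ⊗ B` modulo `𝔪_B`. -/
theorem exists_sub_tmul_one_mem_map [IsLocalRing B]
    (hk : ∀ b : B, ∃ y : k, b - algebraMap k B y ∈ maximalIdeal B) (x : K ⊗[k] B) :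
    ∃ y : K, x - y ⊗ₜ 1 ∈ (maximalIdeal B).map
      (Algebra.TensorProduct.includeRight : B →ₐ[k] K ⊗[k] B) := by
  induction x with
  | zero => exact ⟨0, by simp⟩
  | tmul y b =>
    obtain ⟨z, hz⟩ := hk b
    refine ⟨z • y, ?_⟩
    have : y ⊗ₜ[k] b - (z • y) ⊗ₜ 1 = (y ⊗ₜ 1) * (Algebra.TensorProduct.includeRight :
        B →ₐ[k] K ⊗[k] B) (b - algebraMap k B z) := by
      simp [TensorProduct.tmul_sub, mul_sub, Algebra.algebraMap_eq_smul_one,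
        TensorProduct.smul_tmul]
    rw [this]
    exact Ideal.mul_mem_left _ _ (Ideal.mem_map_of_mem _ hz)
  | add x y hx hy =>
    obtain ⟨a, ha⟩ := hx
    obtain ⟨b, hb⟩ := hy
    refine ⟨a + b, ?_⟩
    rw [TensorProduct.add_tmul, add_sub_add_comm]
    exact Ideal.add_mem _ ha hb

/-- Modulo `𝔪_B` every element is some `y ⊗ 1` with `y` in the field `K`, and this can be a nonunit
only for `y = 0`. -/
theorem maximalIdeal_tensorProduct_of_isPurelyInseparable (p : ℕ) [Fact p.Prime] [CharP k p]
    [IsPurelyInseparable k K]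
    [IsLocalRing B] [IsLocalRing (K ⊗[k] B)]
    (hk : ∀ b : B, ∃ y : k, b - algebraMap k B y ∈ maximalIdeal B) :
    maximalIdeal (K ⊗[k] B) = (maximalIdeal B).map
      (Algebra.TensorProduct.includeRight : B →ₐ[k] K ⊗[k] B) := by
  have hle : (maximalIdeal B).map (Algebra.TensorProduct.includeRight : B →ₐ[k] K ⊗[k] B) ≤
      maximalIdeal (K ⊗[k] B) := by
    rw [Ideal.map_le_iff_le_comap]
    intro b hb
    rw [Ideal.mem_comap, mem_maximalIdeal]
    exact fun h => hb ((isUnit_one_tmul_iff p b).mp h)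
  refine le_antisymm (fun x hx => ?_) hle
  obtain ⟨y, hy⟩ := exists_sub_tmul_one_mem_map hk x
  have h1 : y ⊗ₜ[k] (1 : B) ∈ maximalIdeal (K ⊗[k] B) := by
    have := Ideal.sub_mem _ hx (hle hy)
    rwa [sub_sub_cancel] at this
  have h2 : y = 0 := by
    by_contra hne
    exact h1 ((Ne.isUnit hne).map (Algebra.TensorProduct.includeLeft : K →ₐ[k] K ⊗[k] B))
  simpa [h2] using hy

end ResidueExtension

/-! ### Complete local extensions with perfect residue field -/

section PerfectResidue
open IsLocalRing TensorProduct

theorem charP_of_charP_algebra {R S : Type*} [CommRing R] [CommRing S] [Nontrivial S]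
    [Algebra R S] (p : ℕ) [Fact p.Prime] [CharP R p] : CharP S p := by
  have h0 : (p : S) = 0 := by
    have := congrArg (algebraMap R S) (CharP.cast_eq_zero R p)
    rwa [map_natCast, map_zero] at this
  obtain ⟨q, hq⟩ := CharP.exists S
  have : q ∣ p := (CharP.cast_eq_zero_iff S q p).mp h0
  rcases (Nat.dvd_prime Fact.out).mp this with h | h
  · subst h
    exact absurd (CharP.cast_eq_zero S 1) (by rw [Nat.cast_one]; exact one_ne_zero)
  · exact h ▸ hq

/-- A complete local ring of characteristic `p` contains a field of representatives. -/
theorem exists_residueField_section {B : Type*} [CommRing B] [IsLocalRing B]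
    [IsAdicComplete (maximalIdeal B) B] (p : ℕ) [Fact p.Prime] [CharP B p] :
    ∃ σ : ResidueField B →+* B, ∀ y, residue B (σ y) = y := by
  let _ := ZMod.algebra B p
  -- `ZMod p` is perfect, so the residue field is formally smooth over it and its identity map lifts
  -- through the complete ring `B`.
  have : Algebra.FormallySmooth (ZMod p) (ResidueField B) := formallySmooth_of_perfectField
  obtain ⟨g, hg⟩ := Algebra.FormallySmooth.exists_mkₐ_comp_eq_of_isAdicComplete
    (I := maximalIdeal B) (AlgHom.id (ZMod p) (ResidueField B))
  exact ⟨g.toRingHom, fun y => congrArg (fun f => f y) hg⟩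

universe u

/-- The completion of a local ring with perfect field of representatives. -/
theorem exists_complete_of_perfect_representatives (A : Type u) [CommRing A] [IsLocalRing A]
    (fg : (maximalIdeal A).FG) {K : Type*} [Field K] (p : ℕ)
    (hK : ∀ y : K, ∃ z, z ^ p = y) (i : K →+* A)
    (hi : ∀ x, ∃ y, x - i y ∈ maximalIdeal A) :
    ∃ (S : Type u) (_ : CommRing S) (_ : IsNoetherianRing S) (_ : IsLocalRing S)
      (_ : IsAdicComplete (maximalIdeal S) S) (_ : Algebra A S),
      (maximalIdeal A).map (algebraMap A S) = maximalIdeal S ∧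
      (∀ x : S, ∃ y : S, x - y ^ p ∈ maximalIdeal S) ∧
      ∀ c, Module.length S (S ⧸ maximalIdeal S ^ c) =
        Module.length A (A ⧸ maximalIdeal A ^ c) := by
  let S := AdicCompletion (maximalIdeal A) A
  have hlS : IsLocalRing S := AdicCompletion.isLocalRing_of_fg fg
  have hS : maximalIdeal S = (maximalIdeal A).map (algebraMap A S) :=
    AdicCompletion.maximalIdeal_eq_map_of_fg fg
  have hcS : IsAdicComplete (maximalIdeal S) S := AdicCompletion.isAdicComplete_of_fg fg
  let ι : K →+* S := (algebraMap A S).comp i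
  have hι : ∀ s : S, ∃ y, s - ι y ∈ maximalIdeal S := by
    intro s
    have hlh : IsLocalHom (algebraMap A S) := AdicCompletion.algebraMap_isLocalHom_of_fg fg
    obtain ⟨t, ht⟩ := (AdicCompletion.residueField_map_bijective_of_fg fg).2 (residue S s)
    obtain ⟨x, rfl⟩ := residue_surjective t
    rw [ResidueField.map_residue] at ht
    obtain ⟨y, hy⟩ := hi x
    refine ⟨y, ?_⟩
    rw [← residue_eq_zero_iff, map_sub, ← ht, ← map_sub, residue_eq_zero_iff, hS,
      RingHom.comp_apply, ← map_sub]
    exact Ideal.mem_map_of_mem _ hy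
  have hN : IsNoetherianRing S := isNoetherianRing_of_isAdicComplete
    (by rw [hS]; exact fg.map _) ι hι
  refine ⟨S, inferInstance, hN, hlS, hcS, inferInstance, hS.symm, fun x => ?_, fun c => ?_⟩
  · obtain ⟨y, hy⟩ := hι x
    obtain ⟨z, rfl⟩ := hK y
    exact ⟨ι z, by rwa [← map_pow]⟩
  · rw [hS]
    exact AdicCompletion.length_quotient_pow fg c

/-- Extending a field of representatives to a perfect one preserves lengths. -/
theorem perfect_representatives_tensorProduct (B : Type u) [CommRing B] [IsLocalRing B]
    (p : ℕ) [Fact p.Prime] (k K : Type u) [Field k] [CharP k p] [Algebra k B]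
    [Field K] [Algebra k K] [IsPurelyInseparable k K]
    (hk : ∀ b : B, ∃ y : k, b - algebraMap k B y ∈ maximalIdeal B) :
    ∃ _ : IsLocalRing (B ⊗[k] K),
      (∀ x, ∃ y, x - (Algebra.TensorProduct.includeRight : K →ₐ[k] B ⊗[k] K) y ∈
        maximalIdeal (B ⊗[k] K)) ∧
      (maximalIdeal B).map (algebraMap B (B ⊗[k] K)) = maximalIdeal (B ⊗[k] K) ∧
      ∀ c, Module.length (B ⊗[k] K) ((B ⊗[k] K) ⧸ maximalIdeal (B ⊗[k] K) ^ c) =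
        Module.length B (B ⧸ maximalIdeal B ^ c) := by
  have hloc : IsLocalRing (B ⊗[k] K) :=
    have := isLocalRing_tensorProduct_of_isPurelyInseparable (k := k) (K := K) (B := B) p
    IsLocalRing.of_surjective' (Algebra.TensorProduct.comm k K B).toRingHom
      (Algebra.TensorProduct.comm k K B).surjective
  have hmax : (maximalIdeal B).map (algebraMap B (B ⊗[k] K)) = maximalIdeal (B ⊗[k] K) := by
    have := isLocalRing_tensorProduct_of_isPurelyInseparable (k := k) (K := K) (B := B) p
    have h := maximalIdeal_tensorProduct_of_isPurelyInseparable (k := k) (K := K) (B := B) p hk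
    have h2 : (maximalIdeal (K ⊗[k] B)).map (Algebra.TensorProduct.comm k K B).toRingEquiv =
        maximalIdeal (B ⊗[k] K) := by
      have := Ideal.map_isMaximal_of_equiv (Algebra.TensorProduct.comm k K B).toRingEquiv
        (p := maximalIdeal (K ⊗[k] B))
      exact IsLocalRing.eq_maximalIdeal this
    rw [← h2, h]
    have h3 := Ideal.map_map (Algebra.TensorProduct.includeRight : B →ₐ[k] K ⊗[k] B).toRingHom
      (Algebra.TensorProduct.comm k K B).toRingHom (I := maximalIdeal B)
    refine Eq.trans ?_ h3.symm
    congr 1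
  refine ⟨hloc, ?_, hmax, fun c => ?_⟩
  · intro x
    obtain ⟨y, hy⟩ := exists_sub_tmul_one_mem_map hk (Algebra.TensorProduct.comm k B K x)
    refine ⟨y, ?_⟩
    rw [← hmax]
    have := Ideal.mem_map_of_mem (Algebra.TensorProduct.comm k K B).toRingHom hy
    have h3 := Ideal.map_map (Algebra.TensorProduct.includeRight : B →ₐ[k] K ⊗[k] B).toRingHom
      (Algebra.TensorProduct.comm k K B).toRingHom (I := maximalIdeal B)
    have h4 : algebraMap B (B ⊗[k] K) = (Algebra.TensorProduct.comm k K B).toRingHom.comp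
        (Algebra.TensorProduct.includeRight : B →ₐ[k] K ⊗[k] B).toRingHom := by
      ext b
      simp
    rw [← h4] at h3
    rw [← h3]
    change _ ∈ Ideal.map (Algebra.TensorProduct.comm k K B).toRingEquiv.toRingHom
      (Ideal.map Algebra.TensorProduct.includeRight (maximalIdeal B))
    convert this using 1
    rw [map_sub]
    congr 1
    have h5 := (Algebra.TensorProduct.comm k B K).symm_apply_apply x
    exact h5.symm
  · have hlh : IsLocalHom (algebraMap B (B ⊗[k] K)) :=
      ((IsLocalRing.local_hom_TFAE _).out 0 2).mpr hmax.le
    -- Flat base change multiplies length by that of the closed fibre, which is a field here since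
    -- `𝔪_B` generates the maximal ideal.
    have h3 := IsLocalRing.length_baseChange B (B ⊗[k] K) (B ⧸ maximalIdeal B ^ c)
    rw [hmax] at h3
    have h4 : Module.length (B ⊗[k] K) (B ⊗[k] K ⧸ maximalIdeal (B ⊗[k] K)) = 1 :=
      Module.length_eq_one_iff.mpr (by
        rw [isSimpleModule_iff_isCoatom]; exact (maximalIdeal.isMaximal (B ⊗[k] K)).out)
    rw [h4, mul_one] at h3
    rw [← h3, ← hmax, ← Ideal.map_pow]
    exact (Algebra.TensorProduct.quotIdealMapEquivTensorQuot (B ⊗[k] K)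
      (maximalIdeal B ^ c)).toLinearEquiv.length_eq

/-- A local ring with a field of representatives of characteristic `p` has a local extension with
a perfect field of representatives and the same lengths. -/
theorem exists_perfect_representatives (B : Type u) [CommRing B] [IsLocalRing B]
    (p : ℕ) [Fact p.Prime] (k : Type u) [Field k] [CharP k p] [Algebra k B]
    (hk : ∀ b : B, ∃ y : k, b - algebraMap k B y ∈ maximalIdeal B) :
    ∃ (A : Type u) (_ : CommRing A) (_ : IsLocalRing A) (_ : Algebra B A)
      (K : Type u) (_ : Field K) (i : K →+* A),
      (∀ y : K, ∃ z, z ^ p = y) ∧ (∀ x, ∃ y, x - i y ∈ maximalIdeal A) ∧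
      (maximalIdeal B).map (algebraMap B A) = maximalIdeal A ∧
      ∀ c, Module.length A (A ⧸ maximalIdeal A ^ c) =
        Module.length B (B ⧸ maximalIdeal B ^ c) := by
  have : ExpChar k p := .prime Fact.out
  have : ExpChar (AlgebraicClosure k) p := expChar_of_injective_algebraMap
    (algebraMap k (AlgebraicClosure k)).injective p
  obtain ⟨h, hi, hA, hlA⟩ := perfect_representatives_tensorProduct B p k
    (perfectClosure k (AlgebraicClosure k)) hk
  exact ⟨_, inferInstance, h, inferInstance, _, inferInstance, _,
    fun y => surjective_frobenius (perfectClosure k (AlgebraicClosure k)) p y, hi, hA, hlA⟩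

/-- Every Noetherian local ring of characteristic `p` has a complete Noetherian local extension
with perfect residue field and the same lengths. -/
theorem exists_complete_extension (R : Type u) [CommRing R] [IsNoetherianRing R] [IsLocalRing R]
    (p : ℕ) [Fact p.Prime] [CharP R p] :
    ∃ (S : Type u) (_ : CommRing S) (_ : IsNoetherianRing S) (_ : IsLocalRing S)
      (_ : IsAdicComplete (maximalIdeal S) S) (_ : CharP S p) (_ : Algebra R S),
      (maximalIdeal R).map (algebraMap R S) = maximalIdeal S ∧
      (∀ x : S, ∃ y : S, x - y ^ p ∈ maximalIdeal S) ∧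
      ∀ c, Module.length S (S ⧸ maximalIdeal S ^ c) =
        Module.length R (R ⧸ maximalIdeal R ^ c) := by
  have fgR : (maximalIdeal R).FG := (maximalIdeal R).fg_of_isNoetherianRing
  let B := AdicCompletion (maximalIdeal R) R
  have hB : (maximalIdeal R).map (algebraMap R B) = maximalIdeal B :=
    AdicCompletion.maximalIdeal_eq_map.symm
  have : CharP B p := charP_of_charP_algebra (R := R) p
  obtain ⟨σ, hσ⟩ := exists_residueField_section (B := B) p
  let _ : Algebra (ResidueField B) B := σ.toAlgebra
  have hk : ∀ b : B, ∃ y : ResidueField B, b - σ y ∈ maximalIdeal B := fun b =>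
    ⟨residue B b, by
      rw [← residue_eq_zero_iff, map_sub, sub_eq_zero]
      exact (hσ _).symm⟩
  have : CharP (ResidueField B) p := charP_of_charP_algebra (R := B) p
  -- `A` is not known to be Noetherian or complete; a finitely generated maximal ideal and a field
  -- of representatives are enough for its completion to be Noetherian.
  obtain ⟨A, _, _, _, K, _, i, hK, hi, hA, hlA⟩ :=
    exists_perfect_representatives B p (ResidueField B) hk
  obtain ⟨S, _, hN, hl, hc, _, hS, hp, hlS⟩ := exists_complete_of_perfect_representatives A
    (by rw [← hA, ← hB]; exact (fgR.map _).map _) p hK i hi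
  let _ : Algebra R S := ((algebraMap A S).comp ((algebraMap B A).comp (algebraMap R B))).toAlgebra
  refine ⟨S, inferInstance, hN, hl, hc, charP_of_charP_algebra (R := R) p, inferInstance, ?_, hp,
    fun c => ?_⟩
  · rw [RingHom.algebraMap_toAlgebra, ← Ideal.map_map, ← Ideal.map_map, hB, hA, hS]
  · rw [hlS, hlA, ← hB]
    exact AdicCompletion.length_quotient_pow fgR c

end PerfectResidue

/-! ### Lengths of quotients and ideals containing a power of the maximal ideal -/

section Length
open IsLocalRing

variable {R M M' : Type*} [CommRing R] [AddCommGroup M] [Module R M] [AddCommGroup M'] [Module R M']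

/-- This is the exact sequence `0 → M'/f⁻¹N → M/N → M/(N + im f) → 0`, the source of most length
comparisons below. -/
theorem length_quotient_eq_add (f : M' →ₗ[R] M) (N : Submodule R M) : Module.length R (M ⧸ N) =
    Module.length R (M' ⧸ N.comap f) + Module.length R (M ⧸ (N ⊔ LinearMap.range f)) := by
  let g := (N.comap f).mapQ N f le_rfl
  let k : M ⧸ N →ₗ[R] M ⧸ (N ⊔ LinearMap.range f) := Submodule.factor le_sup_left
  refine Module.length_eq_add_of_exact g k ?_ (Submodule.factor_surjective _) ?_
  · rw [← LinearMap.ker_eq_bot]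
    exact (Submodule.ker_mapQ _ _ _ le_rfl).trans (Submodule.mkQ_map_self _)
  · intro x
    obtain ⟨x, rfl⟩ := Submodule.Quotient.mk_surjective _ x
    change Submodule.Quotient.mk x = 0 ↔ _
    rw [Submodule.Quotient.mk_eq_zero, Submodule.mem_sup]
    constructor
    · rintro ⟨y, hy, _, ⟨z, rfl⟩, rfl⟩
      refine ⟨Submodule.Quotient.mk z, (Submodule.Quotient.eq _).mpr ?_⟩
      simpa using hy
    · rintro ⟨z, hz⟩
      obtain ⟨z, rfl⟩ := Submodule.Quotient.mk_surjective _ z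
      refine ⟨x - f z, ?_, f z, ⟨z, rfl⟩, by simp⟩
      exact (Submodule.Quotient.eq _).mp hz.symm

theorem length_quotient_top : Module.length R (M ⧸ (⊤ : Submodule R M)) = 0 :=
  Module.length_eq_zero

theorem length_quotient_anti {N N' : Submodule R M} (h : N ≤ N') :
    Module.length R (M ⧸ N') ≤ Module.length R (M ⧸ N) :=
  Module.length_le_of_surjective (Submodule.factor h) (Submodule.factor_surjective h)

theorem length_quotient_le_add (f : M' →ₗ[R] M) (N' : Submodule R M') (N : Submodule R M)
    (h : N' ≤ N.comap f) : Module.length R (M ⧸ N) ≤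
      Module.length R (M' ⧸ N') + Module.length R (M ⧸ (N ⊔ LinearMap.range f)) := by
  rw [length_quotient_eq_add f N]
  exact add_le_add_left (length_quotient_anti h) _

theorem length_quotient_smul_le_of_surjective (𝔞 : Ideal R) (f : M' →ₗ[R] M)
    (hf : Function.Surjective f) : Module.length R (M ⧸ 𝔞 • (⊤ : Submodule R M)) ≤
      Module.length R (M' ⧸ 𝔞 • (⊤ : Submodule R M')) := by
  have h : 𝔞 • (⊤ : Submodule R M') ≤ (𝔞 • (⊤ : Submodule R M)).comap f := by
    rw [← Submodule.map_le_iff_le_comap, Submodule.map_smul'']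
    exact Submodule.smul_mono le_rfl le_top
  refine Module.length_le_of_surjective (Submodule.mapQ _ _ f h) ?_
  intro x
  obtain ⟨x, rfl⟩ := Submodule.Quotient.mk_surjective _ x
  obtain ⟨y, rfl⟩ := hf x
  exact ⟨Submodule.Quotient.mk y, rfl⟩

theorem smul_quotient_smul_eq_bot (𝔞 : Ideal R) :
    𝔞 • (⊤ : Submodule R (M ⧸ 𝔞 • (⊤ : Submodule R M))) = ⊥ := by
  rw [eq_bot_iff, Submodule.smul_le]
  intro a ha x _
  obtain ⟨x, rfl⟩ := Submodule.Quotient.mk_surjective _ x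
  rw [Submodule.mem_bot, ← Submodule.Quotient.mk_smul, Submodule.Quotient.mk_eq_zero]
  exact Submodule.smul_mem_smul ha trivial

/-- An ideal of a local ring containing a power of the maximal ideal. -/
def ContainsMaximalPow [IsLocalRing R] (𝔞 : Ideal R) : Prop := ∃ c, maximalIdeal R ^ c ≤ 𝔞

theorem ContainsMaximalPow.pow [IsLocalRing R] {𝔞 : Ideal R} (h : ContainsMaximalPow 𝔞) (n : ℕ) :
    ContainsMaximalPow (𝔞 ^ n) := by
  obtain ⟨c, hc⟩ := h
  exact ⟨c * n, by rw [pow_mul]; exact Ideal.pow_right_mono hc n⟩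

theorem containsMaximalPow_maximalIdeal [IsLocalRing R] : ContainsMaximalPow (maximalIdeal R) :=
  ⟨1, (pow_one _).le⟩

theorem containsMaximalPow_of_forall_isPrime [IsLocalRing R] [IsNoetherianRing R] {𝔞 : Ideal R}
    (h : ∀ P : Ideal R, P.IsPrime → 𝔞 ≤ P → P = maximalIdeal R) : ContainsMaximalPow 𝔞 := by
  apply Ideal.exists_pow_le_of_le_radical_of_fg _ (IsNoetherian.noetherian _)
  rw [Ideal.radical_eq_sInf]
  exact le_sInf fun P hP => (h P hP.2 hP.1).ge

variable [IsNoetherianRing R] [IsLocalRing R] [Module.Finite R M]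

theorem isFiniteLength_of_pow_smul_eq_bot {c : ℕ}
    (h : maximalIdeal R ^ c • (⊤ : Submodule R M) = ⊥) : IsFiniteLength R M := by
  -- The exponent `c + 1` keeps the quotient ring nontrivial, hence local Artinian, also for `c =
  -- 0`.
  have hc : maximalIdeal R ^ (c + 1) • (⊤ : Submodule R M) = ⊥ := by
    rw [eq_bot_iff, ← h]
    exact Submodule.smul_mono_left (Ideal.pow_le_pow_right c.le_succ)
  have ht : Module.IsTorsionBySet R M (maximalIdeal R ^ (c + 1) : Ideal R) := by
    intro x a
    have : a.1 • x ∈ maximalIdeal R ^ (c + 1) • (⊤ : Submodule R M) :=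
      Submodule.smul_mem_smul a.2 trivial
    rwa [hc] at this
  let _ := ht.module
  have hlt : maximalIdeal R ^ (c + 1) ≠ ⊤ := fun h =>
    (maximalIdeal.isMaximal R).ne_top (top_le_iff.mp (h ▸ Ideal.pow_le_self c.succ_ne_zero))
  have : Nontrivial (R ⧸ maximalIdeal R ^ (c + 1)) := Ideal.Quotient.nontrivial_iff.mpr hlt
  have : IsLocalRing (R ⧸ maximalIdeal R ^ (c + 1)) :=
    IsLocalRing.of_surjective' _ Ideal.Quotient.mk_surjective
  have : IsArtinianRing (R ⧸ maximalIdeal R ^ (c + 1)) := by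
    rw [isArtinianRing_iff_isNilpotent_maximalIdeal]
    refine ⟨c + 1, ?_⟩
    have h1 : maximalIdeal (R ⧸ maximalIdeal R ^ (c + 1)) =
        (maximalIdeal R).map (Ideal.Quotient.mk (maximalIdeal R ^ (c + 1))) :=
      (map_maximalIdeal_of_surjective _ Ideal.Quotient.mk_surjective).symm
    rw [h1, ← Ideal.map_pow, Ideal.map_quotient_self]
    rfl
  have : IsScalarTower R (R ⧸ maximalIdeal R ^ (c + 1)) M := ht.isScalarTower
  have : Module.Finite (R ⧸ maximalIdeal R ^ (c + 1)) M :=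
    Module.Finite.of_restrictScalars_finite R _ M
  rw [← Module.length_ne_top_iff, Module.length_eq_of_surjective
    (R := R ⧸ maximalIdeal R ^ (c + 1)) Ideal.Quotient.mk_surjective]
  exact Module.length_ne_top

theorem ContainsMaximalPow.isFiniteLength_of_smul_eq_bot {𝔞 : Ideal R} (h : ContainsMaximalPow 𝔞)
    (h0 : 𝔞 • (⊤ : Submodule R M) = ⊥) : IsFiniteLength R M := by
  obtain ⟨c, hc⟩ := h
  exact isFiniteLength_of_pow_smul_eq_bot (c := c)
    (le_bot_iff.mp (h0 ▸ Submodule.smul_mono_left hc))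

theorem ContainsMaximalPow.isFiniteLength {𝔞 : Ideal R} (h : ContainsMaximalPow 𝔞) :
    IsFiniteLength R (M ⧸ 𝔞 • (⊤ : Submodule R M)) :=
  h.isFiniteLength_of_smul_eq_bot (smul_quotient_smul_eq_bot 𝔞)

theorem ContainsMaximalPow.length_ne_top {𝔞 : Ideal R} (h : ContainsMaximalPow 𝔞) :
    Module.length R (M ⧸ 𝔞 • (⊤ : Submodule R M)) ≠ ⊤ :=
  Module.length_ne_top_iff.mpr h.isFiniteLength

end Length

/-! ### Upper polynomial bounds for colengths -/

section Growth
open IsLocalRing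

variable {R M : Type*} [CommRing R] [AddCommGroup M] [Module R M]

/-- Multiplication by `x` maps `M/(x^n, 𝔟)M` to `M/(x^(n+1), 𝔟)M` with cokernel `M/(x, 𝔟)M`, so each
step adds at most one copy of the latter. -/
theorem length_quotient_span_pow_sup_le (𝔟 : Ideal R) (x : R) (n : ℕ) :
    Module.length R (M ⧸ (Ideal.span {x ^ n} ⊔ 𝔟) • (⊤ : Submodule R M)) ≤
      n * Module.length R (M ⧸ (Ideal.span {x} ⊔ 𝔟) • (⊤ : Submodule R M)) := by
  induction n with
  | zero =>
    rw [pow_zero, Ideal.span_singleton_one, top_sup_eq, Submodule.top_smul]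
    simp
  | succ n ih =>
    have h := length_quotient_le_add (LinearMap.lsmul R M x)
      ((Ideal.span {x ^ n} ⊔ 𝔟) • (⊤ : Submodule R M))
      ((Ideal.span {x ^ (n + 1)} ⊔ 𝔟) • (⊤ : Submodule R M)) ?_
    · refine h.trans ?_
      push_cast
      rw [add_mul, one_mul]
      refine add_le_add ih (length_quotient_anti ?_)
      rw [Submodule.sup_smul]
      refine sup_le ?_ ?_
      · refine le_sup_of_le_right ?_
        rw [Submodule.smul_le]
        intro r hr m _
        obtain ⟨a, rfl⟩ := Ideal.mem_span_singleton'.mp hr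
        exact ⟨a • m, by simp [mul_smul]⟩
      · exact le_sup_of_le_left (Submodule.smul_mono_left le_sup_right)
    · rw [Submodule.smul_le]
      intro r hr m _
      rw [Submodule.mem_comap, LinearMap.lsmul_apply, smul_smul]
      refine Submodule.smul_mem_smul ?_ trivial
      rw [Submodule.mem_sup] at hr ⊢
      obtain ⟨a, ha, b, hb, rfl⟩ := hr
      refine ⟨x * a, ?_, x * b, 𝔟.mul_mem_left _ hb, by ring⟩
      obtain ⟨c, rfl⟩ := Ideal.mem_span_singleton'.mp ha
      exact Ideal.mem_span_singleton'.mpr ⟨c, by ring⟩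

theorem length_quotient_span_image_pow_sup_le (s : Finset R) (n : ℕ) (𝔟 : Ideal R) :
    Module.length R (M ⧸ (Ideal.span ((· ^ n) '' (s : Set R)) ⊔ 𝔟) • (⊤ : Submodule R M)) ≤
      n ^ s.card * Module.length R (M ⧸ (Ideal.span (s : Set R) ⊔ 𝔟) • (⊤ : Submodule R M)) := by
  classical
  induction s using Finset.induction_on generalizing 𝔟 with
  | empty =>
    rw [Finset.coe_empty, Set.image_empty, Finset.card_empty, pow_zero, one_mul]
  | insert x s hx ih =>
    rw [Finset.card_insert_of_notMem hx, Finset.coe_insert, Set.image_insert_eq,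
      Ideal.span_insert, Ideal.span_insert, sup_comm (Ideal.span {x ^ n}), sup_assoc]
    refine (ih _).trans ?_
    rw [pow_succ, mul_assoc]
    refine mul_le_mul_right ?_ _
    have := length_quotient_span_pow_sup_le (M := M) (Ideal.span (s : Set R) ⊔ 𝔟) x n
    rw [sup_left_comm]
    refine this.trans (le_of_eq ?_)
    rw [sup_assoc]

variable [IsNoetherianRing R] [IsLocalRing R]

/-- Heights are finite in a Noetherian ring, so the truncations in `natDim` lose nothing. -/
theorem natDim_eq_height : ((natDim R : ℕ) : ℕ∞) = (maximalIdeal R).height := by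
  have h := maximalIdeal_height_eq_ringKrullDim (R := R)
  have hlt : (maximalIdeal R).height ≠ ⊤ := Ideal.height_ne_top (maximalIdeal.isMaximal R).ne_top
  rw [natDim, ← h, WithBot.unbotD_coe, ENat.natCast_toNat hlt]

theorem natDim_eq_ringKrullDim : ((natDim R : ℕ) : WithBot ℕ∞) = ringKrullDim R := by
  rw [← maximalIdeal_height_eq_ringKrullDim, ← natDim_eq_height]
  rfl

theorem exists_system_of_parameters : ∃ t : Finset R, t.card = natDim R ∧
    (t : Set R) ⊆ maximalIdeal R ∧ ContainsMaximalPow (Ideal.span (t : Set R)) := by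
  obtain ⟨s, hs, hc⟩ := Ideal.exists_finset_card_eq_height_of_isNoetherianRing (maximalIdeal R)
  refine ⟨s, ?_, ?_, ?_⟩
  · rw [← natDim_eq_height] at hc
    exact_mod_cast hc
  · exact Ideal.subset_span.trans hs.1.2
  · refine containsMaximalPow_of_forall_isPrime fun P hP hle => ?_
    exact le_antisymm (le_maximalIdeal hP.ne_top) (hs.2 ⟨hP, hle⟩ (le_maximalIdeal hP.ne_top))

theorem exists_system_of_parameters_quotient (𝔟 : Ideal R) (h𝔟 : 𝔟 ≠ ⊤) : ∃ t : Finset R,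
    t.card ≤ natDim (R ⧸ 𝔟) ∧ (t : Set R) ⊆ maximalIdeal R ∧
      ContainsMaximalPow (Ideal.span (t : Set R) ⊔ 𝔟) := by
  classical
  have : Nontrivial (R ⧸ 𝔟) := Ideal.Quotient.nontrivial_iff.mpr h𝔟
  have : IsLocalRing (R ⧸ 𝔟) := IsLocalRing.of_surjective' _ Ideal.Quotient.mk_surjective
  have hm : (maximalIdeal R).map (Ideal.Quotient.mk 𝔟) = maximalIdeal (R ⧸ 𝔟) :=
    map_maximalIdeal_of_surjective _ Ideal.Quotient.mk_surjective
  obtain ⟨t, ht, htm, c, hc⟩ := exists_system_of_parameters (R := R ⧸ 𝔟)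
  have hout : ∀ y : R ⧸ 𝔟, Ideal.Quotient.mk 𝔟 (Quotient.out y) = y := fun y => Quotient.out_eq' y
  refine ⟨t.image Quotient.out, Finset.card_image_le.trans ht.le, ?_, c, ?_⟩
  · intro x hx
    obtain ⟨y, hy, rfl⟩ := Finset.mem_image.mp (Finset.mem_coe.mp hx)
    have h1 := htm hy
    have := IsLocalHom.of_surjective (Ideal.Quotient.mk 𝔟) Ideal.Quotient.mk_surjective
    have h2 := IsLocalRing.maximalIdeal_comap (Ideal.Quotient.mk 𝔟)
    rw [SetLike.mem_coe, ← h2, Ideal.mem_comap, hout]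
    exact h1
  · have h1 : (maximalIdeal R ^ c).map (Ideal.Quotient.mk 𝔟) ≤
        (Ideal.span ((t.image Quotient.out : Finset R) : Set R)).map (Ideal.Quotient.mk 𝔟) := by
      rw [Ideal.map_pow, hm]
      refine hc.trans ?_
      rw [Ideal.map_span, Ideal.span_le]
      intro y hy
      exact Ideal.subset_span ⟨Quotient.out y, Finset.mem_coe.mpr (Finset.mem_image_of_mem _ hy),
        hout y⟩
    intro x hx
    have h2 := h1 (Ideal.mem_map_of_mem _ hx)
    rw [Ideal.mem_map_iff_of_surjective _ Ideal.Quotient.mk_surjective] at h2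
    obtain ⟨y, hy, hyx⟩ := h2
    rw [Ideal.Quotient.eq] at hyx
    have : x = y - (y - x) := by ring
    rw [this]
    exact Ideal.sub_mem _ (Ideal.mem_sup_left hy) (Ideal.mem_sup_right hyx)

/-- Polynomial growth, of degree the dimension of `R/𝔟`, of colengths on a module killed by `𝔟`. -/
theorem exists_length_quotient_le [Module.Finite R M] (𝔟 : Ideal R) (h𝔟 : 𝔟 ≠ ⊤)
    (hM : 𝔟 • (⊤ : Submodule R M) = ⊥) {J : Ideal R} (hJ : ContainsMaximalPow J) :
    ∃ C : ℕ, ∀ (n : ℕ) (𝔠 : Ideal R), (∀ x ∈ J, x ^ n ∈ 𝔠) →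
      Module.length R (M ⧸ 𝔠 • (⊤ : Submodule R M)) ≤ ((C * n ^ natDim (R ⧸ 𝔟) : ℕ) : ℕ∞) := by
  obtain ⟨t, ht, htm, hc'⟩ := exists_system_of_parameters_quotient 𝔟 h𝔟
  obtain ⟨c, hc⟩ := hJ
  obtain ⟨ℓ, hℓ⟩ := ENat.ne_top_iff_exists.mp (hc'.length_ne_top (M := M))
  refine ⟨(c + 1) ^ natDim (R ⧸ 𝔟) * ℓ, fun n 𝔠 h𝔠 => ?_⟩
  rcases Nat.eq_zero_or_pos n with rfl | hn
  · have h1 : 𝔠 = ⊤ := by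
      rw [Ideal.eq_top_iff_one]
      simpa using h𝔠 0 J.zero_mem
    subst h1
    rw [Submodule.top_smul, length_quotient_top]
    exact zero_le
  -- For a parameter `x`, the power `x ^ (c + 1)` lies in `J`, so its `n`-th power lies in `𝔠`.
  -- Having `c + 1` rather than `c` makes the base `(c + 1) * n` positive, as needed to raise the
  -- exponent from `t.card` to the dimension.
  have hle : (Ideal.span ((· ^ ((c + 1) * n)) '' (t : Set R)) ⊔ 𝔟) • (⊤ : Submodule R M) ≤
      𝔠 • (⊤ : Submodule R M) := by
    rw [Submodule.sup_smul, hM, sup_bot_eq]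
    refine Submodule.smul_mono_left ?_
    rw [Ideal.span_le]
    rintro _ ⟨x, hx, rfl⟩
    change x ^ ((c + 1) * n) ∈ 𝔠
    rw [pow_mul]
    refine h𝔠 _ (hc (Ideal.pow_le_pow_right c.le_succ (Ideal.pow_mem_pow (htm hx) _)))
  refine (length_quotient_anti hle).trans ((length_quotient_span_image_pow_sup_le t _ 𝔟).trans ?_)
  rw [← hℓ]
  norm_cast
  calc ((c + 1) * n) ^ t.card * ℓ ≤ ((c + 1) * n) ^ natDim (R ⧸ 𝔟) * ℓ :=
        Nat.mul_le_mul_right _ (Nat.pow_le_pow_right (Nat.mul_pos c.succ_pos hn) ht)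
    _ = _ := by rw [mul_pow]; ring

end Growth

/-! ### Integer sequences whose iterated differences vanish eventually -/

section EventuallyMonotone

/-- An integer sequence with eventually vanishing iterated differences is eventually monotone or
eventually antitone. -/
theorem eventually_monotone_or_antitone (r n₀ : ℕ) (h : ℕ → ℤ)
    (hr : ∀ n ≥ n₀, (fwdDiff 1)^[r] h n = 0) :
    ∃ n₁, (∀ n ≥ n₁, h n ≤ h (n + 1)) ∨ (∀ n ≥ n₁, h (n + 1) ≤ h n) := by
  induction r generalizing h with
  | zero => exact ⟨n₀, Or.inl fun n hn => by
      have h1 := hr n hn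
      have h2 := hr (n + 1) (by omega)
      simp only [Function.iterate_zero, id] at h1 h2
      rw [h1, h2]⟩
  | succ r ih =>
    have hd : ∀ n, fwdDiff 1 h n = h (n + 1) - h n := fun n => rfl
    obtain ⟨n₁, hn₁⟩ := ih (fwdDiff 1 h) (fun n hn => by
      rw [← Function.iterate_succ_apply]; exact hr n hn)
    rcases hn₁ with hn₁ | hn₁
    -- A monotone difference either becomes nonnegative once and stays so, or is always negative
    -- from `n₁` on.
    · have hmono : ∀ m n, n₁ ≤ m → m ≤ n → fwdDiff 1 h m ≤ fwdDiff 1 h n := by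
        intro m n hm hmn
        induction n, hmn using Nat.le_induction with
        | base => exact le_rfl
        | succ n hmn' ih' => exact ih'.trans (hn₁ n (hm.trans hmn'))
      by_cases hex : ∃ m ≥ n₁, 0 ≤ fwdDiff 1 h m
      · obtain ⟨m, hm, h0⟩ := hex
        exact ⟨m, Or.inl fun n hn => by
          have := hmono m n hm hn
          rw [hd n] at this
          linarith⟩
      · push Not at hex
        exact ⟨n₁, Or.inr fun n hn => by
          have := hex n hn
          rw [hd n] at this
          linarith⟩
    · have hanti : ∀ m n, n₁ ≤ m → m ≤ n → fwdDiff 1 h n ≤ fwdDiff 1 h m := by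
        intro m n hm hmn
        induction n, hmn using Nat.le_induction with
        | base => exact le_rfl
        | succ n hmn' ih' => exact (hn₁ n (hm.trans hmn')).trans ih'
      by_cases hex : ∃ m ≥ n₁, fwdDiff 1 h m ≤ 0
      · obtain ⟨m, hm, h0⟩ := hex
        exact ⟨m, Or.inr fun n hn => by
          have := hanti m n hm hn
          rw [hd n] at this
          linarith⟩
      · push Not at hex
        exact ⟨n₁, Or.inl fun n hn => by
          have := hex n hn
          rw [hd n] at this
          linarith⟩

theorem iterate_fwdDiff_eq_zero_of_le {r r' n₀ : ℕ} {h : ℕ → ℤ} (hrr : r ≤ r')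
    (hr : ∀ n ≥ n₀, (fwdDiff 1)^[r] h n = 0) : ∀ n ≥ n₀, (fwdDiff 1)^[r'] h n = 0 := by
  induction r', hrr using Nat.le_induction with
  | base => exact hr
  | succ r' _ ih =>
    intro n hn
    rw [Function.iterate_succ_apply']
    change (fwdDiff 1)^[r'] h (n + 1) - (fwdDiff 1)^[r'] h n = 0
    rw [ih n hn, ih (n + 1) (by omega), sub_zero]

theorem iterate_fwdDiff_sub (r : ℕ) (f g : ℕ → ℤ) :
    (fwdDiff 1)^[r] (f - g) = (fwdDiff 1)^[r] f - (fwdDiff 1)^[r] g := by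
  induction r generalizing f g with
  | zero => rfl
  | succ r ih =>
    rw [Function.iterate_succ_apply, Function.iterate_succ_apply, Function.iterate_succ_apply,
      ← ih]
    congr 1
    ext n
    simp only [fwdDiff, Pi.sub_apply]
    ring

/-- The increments of a sequence bounded by `C n ^ d` are bounded by a multiple of `n ^ d / n`,
as soon as they are eventually monotone or antitone. -/
theorem exists_increment_mul_le (u : ℕ → ℕ) (hu : Monotone u) (C d : ℕ)
    (hC : ∀ n, u n ≤ C * n ^ d) (n₁ : ℕ)
    (h : (∀ n ≥ n₁, u (n + 1) - u n ≤ u (n + 2) - u (n + 1)) ∨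
      (∀ n ≥ n₁, u (n + 2) - u (n + 1) ≤ u (n + 1) - u n)) :
    ∃ C', ∀ n, (u (n + 1) - u n) * n ≤ C' * n ^ d := by
  have key : ∀ n ≥ 2 * n₁, (u (n + 1) - u n) * n ≤ (2 ^ d * C * 2) * n ^ d := by
    intro n hn
    rcases h with h | h
    -- Growing increments: the `n` increments from `n` to `2n` are all at least the one at `n`, and
    -- they sum to at most `u (2n)`.
    · have hle : ∀ m, n ≤ m → u (n + 1) - u n ≤ u (m + 1) - u m := by
        intro m hm
        induction m, hm using Nat.le_induction with
        | base => exact le_rfl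
        | succ m hm ih => exact ih.trans (h m (by omega))
      have hsum : ∀ k, k * (u (n + 1) - u n) ≤ u (n + k) - u n := by
        intro k
        induction k with
        | zero => simp
        | succ k ih =>
          have h1 := hle (n + k) (by omega)
          have h2 := hu (show n ≤ n + k by omega)
          have h3 := hu (show n + k ≤ n + k + 1 by omega)
          rw [add_mul, one_mul, ← add_assoc]
          omega
      calc (u (n + 1) - u n) * n = n * (u (n + 1) - u n) := mul_comm _ _
        _ ≤ u (n + n) := (hsum n).trans (Nat.sub_le _ _)
        _ ≤ C * (n + n) ^ d := hC _
        _ = 2 ^ d * C * n ^ d := by rw [← two_mul, mul_pow]; ring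
        _ ≤ _ := Nat.mul_le_mul_right _ (Nat.le_mul_of_pos_right _ (by norm_num))
    -- Shrinking increments: those from `n / 2` to `n` are all at least the one at `n`, and they sum
    -- to at most `u n`. The assumption `n ≥ 2 * n₁` puts `n / 2` in the range of antitonicity.
    · have hle : ∀ m, n₁ ≤ m → m ≤ n → u (n + 1) - u n ≤ u (m + 1) - u m := by
        intro m hm hmn
        have : ∀ j, m ≤ j → u (j + 1) - u j ≤ u (m + 1) - u m := by
          intro j hj
          induction j, hj using Nat.le_induction with
          | base => exact le_rfl
          | succ j hj ih => exact (h j (by omega)).trans ih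
        exact this n hmn
      have hsum : ∀ k, k ≤ n - n / 2 → k * (u (n + 1) - u n) ≤ u (n / 2 + k) - u (n / 2) := by
        intro k
        induction k with
        | zero => simp
        | succ k ih =>
          intro hk
          have h0 := ih (by omega)
          have h1 := hle (n / 2 + k) (by omega) (by omega)
          have h2 := hu (show n / 2 ≤ n / 2 + k by omega)
          have h3 := hu (show n / 2 + k ≤ n / 2 + k + 1 by omega)
          rw [add_mul, one_mul, ← add_assoc]
          omega
      have h4 := hsum (n - n / 2) le_rfl
      rw [show n / 2 + (n - n / 2) = n by omega] at h4
      have h5 : n ≤ 2 * (n - n / 2) := by omega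
      calc (u (n + 1) - u n) * n ≤ (u (n + 1) - u n) * (2 * (n - n / 2)) :=
            Nat.mul_le_mul_left _ h5
        _ = 2 * ((n - n / 2) * (u (n + 1) - u n)) := by ring
        _ ≤ 2 * u n := Nat.mul_le_mul_left _ (h4.trans (Nat.sub_le _ _))
        _ ≤ 2 * (C * n ^ d) := Nat.mul_le_mul_left _ (hC _)
        _ = (1 * C * 2) * n ^ d := by ring
        _ ≤ (2 ^ d * C * 2) * n ^ d := by gcongr; exact Nat.one_le_two_pow
  refine ⟨2 ^ d * C * 2 + ∑ n ∈ Finset.range (2 * n₁), (u (n + 1) - u n) * n, fun n => ?_⟩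
  rcases le_or_gt (2 * n₁) n with hn | hn
  · exact (key n hn).trans (Nat.mul_le_mul_right _ (Nat.le_add_right _ _))
  · rcases Nat.eq_zero_or_pos n with rfl | hpos
    · simp
    · calc (u (n + 1) - u n) * n ≤ ∑ n ∈ Finset.range (2 * n₁), (u (n + 1) - u n) * n :=
            Finset.single_le_sum (f := fun n => (u (n + 1) - u n) * n)
              (fun _ _ => Nat.zero_le _) (Finset.mem_range.mpr hn)
        _ ≤ 2 ^ d * C * 2 + ∑ n ∈ Finset.range (2 * n₁), (u (n + 1) - u n) * n :=
            Nat.le_add_left _ _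
        _ ≤ _ := Nat.le_mul_of_pos_right _ (by positivity)

end EventuallyMonotone

/-! ### Hilbert functions of stable filtrations -/

section HilbertFunction
open IsLocalRing

variable {R M : Type*} [CommRing R] [AddCommGroup M] [Module R M]

/-- The length of `M / N` as a natural number. -/
noncomputable def colen (N : Submodule R M) : ℕ := (Module.length R (M ⧸ N)).toNat

theorem coe_colen {N : Submodule R M} (h : Module.length R (M ⧸ N) ≠ ⊤) :
    (colen N : ℕ∞) = Module.length R (M ⧸ N) := ENat.natCast_toNat h

theorem length_quotient_ne_top_of_le {N N' : Submodule R M} (hle : N ≤ N')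
    (h : Module.length R (M ⧸ N) ≠ ⊤) : Module.length R (M ⧸ N') ≠ ⊤ :=
  ne_top_of_le_ne_top h (length_quotient_anti hle)

theorem colen_anti {N N' : Submodule R M} (hle : N ≤ N')
    (h : Module.length R (M ⧸ N) ≠ ⊤) : colen N' ≤ colen N :=
  ENat.toNat_le_toNat (length_quotient_anti hle) h

/-- The module `F/(F ∩ x⁻¹G)` embeds in `M/G` with cokernel `M/(G + xF)`, and in `M/(F ∩ x⁻¹G)` with
cokernel `M/F`; compare the two length formulas. -/
theorem colen_add_colen_inf_comap (x : R) (F G : Submodule R M)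
    (hF : Module.length R (M ⧸ F) ≠ ⊤) (hG : Module.length R (M ⧸ G) ≠ ⊤)
    (hK : Module.length R (M ⧸ (F ⊓ G.comap (LinearMap.lsmul R M x))) ≠ ⊤) :
    colen G + colen F = colen (F ⊓ G.comap (LinearMap.lsmul R M x)) +
      colen (G ⊔ F.map (LinearMap.lsmul R M x)) := by
  have h1 := length_quotient_eq_add (LinearMap.lsmul R M x ∘ₗ F.subtype) G
  have h2 := length_quotient_eq_add F.subtype (F ⊓ G.comap (LinearMap.lsmul R M x))
  have h3 : (F ⊓ G.comap (LinearMap.lsmul R M x)).comap F.subtype =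
      G.comap (LinearMap.lsmul R M x ∘ₗ F.subtype) := by
    ext y
    simp
  rw [LinearMap.range_comp, Submodule.range_subtype] at h1
  rw [Submodule.range_subtype, h3, sup_eq_right.mpr inf_le_left] at h2
  have h4 := length_quotient_ne_top_of_le
    (le_sup_left : G ≤ G ⊔ F.map (LinearMap.lsmul R M x)) hG
  have h5 : Module.length R (F ⧸ G.comap (LinearMap.lsmul R M x ∘ₗ F.subtype)) ≠ ⊤ :=
    ne_top_of_le_ne_top hG (h1 ▸ le_self_add)
  rw [← coe_colen hG, ← coe_colen h4, ← ENat.natCast_toNat h5] at h1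
  rw [← coe_colen hF, ← coe_colen hK, ← ENat.natCast_toNat h5] at h2
  norm_cast at h1 h2
  omega

variable {I : Ideal R}

/-- The shift of a filtration. -/
def Ideal.Filtration.shift (F : I.Filtration M) : I.Filtration M where
  N n := F.N (n + 1)
  mono n := F.mono (n + 1)
  smul_le n := F.smul_le (n + 1)

theorem Ideal.Filtration.Stable.shift {F : I.Filtration M} (h : F.Stable) : F.shift.Stable := by
  obtain ⟨n₀, hn⟩ := h
  exact ⟨n₀, fun n hn' => hn (n + 1) (by omega)⟩

/-- The filtration of the elements of `F` multiplied into `G` by an element of degree one. -/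
def Ideal.Filtration.colon (F G : I.Filtration M) (x : R) : I.Filtration M where
  N n := F.N n ⊓ (G.N (n + 1)).comap (LinearMap.lsmul R M x)
  mono n := inf_le_inf (F.mono n) (Submodule.comap_mono (G.mono (n + 1)))
  smul_le n := by
    rw [Submodule.smul_le]
    rintro r hr m ⟨hm1, hm2⟩
    refine ⟨F.smul_le n (Submodule.smul_mem_smul hr hm1), ?_⟩
    have := G.smul_le (n + 1) (Submodule.smul_mem_smul hr hm2)
    simpa [smul_smul, mul_comm] using this

/-- The filtration `G_{n+1} + x F_n`. -/
def Ideal.Filtration.addMul (F G : I.Filtration M) (x : R) : I.Filtration M where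
  N n := G.N (n + 1) ⊔ (F.N n).map (LinearMap.lsmul R M x)
  mono n := sup_le_sup (G.mono (n + 1)) (Submodule.map_mono (F.mono n))
  smul_le n := by
    rw [Submodule.smul_sup, ← Submodule.map_smul'']
    exact sup_le_sup (G.smul_le (n + 1)) (Submodule.map_mono (F.smul_le n))

/-- The Hilbert function of a subquotient of stable filtrations is eventually polynomial, in the
sense that its iterated differences vanish eventually. -/
theorem exists_iterate_fwdDiff_colen_eq_zero [IsNoetherianRing R] [Module.Finite R M]
    (s : Finset R) (T : Ideal R) (F G : I.Filtration M) (hF : F.Stable)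
    (hGF : ∀ n, G.N n ≤ F.N n) (hG : ∀ n, Module.length R (M ⧸ G.N n) ≠ ⊤)
    (hs : (s : Set R) ⊆ I) (hI : I ≤ Ideal.span (s : Set R) ⊔ T)
    (hT : ∀ n, T • F.N n ≤ G.N (n + 1)) :
    ∃ r n₀, ∀ n ≥ n₀,
      (fwdDiff 1)^[r] (fun n => (colen (G.N n) : ℤ) - colen (F.N n)) n = 0 := by
  classical
  induction s using Finset.induction_on generalizing T F G with
  | empty =>
    obtain ⟨n₀, hn₀⟩ := hF
    refine ⟨0, n₀ + 1, fun n hn => ?_⟩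
    obtain ⟨n, rfl⟩ : ∃ m, n = m + 1 := ⟨n - 1, by omega⟩
    have h1 : F.N (n + 1) ≤ G.N (n + 1) := by
      rw [← hn₀ n (by omega)]
      refine (Submodule.smul_mono_left (hI.trans ?_)).trans (hT n)
      simp
    simp [le_antisymm h1 (hGF _)]
  | insert x s hx ih =>
    rw [Finset.coe_insert, Set.insert_subset_iff] at hs
    have hxF : ∀ n, (F.N n).map (LinearMap.lsmul R M x) ≤ F.N (n + 1) := by
      rintro n _ ⟨m, hm, rfl⟩
      exact F.smul_le n (Submodule.smul_mem_smul hs.1 hm)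
    have hGK : ∀ n, G.N n ≤ (F.colon G x).N n := fun n =>
      le_inf (hGF n) fun m hm => G.smul_le n (Submodule.smul_mem_smul hs.1 hm)
    have hI' : I ≤ Ideal.span (s : Set R) ⊔ (Ideal.span {x} ⊔ T) := by
      rwa [← sup_assoc, sup_comm (Ideal.span (s : Set R)), ← Ideal.span_insert, ← Finset.coe_insert]
    have hspan : ∀ N : Submodule R M, Ideal.span {x} • N = N.map (LinearMap.lsmul R M x) := by
      intro N
      rw [Submodule.ideal_span_singleton_smul]
      rfl
    -- Multiplication by `x` from `F_n/G_n` to `F_(n+1)/G_(n+1)` has kernel given by `colon` and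
    -- cokernel given by `addMul`. Both are killed by `x`, so `x` can move from the generators into
    -- `T`. The first difference of the Hilbert function is the cokernel's minus the kernel's.
    obtain ⟨r₁, n₁, h₁⟩ := ih (Ideal.span {x} ⊔ T) (F.colon G x) G
      (hF.of_le (F' := F.colon G x) (fun n => inf_le_left)) hGK hG hs.2 hI' (fun n => by
        rw [Submodule.sup_smul, hspan]
        refine sup_le (Submodule.map_le_iff_le_comap.mpr inf_le_right) ?_
        exact (Submodule.smul_mono le_rfl inf_le_left).trans (hT n))
    obtain ⟨r₂, n₂, h₂⟩ := ih (Ideal.span {x} ⊔ T) F.shift (F.addMul G x)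
      hF.shift (fun n => sup_le (hGF (n + 1)) (hxF n))
      (fun n => length_quotient_ne_top_of_le le_sup_left (hG (n + 1))) hs.2 hI' (fun n => by
        rw [Submodule.sup_smul, hspan]
        exact sup_le le_sup_right ((hT (n + 1)).trans le_sup_left))
    refine ⟨max r₁ r₂ + 1, max n₁ n₂, fun n hn => ?_⟩
    have h3 : fwdDiff 1 (fun n => (colen (G.N n) : ℤ) - colen (F.N n)) =
        (fun n => (colen ((F.addMul G x).N n) : ℤ) - colen (F.shift.N n)) -
        (fun n => (colen (G.N n) : ℤ) - colen ((F.colon G x).N n)) := by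
      ext n
      have h4 := colen_add_colen_inf_comap x (F.N n) (G.N (n + 1))
        (length_quotient_ne_top_of_le (hGF n) (hG n)) (hG (n + 1))
        (length_quotient_ne_top_of_le (hGK n) (hG n))
      simp only [fwdDiff, Pi.sub_apply, Ideal.Filtration.addMul, Ideal.Filtration.shift,
        Ideal.Filtration.colon]
      zify at h4
      linarith
    rw [Function.iterate_succ_apply, h3, iterate_fwdDiff_sub, Pi.sub_apply,
      iterate_fwdDiff_eq_zero_of_le (le_max_left _ _) h₁ n (le_of_max_le_left hn),
      iterate_fwdDiff_eq_zero_of_le (le_max_right _ _) h₂ n (le_of_max_le_right hn), sub_zero]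

/-- The length of `I ^ n M / I ^ (n + 1) M` is at most of the order `n ^ (dim R - 1)`. -/
theorem exists_colen_pow_succ_sub_mul_le [IsNoetherianRing R] [IsLocalRing R] [Module.Finite R M]
    (hI : ContainsMaximalPow I) : ∃ C : ℕ, ∀ n,
      (colen (I ^ (n + 1) • (⊤ : Submodule R M)) - colen (I ^ n • (⊤ : Submodule R M))) * n ≤
        C * n ^ natDim R := by
  obtain ⟨s, hs⟩ := (IsNoetherian.noetherian I : I.FG)
  have hfin : ∀ n, Module.length R (M ⧸ I ^ n • (⊤ : Submodule R M)) ≠ ⊤ :=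
    fun n => (hI.pow n).length_ne_top
  have hst := I.stableFiltration_stable (⊤ : Submodule R M)
  -- With `F_n = I^n M` and `G` its shift, the Hilbert function is the increment of the colength,
  -- which is therefore eventually monotone or antitone.
  obtain ⟨r, n₀, h⟩ := exists_iterate_fwdDiff_colen_eq_zero s ⊥
    (I.stableFiltration (⊤ : Submodule R M)) (I.stableFiltration (⊤ : Submodule R M)).shift hst
    (fun n => (I.stableFiltration _).mono n) (fun n => hfin (n + 1))
    (by rw [← hs]; exact Ideal.subset_span) (by rw [sup_bot_eq, ← hs])
    (fun n => by rw [Submodule.bot_smul]; exact bot_le)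
  obtain ⟨n₁, hn₁⟩ := eventually_monotone_or_antitone r n₀ _ h
  obtain ⟨C, hC⟩ := exists_length_quotient_le (M := M) (⊥ : Ideal R) bot_ne_top
    (Submodule.bot_smul _) hI
  have hdim : natDim (R ⧸ (⊥ : Ideal R)) = natDim R := by
    rw [natDim, natDim, ringKrullDim_eq_of_ringEquiv (RingEquiv.quotientBot R)]
  rw [hdim] at hC
  have hmono : Monotone fun n => colen (I ^ n • (⊤ : Submodule R M)) := fun a b hab =>
    colen_anti (Submodule.smul_mono_left (Ideal.pow_le_pow_right hab)) (hfin b)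
  refine exists_increment_mul_le (fun n => colen (I ^ n • (⊤ : Submodule R M))) hmono C _
    (fun n => ?_) n₁ ?_
  · have := hC n (I ^ n) fun x hx => Ideal.pow_mem_pow hx n
    rw [← coe_colen (hfin n)] at this
    exact_mod_cast this
  · simp only [Ideal.Filtration.shift, Ideal.stableFiltration] at hn₁
    refine hn₁.imp (fun H n hn => ?_) (fun H n hn => ?_)
    all_goals
      have h1 := H n hn
      have h2 := hmono (show n ≤ n + 1 by omega)
      have h3 := hmono (show n + 1 ≤ n + 1 + 1 by omega)
      simp only at h2 h3 ⊢
      rw [show n + 2 = n + 1 + 1 from rfl]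
      omega

/-- The module `(N₂ + N)/(N₁ + N)` is a quotient of `N₂/N₁`, so adding `N` cannot widen the gap. -/
theorem colen_sup_le_add {N₁ N₂ : Submodule R M} (h : N₁ ≤ N₂) (N : Submodule R M)
    (h₁ : Module.length R (M ⧸ N₁) ≠ ⊤) :
    colen (N₁ ⊔ N) ≤ colen (N₂ ⊔ N) + (colen N₁ - colen N₂) := by
  have e1 := length_quotient_eq_add N₂.subtype N₁
  have e2 := length_quotient_eq_add N₂.subtype (N₁ ⊔ N)
  rw [Submodule.range_subtype, sup_eq_right.mpr h] at e1
  rw [Submodule.range_subtype, sup_right_comm, sup_eq_right.mpr h] at e2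
  have h2 := length_quotient_ne_top_of_le h h₁
  have h3 := length_quotient_ne_top_of_le (le_sup_left : N₁ ≤ N₁ ⊔ N) h₁
  have h4 := length_quotient_ne_top_of_le (le_sup_left : N₂ ≤ N₂ ⊔ N) h2
  have h5 : Module.length R (N₂ ⧸ N₁.comap N₂.subtype) ≠ ⊤ :=
    ne_top_of_le_ne_top h₁ (e1 ▸ le_self_add)
  have h6 : Module.length R (N₂ ⧸ (N₁ ⊔ N).comap N₂.subtype) ≠ ⊤ :=
    ne_top_of_le_ne_top h3 (e2 ▸ le_self_add)
  have h7 : Module.length R (N₂ ⧸ (N₁ ⊔ N).comap N₂.subtype) ≤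
      Module.length R (N₂ ⧸ N₁.comap N₂.subtype) :=
    length_quotient_anti (Submodule.comap_mono le_sup_left)
  rw [← coe_colen h₁, ← coe_colen h2, ← ENat.natCast_toNat h5] at e1
  rw [← coe_colen h3, ← coe_colen h4, ← ENat.natCast_toNat h6] at e2
  rw [← ENat.natCast_toNat h5, ← ENat.natCast_toNat h6] at h7
  norm_cast at e1 e2 h7
  omega

end HilbertFunction

/-! ### Lower polynomial bounds for colengths -/

section LowerGrowth
open IsLocalRing

variable {R M : Type*} [CommRing R] [AddCommGroup M] [Module R M]

/-- Multiplication by an element acting injectively gives a recursion for colengths of powers. -/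
theorem exists_colen_pow_add_le [IsNoetherianRing R] [Module.Finite R M] (I : Ideal R) (x : R)
    (hx : Function.Injective (LinearMap.lsmul R M x)) : ∃ k, ∀ n,
      Module.length R (M ⧸ I ^ n • (⊤ : Submodule R M)) +
        Module.length R (M ⧸ (I ^ (n + k) • (⊤ : Submodule R M) ⊔
          LinearMap.range (LinearMap.lsmul R M x))) ≤
      Module.length R (M ⧸ I ^ (n + k) • (⊤ : Submodule R M)) := by
  -- Artin–Rees: `x m ∈ I^(n+k) M` implies `x m ∈ x I^n M`, hence `m ∈ I^n M` by injectivity.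
  obtain ⟨k, hk⟩ := Ideal.exists_pow_inf_eq_pow_smul I (LinearMap.range (LinearMap.lsmul R M x))
  refine ⟨k, fun n => ?_⟩
  rw [length_quotient_eq_add (LinearMap.lsmul R M x) (I ^ (n + k) • (⊤ : Submodule R M))]
  refine add_le_add_left (length_quotient_anti ?_) _
  intro m hm
  have h1 : LinearMap.lsmul R M x m ∈
      I ^ (n + k) • ⊤ ⊓ LinearMap.range (LinearMap.lsmul R M x) := ⟨hm, m, rfl⟩
  rw [hk (n + k) (by omega), Nat.add_sub_cancel] at h1
  have h2 := (Submodule.smul_mono le_rfl inf_le_right :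
    I ^ n • (I ^ k • ⊤ ⊓ LinearMap.range (LinearMap.lsmul R M x)) ≤ _) h1
  rw [LinearMap.range_eq_map, ← Submodule.map_smul''] at h2
  obtain ⟨m', hm', h3⟩ := h2
  rwa [← hx h3]

theorem sub_pow_succ_le (d : ℕ) (x y : ℝ) (hx : 0 ≤ x) (hy : 0 ≤ y) :
    (x + y) ^ (d + 1) ≤ x ^ (d + 1) + (d + 1) * y * (x + y) ^ d := by
  induction d with
  | zero => simp
  | succ d ih =>
    calc (x + y) ^ (d + 1 + 1) = (x + y) ^ (d + 1) * (x + y) := pow_succ _ _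
      _ ≤ (x ^ (d + 1) + (d + 1) * y * (x + y) ^ d) * (x + y) := by gcongr
      _ = x ^ (d + 1 + 1) + (x ^ (d + 1) * y + (d + 1) * y * (x + y) ^ (d + 1)) := by ring
      _ ≤ x ^ (d + 1 + 1) + ((x + y) ^ (d + 1) * y + (d + 1) * y * (x + y) ^ (d + 1)) := by
        gcongr; linarith
      _ = _ := by push_cast; ring

/-- A gain of `c n^d` every `k` steps sums to growth of degree `d + 1`. -/
theorem exists_mul_pow_succ_le (u : ℕ → ℝ) (d k : ℕ) (c : ℝ) (hc : 0 < c)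
    (h0 : ∀ n, 1 ≤ n → c ≤ u n) (h0' : 0 ≤ u 0)
    (h : ∀ n, 1 ≤ n + k → u n + c * ((n + k : ℕ) : ℝ) ^ d ≤ u (n + k)) :
    ∃ c' : ℝ, 0 < c' ∧ ∀ n : ℕ, 1 ≤ n → c' * (n : ℝ) ^ (d + 1) ≤ u n := by
  have hk0 : k ≠ 0 := by
    rintro rfl
    have := h 1 le_rfl
    simp only [add_zero, Nat.cast_one, one_pow, mul_one] at this
    linarith
  have hk : (1 : ℝ) ≤ k := by exact_mod_cast Nat.one_le_iff_ne_zero.mpr hk0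
  -- Chosen to meet two demands: `c' (d + 1) k ≤ c` for the step from `m` to `m + k`, and `c'
  -- k^(d+1) ≤ c` for the initial range `n < k`.
  set c' := c / ((d + 1) * k ^ (d + 1)) with hc'
  have hpos : 0 < c' := by positivity
  have hc1 : c' * ((d + 1) * k) ≤ c := by
    rw [hc', div_mul_eq_mul_div, div_le_iff₀ (by positivity)]
    gcongr
    exact le_self_pow₀ hk (by omega)
  have hc2 : c' * (k : ℝ) ^ (d + 1) ≤ c := by
    rw [hc', div_mul_eq_mul_div, div_le_iff₀ (by positivity)]
    gcongr
    have : (0 : ℝ) ≤ d := by positivity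
    nlinarith [show (0 : ℝ) < (k : ℝ) ^ (d + 1) by positivity]
  refine ⟨c', hpos, ?_⟩
  have key : ∀ n : ℕ, c' * (n : ℝ) ^ (d + 1) ≤ u n := by
    intro n
    induction n using Nat.strong_induction_on with
    | _ n ih =>
      rcases Nat.eq_zero_or_pos n with rfl | hn
      · simpa using h0'
      rcases lt_or_ge n k with hlt | hge
      · refine le_trans ?_ (h0 n hn)
        refine le_trans ?_ hc2
        gcongr
      · obtain ⟨m, rfl⟩ : ∃ m, n = m + k := ⟨n - k, by omega⟩
        refine le_trans ?_ (h m hn)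
        have h1 := ih m (by omega)
        have h2 := sub_pow_succ_le d (m : ℝ) k (by positivity) (by positivity)
        push_cast
        calc c' * ((m : ℝ) + k) ^ (d + 1)
            ≤ c' * ((m : ℝ) ^ (d + 1) + (d + 1) * k * ((m : ℝ) + k) ^ d) := by gcongr
          _ = c' * (m : ℝ) ^ (d + 1) + (c' * ((d + 1) * k)) * ((m : ℝ) + k) ^ d := by ring
          _ ≤ u m + c * ((m : ℝ) + k) ^ d := by gcongr
  exact fun n _ => key n

variable [IsNoetherianRing R] [IsLocalRing R]

theorem one_le_colen_pow [Module.Finite R M] [Nontrivial M] {n : ℕ} (hn : 1 ≤ n) :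
    1 ≤ colen (maximalIdeal R ^ n • (⊤ : Submodule R M)) := by
  rw [Nat.one_le_iff_ne_zero]
  intro h
  have h1 := coe_colen ((containsMaximalPow_maximalIdeal (R := R).pow n).length_ne_top (M := M))
  rw [h, Nat.cast_zero, eq_comm, Module.length_eq_zero_iff,
    Submodule.Quotient.subsingleton_iff] at h1
  have h2 : maximalIdeal R • (⊤ : Submodule R M) = ⊤ :=
    top_le_iff.mp (h1.ge.trans (Submodule.smul_mono_left (Ideal.pow_le_self (by omega))))
  have h3 := Submodule.eq_bot_of_le_smul_of_le_jacobson_bot (maximalIdeal R) (⊤ : Submodule R M)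
    Module.Finite.fg_top h2.ge (maximalIdeal_le_jacobson _)
  exact top_ne_bot h3

/-- Let `P` be the bottom prime of the chain and `x` an element of the next prime outside `P`. Then
`x` acts injectively on `R/P`, and the recursion turns growth of degree `d` for `R/(P + (x))` into
degree `d + 1` for `R/P`, a quotient of `R/𝔟`. -/
theorem exists_le_colen_pow_of_series (l : LTSeries (PrimeSpectrum R)) (𝔟 : Ideal R)
    (h : 𝔟 ≤ l.head.asIdeal) : ∃ c : ℝ, 0 < c ∧ ∀ n : ℕ, 1 ≤ n →
      c * (n : ℝ) ^ l.length ≤ colen (maximalIdeal R ^ n • (⊤ : Submodule R (R ⧸ 𝔟))) := by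
  obtain ⟨d, hd⟩ : ∃ d, l.length = d := ⟨_, rfl⟩
  rw [hd]
  induction d generalizing l 𝔟 with
  | zero =>
    have : Nontrivial (R ⧸ 𝔟) := Ideal.Quotient.nontrivial_iff.mpr
      (ne_top_of_le_ne_top l.head.isPrime.ne_top h)
    refine ⟨1, one_pos, fun n hn => ?_⟩
    rw [pow_zero, mul_one]
    exact_mod_cast one_le_colen_pow hn
  | succ d ih =>
    have hne : l.length ≠ 0 := by omega
    set P := l.head.asIdeal with hP
    have hPp : P.IsPrime := l.head.isPrime
    have hlt : l.head < (l.tail hne).head := by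
      rw [RelSeries.head_tail]
      exact l.strictMono (by rw [Fin.lt_def]; simp [hd])
    obtain ⟨x, hx1, hx0⟩ := SetLike.exists_of_lt (show P < (l.tail hne).head.asIdeal from hlt)
    obtain ⟨c, hc, hbound⟩ := ih (l.tail hne) (P ⊔ Ideal.span {x})
      (sup_le hlt.le (by rwa [Ideal.span_singleton_le_iff_mem])) (by simp [hd])
    have hinj : Function.Injective (LinearMap.lsmul R (R ⧸ P) x) := by
      rw [← LinearMap.ker_eq_bot, LinearMap.ker_eq_bot']
      intro y hy
      have h1 : Ideal.Quotient.mk P x * y = 0 := hy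
      rcases mul_eq_zero.mp h1 with h2 | h2
      · exact absurd (Ideal.Quotient.eq_zero_iff_mem.mp h2) hx0
      · exact h2
    obtain ⟨k, hk⟩ := exists_colen_pow_add_le (M := R ⧸ P) (maximalIdeal R) x hinj
    have hfin : ∀ n (𝔠 : Ideal R),
        Module.length R ((R ⧸ 𝔠) ⧸ maximalIdeal R ^ n • (⊤ : Submodule R (R ⧸ 𝔠))) ≠ ⊤ :=
      fun n 𝔠 => (containsMaximalPow_maximalIdeal.pow n).length_ne_top
    have hmono : ∀ n, (colen (maximalIdeal R ^ n • (⊤ : Submodule R (R ⧸ P))) : ℝ) ≤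
        colen (maximalIdeal R ^ n • (⊤ : Submodule R (R ⧸ 𝔟))) := by
      intro n
      have := length_quotient_smul_le_of_surjective (maximalIdeal R ^ n) (Submodule.factor h)
        (Submodule.factor_surjective h)
      rw [← coe_colen (hfin n _), ← coe_colen (hfin n _)] at this
      exact_mod_cast this
    obtain ⟨c', hc', hfinal⟩ := exists_mul_pow_succ_le
      (fun n => (colen (maximalIdeal R ^ n • (⊤ : Submodule R (R ⧸ P))) : ℝ)) d k (min c 1)
      (by positivity) (fun n hn => (min_le_right _ _).trans (by exact_mod_cast one_le_colen_pow hn))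
      (by positivity) (fun n hn => by
        have h1 := hk n
        have hle : maximalIdeal R ^ (n + k) • (⊤ : Submodule R (R ⧸ P)) ⊔
            LinearMap.range (LinearMap.lsmul R (R ⧸ P) x) ≤
            (maximalIdeal R ^ (n + k) • (⊤ : Submodule R (R ⧸ (P ⊔ Ideal.span {x})))).comap
              (Submodule.factor le_sup_left) := by
          refine sup_le ?_ ?_
          · rw [← Submodule.map_le_iff_le_comap, Submodule.map_smul'']
            exact Submodule.smul_mono le_rfl le_top
          · rintro _ ⟨y, rfl⟩
            obtain ⟨y, rfl⟩ := Ideal.Quotient.mk_surjective y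
            rw [Submodule.mem_comap, LinearMap.lsmul_apply, map_smul]
            convert Submodule.zero_mem _
            change Ideal.Quotient.mk _ (x * y) = 0
            rw [Ideal.Quotient.eq_zero_iff_mem]
            exact Ideal.mul_mem_right _ _
              (Ideal.mem_sup_right (Ideal.mem_span_singleton_self x))
        have h2 : Module.length R ((R ⧸ (P ⊔ Ideal.span {x})) ⧸
            maximalIdeal R ^ (n + k) • (⊤ : Submodule R (R ⧸ (P ⊔ Ideal.span {x})))) ≤
            Module.length R ((R ⧸ P) ⧸ (maximalIdeal R ^ (n + k) • (⊤ : Submodule R (R ⧸ P)) ⊔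
              LinearMap.range (LinearMap.lsmul R (R ⧸ P) x))) := by
          refine Module.length_le_of_surjective (Submodule.mapQ _ _ _ hle) ?_
          intro y
          obtain ⟨y, rfl⟩ := Submodule.Quotient.mk_surjective _ y
          obtain ⟨y, rfl⟩ := Submodule.factor_surjective (le_sup_left : P ≤ P ⊔ Ideal.span {x}) y
          exact ⟨Submodule.Quotient.mk y, rfl⟩
        have h3 := (add_le_add_right h2 _).trans h1
        rw [← coe_colen (hfin _ _), ← coe_colen (hfin _ _), ← coe_colen (hfin _ _)] at h3
        have h4 := hbound (n + k) hn
        have h5 : (min c 1) * ((n + k : ℕ) : ℝ) ^ d ≤ c * ((n + k : ℕ) : ℝ) ^ d := by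
          gcongr
          exact min_le_left _ _
        have h6 : (colen (maximalIdeal R ^ n • (⊤ : Submodule R (R ⧸ P))) : ℝ) +
            colen (maximalIdeal R ^ (n + k) • (⊤ : Submodule R (R ⧸ (P ⊔ Ideal.span {x})))) ≤
            colen (maximalIdeal R ^ (n + k) • (⊤ : Submodule R (R ⧸ P))) := by exact_mod_cast h3
        linarith)
    exact ⟨c', hc', fun n hn => (hfinal n hn).trans (hmono n)⟩

theorem exists_le_colen_pow : ∃ c : ℝ, 0 < c ∧ ∀ n : ℕ, 1 ≤ n →
    c * (n : ℝ) ^ natDim R ≤ colen (maximalIdeal R ^ n • (⊤ : Submodule R R)) := by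
  have h1 := natDim_eq_ringKrullDim (R := R)
  obtain ⟨l, hl⟩ := Order.le_krullDim_iff.mp h1.le
  obtain ⟨c, hc, h⟩ := exists_le_colen_pow_of_series l ⊥ bot_le
  refine ⟨c, hc, fun n hn => ?_⟩
  rw [← hl]
  refine (h n hn).trans ?_
  have := length_quotient_smul_le_of_surjective (maximalIdeal R ^ n) (Submodule.mkQ (⊥ : Ideal R))
    (Submodule.mkQ_surjective _)
  rw [← coe_colen (containsMaximalPow_maximalIdeal.pow n).length_ne_top,
    ← coe_colen (containsMaximalPow_maximalIdeal.pow n).length_ne_top] at this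
  exact_mod_cast this

end LowerGrowth

/-! ### Lengths along semilinear isomorphisms -/

section SemilinearLength
open IsLocalRing

/-- By `hφ` the residue field map is surjective, and restriction of scalars multiplies length by the
residue degree, here 1. It serves for Frobenius, for surjections of rings and for `R → R ⋉ M`. -/
theorem length_quotient_eq_of_semilinear {A B M M' : Type*} [CommRing A] [IsLocalRing A]
    [CommRing B] [IsLocalRing B] (φ : A →+* B) [IsLocalHom φ]
    (hφ : ∀ b, ∃ a, b - φ a ∈ maximalIdeal B) [AddCommGroup M] [Module B M]
    [AddCommGroup M'] [Module A M'] (f : M' ≃+ M) (hf : ∀ a x, f (a • x) = φ a • f x)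
    (N' : Submodule A M') (N : Submodule B M) (hN : ∀ x, x ∈ N' ↔ f x ∈ N) :
    Module.length A (M' ⧸ N') = Module.length B (M ⧸ N) := by
  let _ := φ.toAlgebra
  let _ : Module A M := Module.compHom M φ
  have : IsScalarTower A B M := ⟨fun a b m => mul_smul (φ a) b m⟩
  have : IsLocalHom (algebraMap A B) := ‹IsLocalHom φ›
  have h1 : Function.Surjective (algebraMap (ResidueField A) (ResidueField B)) := by
    intro b
    obtain ⟨b, rfl⟩ := residue_surjective b
    obtain ⟨a, ha⟩ := hφ b
    refine ⟨residue A a, ?_⟩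
    rw [← sub_eq_zero, ← neg_sub, neg_eq_zero]
    exact (residue_eq_zero_iff _).mpr ha
  have h2 : Module.length (ResidueField A) (ResidueField B) = 1 := by
    rw [Module.length_eq_of_surjective (M := ResidueField B) h1]
    exact Module.length_eq_one _ _
  have h3 := IsLocalRing.length_restrictScalars A B (M ⧸ N)
  rw [h2, mul_one] at h3
  rw [← h3]
  let g : M' ≃ₗ[A] M := { f with map_smul' := hf }
  have hg : N'.map (g : M' →ₗ[A] M) = N.restrictScalars A := by
    ext y
    obtain ⟨x, rfl⟩ := g.surjective y
    constructor
    · rintro ⟨z, hz, h⟩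
      rw [← g.injective h]
      exact (hN z).mp hz
    · exact fun h => ⟨x, (hN x).mpr h, rfl⟩
  exact ((Submodule.Quotient.equiv N' (N.restrictScalars A) g hg).trans
    (Submodule.Quotient.restrictScalarsEquiv A N)).length_eq

end SemilinearLength

/-! ### Finite free modules: adic topology and precompleteness -/

theorem mem_smul_top_pi_iff {R ι : Type*} [CommRing R] [Fintype ι] (I : Ideal R) (x : ι → R) :
    x ∈ I • (⊤ : Submodule R (ι → R)) ↔ ∀ i, x i ∈ I := by
  classical
  constructor
  · intro h i
    have h1 : LinearMap.proj i x ∈ (I • (⊤ : Submodule R (ι → R))).map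
        (LinearMap.proj i : (ι → R) →ₗ[R] R) := ⟨x, h, rfl⟩
    rw [Submodule.map_smul''] at h1
    exact Ideal.mul_le_left h1
  · intro h
    rw [pi_eq_sum_univ' x]
    exact sum_mem fun i _ => Submodule.smul_mem_smul (h i) trivial

theorem isPrecomplete_pi {R : Type*} [CommRing R] (I : Ideal R) (ι : Type*) [Fintype ι]
    [IsPrecomplete I R] : IsPrecomplete I (ι → R) := by
  refine ⟨fun f hf => ?_⟩
  have h : ∀ i, ∃ L : R, ∀ n, f n i ≡ L [SMOD (I ^ n • ⊤ : Submodule R R)] := fun i =>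
    IsPrecomplete.prec (inferInstance : IsPrecomplete I R) fun {m n} hmn => by
      have h1 := hf hmn
      rw [SModEq.sub_mem, mem_smul_top_pi_iff] at h1
      rw [SModEq.sub_mem, smul_eq_mul, Ideal.mul_top]
      exact h1 i
  choose L hL using h
  refine ⟨L, fun n => ?_⟩
  rw [SModEq.sub_mem, mem_smul_top_pi_iff]
  intro i
  have h1 := hL i n
  rwa [SModEq.sub_mem, smul_eq_mul, Ideal.mul_top] at h1

/-! ### The Frobenius pushforward -/

section Pushforward
open IsLocalRing

/-- The module `F_* M`: restriction of scalars along the Frobenius endomorphism. -/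
def FrobeniusPushforward (_ : ℕ) (M : Type*) : Type _ := M

variable {R : Type*} [CommRing R] (p : ℕ) [Fact p.Prime] [CharP R p]
variable (M : Type*) [AddCommGroup M] [Module R M]

instance : AddCommGroup (FrobeniusPushforward p M) := inferInstanceAs (AddCommGroup M)

instance : Module R (FrobeniusPushforward p M) := Module.compHom M (frobenius R p)

/-- The identity map to the Frobenius pushforward. -/
def FrobeniusPushforward.of : M ≃+ FrobeniusPushforward p M := AddEquiv.refl M

variable {p M}

theorem FrobeniusPushforward.smul_of (r : R) (m : M) :
    r • FrobeniusPushforward.of p M m = FrobeniusPushforward.of p M (r ^ p • m) := rfl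

theorem FrobeniusPushforward.of_mem_smul_top (𝔞 : Ideal R) (m : M) :
    FrobeniusPushforward.of p M m ∈ 𝔞 • (⊤ : Submodule R (FrobeniusPushforward p M)) ↔
      m ∈ 𝔞.map (frobenius R p) • (⊤ : Submodule R M) := by
  constructor
  · intro h
    refine Submodule.smul_induction_on (p := fun x => (FrobeniusPushforward.of p M).symm x ∈
      𝔞.map (frobenius R p) • (⊤ : Submodule R M)) h ?_ ?_
    · intro r hr n _
      exact Submodule.smul_mem_smul (Ideal.mem_map_of_mem (frobenius R p) hr)
        (Submodule.mem_top (x := (FrobeniusPushforward.of p M).symm n))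
    · intro x y hx hy
      rw [map_add]
      exact add_mem hx hy
  · intro h
    have key : ∀ b ∈ 𝔞.map (frobenius R p), ∀ n : M, FrobeniusPushforward.of p M (b • n) ∈
        𝔞 • (⊤ : Submodule R (FrobeniusPushforward p M)) := by
      intro b hb
      refine Submodule.span_induction (p := fun b _ => ∀ n : M,
        FrobeniusPushforward.of p M (b • n) ∈
          𝔞 • (⊤ : Submodule R (FrobeniusPushforward p M))) ?_ ?_ ?_ ?_ hb
      · rintro _ ⟨r, hr, rfl⟩ n
        exact Submodule.smul_mem_smul hr (Submodule.mem_top (x := FrobeniusPushforward.of p M n))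
      · intro n
        rw [zero_smul, map_zero]
        exact zero_mem _
      · intro x y _ _ hx hy n
        rw [add_smul, map_add]
        exact add_mem (hx n) (hy n)
      · intro c x _ hx n
        rw [smul_eq_mul, mul_comm, mul_smul]
        exact hx _
    refine Submodule.smul_induction_on (p := fun x => FrobeniusPushforward.of p M x ∈
      𝔞 • (⊤ : Submodule R (FrobeniusPushforward p M))) h (fun b hb n _ => key b hb n) ?_
    intro x y hx hy
    rw [map_add]
    exact add_mem hx hy

theorem map_frobenius_le (I : Ideal R) : I.map (frobenius R p) ≤ I := by
  rw [Ideal.map_le_iff_le_comap]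
  exact fun x hx => Ideal.pow_mem_of_mem _ hx _ (Fact.out : p.Prime).pos

variable [IsLocalRing R]

instance isLocalHom_frobenius : IsLocalHom (frobenius R p) where
  map_nonunit x hx := by
    rw [frobenius_def] at hx
    exact (isUnit_pow_iff (Fact.out : p.Prime).ne_zero).mp hx

theorem length_frobeniusPushforward_quotient (h : ∀ x : R, ∃ y, x - y ^ p ∈ maximalIdeal R)
    (𝔞 : Ideal R) :
    Module.length R (FrobeniusPushforward p M ⧸ 𝔞 • (⊤ : Submodule R (FrobeniusPushforward p M))) =
      Module.length R (M ⧸ 𝔞.map (frobenius R p) • (⊤ : Submodule R M)) :=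
  length_quotient_eq_of_semilinear (frobenius R p) h (FrobeniusPushforward.of p M).symm
    (fun _ _ => rfl) _ _ fun x =>
      FrobeniusPushforward.of_mem_smul_top 𝔞 ((FrobeniusPushforward.of p M).symm x)

variable [IsNoetherianRing R]

theorem ContainsMaximalPow.map_frobenius {I : Ideal R} (h : ContainsMaximalPow I) :
    ContainsMaximalPow (I.map (frobenius R p)) := by
  refine containsMaximalPow_of_forall_isPrime fun P hP hle => ?_
  obtain ⟨c, hc⟩ := h
  refine le_antisymm (le_maximalIdeal hP.ne_top) fun x hx => ?_
  refine hP.mem_of_pow_mem (c * p) (hle ?_)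
  rw [pow_mul]
  exact Ideal.mem_map_of_mem (frobenius R p) (hc (Ideal.pow_mem_pow hx c))

/-- `F_*M/𝔪F_*M` has the length of `M/𝔪^[p]M`, which is finite. Since `R` is complete and `F_*M` is
separated, lifts of generators of this quotient generate `F_*M`. -/
theorem finite_frobeniusPushforward [Module.Finite R M] [IsAdicComplete (maximalIdeal R) R]
    (h : ∀ x : R, ∃ y, x - y ^ p ∈ maximalIdeal R) :
    Module.Finite R (FrobeniusPushforward p M) := by
  have hlen := length_frobeniusPushforward_quotient (M := M) h (maximalIdeal R)
  have hfin : IsFiniteLength R (FrobeniusPushforward p M ⧸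
      maximalIdeal R • (⊤ : Submodule R (FrobeniusPushforward p M))) := by
    rw [← Module.length_ne_top_iff, hlen]
    exact (containsMaximalPow_maximalIdeal.map_frobenius).length_ne_top
  have hN := (isFiniteLength_iff_isNoetherian_isArtinian.mp hfin).1
  obtain ⟨n, g, hg⟩ := Module.Finite.exists_fin' R (FrobeniusPushforward p M ⧸
      maximalIdeal R • (⊤ : Submodule R (FrobeniusPushforward p M)))
  obtain ⟨f, hf⟩ := Module.projective_lifting_property (Submodule.mkQ
    (maximalIdeal R • (⊤ : Submodule R (FrobeniusPushforward p M)))) g (Submodule.mkQ_surjective _)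
  have hmap : ∀ k, ((maximalIdeal R) ^ k).map (frobenius R p) • (⊤ : Submodule R M) ≤
      maximalIdeal R ^ k • ⊤ := fun k => Submodule.smul_mono_left (map_frobenius_le _)
  have : IsHausdorff (maximalIdeal R) (FrobeniusPushforward p M) := by
    refine ⟨fun x hx => ?_⟩
    obtain ⟨x, rfl⟩ := (FrobeniusPushforward.of p M).surjective x
    have h0 : x = 0 := IsHausdorff.haus (inferInstance : IsHausdorff (maximalIdeal R) M) x
      fun n => by
        have h1 := hx n
        rw [SModEq.zero] at h1 ⊢
        exact hmap n ((FrobeniusPushforward.of_mem_smul_top _ x).mp h1)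
    rw [h0, map_zero]
  have := isPrecomplete_pi (maximalIdeal R) (Fin n)
  refine Module.Finite.of_surjective f
    (surjective_of_mkQ_comp_surjective (I := maximalIdeal R) ?_)
  rw [hf]
  exact hg

end Pushforward

/-! ### Frobenius powers against ordinary powers -/

section FrobeniusPower
open IsLocalRing

variable {R : Type*} [CommRing R] (p : ℕ) [Fact p.Prime] [CharP R p]

theorem bracketPower_eq_map (J : Ideal R) (e : ℕ) :
    bracketPower J (p ^ e) = J.map (iterateFrobenius R p e) := by
  rw [bracketPower, Ideal.map]
  congr 1
  ext x
  simp [iterateFrobenius_def, eq_comm]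

theorem map_frobenius_bracketPower (J : Ideal R) (e : ℕ) :
    (bracketPower J (p ^ e)).map (frobenius R p) = bracketPower J (p ^ (e + 1)) := by
  rw [bracketPower_eq_map, bracketPower_eq_map, Ideal.map_map]
  congr 1
  ext x
  simp [iterateFrobenius_def, frobenius_def, pow_succ, pow_mul]

/-- Pigeonhole: a monomial of such degree in the generators contains the `p`-th power of one of
them, which can be split off. -/
theorem pow_add_le_mul_pow (s : Finset R) (n : ℕ) :
    Ideal.span (s : Set R) ^ (s.card * p + n + p) ≤
      (Ideal.span (s : Set R)).map (frobenius R p) * Ideal.span (s : Set R) ^ (s.card * p + n) := by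
  classical
  induction s using Finset.induction_on generalizing n with
  | empty =>
    rw [Finset.coe_empty, Ideal.span_empty, ← Ideal.zero_eq_bot,
      zero_pow (by have := (Fact.out : p.Prime).pos; omega)]
    exact bot_le
  | insert x s hx ih =>
    have hle : Ideal.span (s : Set R) ≤ Ideal.span ((insert x s : Finset R) : Set R) :=
      Ideal.span_mono (by simp)
    have hxm : Ideal.span {x} ≤ Ideal.span ((insert x s : Finset R) : Set R) :=
      Ideal.span_mono (by simp)
    have heq : Ideal.span ((insert x s : Finset R) : Set R) =
        Ideal.span {x} + Ideal.span (s : Set R) := by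
      rw [Finset.coe_insert, Ideal.span_insert, Submodule.add_eq_sup]
    set A := Ideal.span ((insert x s : Finset R) : Set R) with hA
    rw [Finset.card_insert_of_notMem hx]
    conv_lhs => rw [heq, add_pow]
    rw [Ideal.sum_eq_sup, Finset.sup_le_iff]
    intro i hi
    refine Ideal.mul_le_left.trans ?_
    have hi' := Finset.mem_range.mp hi
    -- Either the exponent of `x` is at least `p` and `x ^ p` splits off, or enough degree is left
    -- for the remaining generators.
    rcases le_or_gt p i with hpi | hpi
    · obtain ⟨j, rfl⟩ := Nat.exists_eq_add_of_le hpi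
      rw [pow_add, mul_assoc]
      refine Ideal.mul_mono ?_ ?_
      · rw [Ideal.span_singleton_pow, Ideal.span_singleton_le_iff_mem]
        exact Ideal.mem_map_of_mem (frobenius R p) (hxm (Ideal.mem_span_singleton_self x))
      · refine (Ideal.mul_mono (Ideal.pow_right_mono hxm _) (Ideal.pow_right_mono hle _)).trans ?_
        rw [← pow_add]
        exact Ideal.pow_le_pow_right (by omega)
    · obtain ⟨k, hk⟩ : ∃ k, (s.card + 1) * p + n + p - i = s.card * p + k + p :=
        ⟨(s.card + 1) * p + n + p - i - p - s.card * p, by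
          have : (s.card + 1) * p = s.card * p + p := by ring
          omega⟩
      rw [hk]
      refine (Ideal.mul_mono (Ideal.pow_right_mono hxm i) (ih k)).trans ?_
      rw [mul_left_comm]
      refine Ideal.mul_mono (Ideal.map_mono hle) ?_
      refine (Ideal.mul_mono le_rfl (Ideal.pow_right_mono hle _)).trans ?_
      rw [← pow_add]
      refine Ideal.pow_le_pow_right ?_
      have : (s.card + 1) * p = s.card * p + p := by ring
      omega

/-- Splitting off `p`-th powers `n` times leaves a remainder of degree `μ p`, with `μ` the number of
generators. That `μ` does not depend on `n` is what later bounds the number of Hilbert function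
steps. -/
theorem exists_pow_mul_add_le (I : Ideal R) [IsNoetherianRing R] : ∃ μ : ℕ, ∀ n,
    I ^ (p * (n + μ)) ≤ (I ^ n).map (frobenius R p) := by
  obtain ⟨s, hs⟩ := (IsNoetherian.noetherian I : I.FG)
  refine ⟨s.card, fun n => ?_⟩
  have h : ∀ n k, I ^ (s.card * p + k + p * n) ≤
      (I ^ n).map (frobenius R p) * I ^ (s.card * p + k) := by
    intro n k
    induction n with
    | zero => simp [Ideal.one_eq_top, Ideal.map_top]
    | succ n ih =>
      calc I ^ (s.card * p + k + p * (n + 1)) = I ^ (s.card * p + (k + p * n) + p) := by ring_nf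
        _ ≤ I.map (frobenius R p) * I ^ (s.card * p + (k + p * n)) := by
          have := pow_add_le_mul_pow p s (k + p * n)
          rwa [show Ideal.span (s : Set R) = I from hs] at this
        _ ≤ I.map (frobenius R p) * ((I ^ n).map (frobenius R p) * I ^ (s.card * p + k)) := by
          rw [← add_assoc]
          exact Ideal.mul_mono_right ih
        _ = (I ^ (n + 1)).map (frobenius R p) * I ^ (s.card * p + k) := by
          rw [← mul_assoc, ← Ideal.map_mul, pow_succ']
  have := (h n 0).trans Ideal.mul_le_left
  rwa [show s.card * p + 0 + p * n = p * (n + s.card) by ring] at this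

end FrobeniusPower

/-! ### Dimension drop modulo an element outside the minimal primes -/

section Dimension
open IsLocalRing

variable {R : Type*} [CommRing R] [IsNoetherianRing R] [IsLocalRing R]

/-- A chain of primes containing `s` starts strictly above some minimal prime, so it can be
prolonged by one. -/
theorem natDim_quotient_span_succ_le {s : R} (hs : ∀ P ∈ minimalPrimes R, s ∉ P)
    (hsm : s ∈ maximalIdeal R) : natDim (R ⧸ Ideal.span {s}) + 1 ≤ natDim R := by
  have hne : Ideal.span {s} ≠ ⊤ := ne_top_of_le_ne_top (maximalIdeal.isMaximal R).ne_top
    ((Ideal.span_singleton_le_iff_mem _).mpr hsm)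
  have : Nontrivial (R ⧸ Ideal.span {s}) := Ideal.Quotient.nontrivial_iff.mpr hne
  have : IsLocalRing (R ⧸ Ideal.span {s}) :=
    IsLocalRing.of_surjective' _ Ideal.Quotient.mk_surjective
  have h1 := natDim_eq_ringKrullDim (R := R ⧸ Ideal.span {s})
  have h2 := natDim_eq_ringKrullDim (R := R)
  rw [ringKrullDim_quotient] at h1
  obtain ⟨l, hl⟩ := Order.le_krullDim_iff.mp h1.le
  obtain ⟨P, hP, hle⟩ := Ideal.exists_minimalPrimes_le (J := l.head.1.asIdeal) bot_le
  let P' : PrimeSpectrum R := ⟨P, hP.1.1⟩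
  have hlt : P' < l.head := lt_of_le_of_ne hle fun h => hs P hP <| by
    have h3 : s ∈ l.head.1.asIdeal := l.head.2 (Ideal.mem_span_singleton_self s)
    rwa [← h] at h3
  have hmono : StrictMono (Subtype.val : PrimeSpectrum.zeroLocus (R := R) (Ideal.span {s}) → _) :=
    fun _ _ h => h
  have hlt' : P' < (l.map Subtype.val hmono).head := hlt
  have h4 : (((l.map Subtype.val hmono).cons P' hlt').length : WithBot ℕ∞) ≤ ringKrullDim R :=
    Order.LTSeries.length_le_krullDim _
  have h5 : ((l.map Subtype.val hmono).cons P' hlt').length = l.length + 1 :=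
    RelSeries.cons_length _ _ _
  rw [← h2, h5] at h4
  rw [← hl]
  exact_mod_cast h4

end Dimension

/-! ### Colengths of quotients and finite products -/

section Lengths

variable {R : Type*} [CommRing R]

theorem length_quotient_smul_sup_le {M : Type*} [AddCommGroup M] [Module R M] (𝔞 : Ideal R)
    (N : Submodule R M) : Module.length R (M ⧸ (𝔞 • (⊤ : Submodule R M) ⊔ N)) ≤
      Module.length R ((M ⧸ N) ⧸ 𝔞 • (⊤ : Submodule R (M ⧸ N))) := by
  have h : 𝔞 • (⊤ : Submodule R (M ⧸ N)) ≤ LinearMap.ker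
      (Submodule.factor (le_sup_right : N ≤ 𝔞 • (⊤ : Submodule R M) ⊔ N)) := by
    rw [Submodule.smul_le]
    intro r hr x _
    obtain ⟨x, rfl⟩ := Submodule.Quotient.mk_surjective _ x
    rw [LinearMap.mem_ker, map_smul]
    change Submodule.Quotient.mk (r • x) = 0
    rw [Submodule.Quotient.mk_eq_zero]
    exact Submodule.mem_sup_left (Submodule.smul_mem_smul hr trivial)
  refine Module.length_le_of_surjective (Submodule.liftQ _ _ h) ?_
  intro x
  obtain ⟨y, rfl⟩ := Submodule.factor_surjective
    (le_sup_right : N ≤ 𝔞 • (⊤ : Submodule R M) ⊔ N) x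
  exact ⟨Submodule.Quotient.mk y, rfl⟩

theorem smul_top_pi {ι : Type*} [Fintype ι] {M : ι → Type*} [∀ i, AddCommGroup (M i)]
    [∀ i, Module R (M i)] (𝔞 : Ideal R) : 𝔞 • (⊤ : Submodule R (∀ i, M i)) =
      Submodule.pi Set.univ (fun i => 𝔞 • (⊤ : Submodule R (M i))) := by
  classical
  apply le_antisymm
  · rw [Submodule.smul_le]
    intro r hr x _ i _
    exact Submodule.smul_mem_smul hr trivial
  · intro x hx
    rw [← Finset.univ_sum_single x]
    refine sum_mem fun i _ => ?_
    have h1 : LinearMap.single R M i (x i) ∈ (𝔞 • (⊤ : Submodule R (M i))).map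
        (LinearMap.single R M i) := ⟨x i, hx i trivial, rfl⟩
    rw [Submodule.map_smul''] at h1
    exact Submodule.smul_mono le_rfl le_top h1

theorem length_quotient_smul_pi {ι : Type*} [Fintype ι] {M : ι → Type*}
    [∀ i, AddCommGroup (M i)] [∀ i, Module R (M i)] (𝔞 : Ideal R) :
    Module.length R ((∀ i, M i) ⧸ 𝔞 • (⊤ : Submodule R (∀ i, M i))) =
      ∑ i, Module.length R (M i ⧸ 𝔞 • (⊤ : Submodule R (M i))) := by
  classical
  rw [smul_top_pi, (Submodule.quotientPi _).length_eq, Module.length_pi_of_fintype]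

end Lengths

/-! ### Colengths of mixed powers up to negligible error -/

section MixedColength
open IsLocalRing Asymptotics

variable (R : Type*) [CommRing R] (M N : Type*) [AddCommGroup M] [Module R M] [AddCommGroup N]
  [Module R N] (p : ℕ) (s : ℝ) (I J : Ideal R)

/-- The numerator of `hSeq`. -/
noncomputable def mixedColen (e : ℕ) : ℝ :=
  (colen (mixedPower p s I J e • (⊤ : Submodule R M)) : ℝ)

/-- The order of magnitude `q ^ d / q` for `q = p ^ e`. -/
noncomputable def errorRate (p d : ℕ) (e : ℕ) : ℝ := ((p : ℝ) ^ e) ^ d / (p : ℝ) ^ e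

theorem hSeq_eq (e : ℕ) : hSeq R M p s I J e =
    mixedColen R M p s I J e / ((p : ℝ) ^ e) ^ natDim R := by
  rw [← pow_mul]
  rfl

theorem mixedColen_nonneg (e : ℕ) : 0 ≤ mixedColen R M p s I J e := Nat.cast_nonneg _

variable {R M N p s I J}

theorem pow_mem_mixedPower {x : R} (hx : x ∈ J) (e : ℕ) : x ^ p ^ e ∈ mixedPower p s I J e :=
  Ideal.mem_sup_right (Ideal.subset_span ⟨x, hx, rfl⟩)

variable [IsNoetherianRing R] [IsLocalRing R] [Module.Finite R M] [Module.Finite R N]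

theorem containsMaximalPow_of_forall_pow_mem {𝔞 : Ideal R} (hJ : ContainsMaximalPow J) (n : ℕ)
    (h : ∀ x ∈ J, x ^ n ∈ 𝔞) : ContainsMaximalPow 𝔞 := by
  refine containsMaximalPow_of_forall_isPrime fun P hP hle => ?_
  obtain ⟨c, hc⟩ := hJ
  refine le_antisymm (le_maximalIdeal hP.ne_top) fun x hx => ?_
  refine hP.mem_of_pow_mem (c * n) (hle ?_)
  rw [pow_mul]
  exact h _ (hc (Ideal.pow_mem_pow hx c))

theorem ContainsMaximalPow.mixedPower (hJ : ContainsMaximalPow J) (e : ℕ) :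
    ContainsMaximalPow (mixedPower p s I J e) :=
  containsMaximalPow_of_forall_pow_mem hJ (p ^ e) fun _ hx => pow_mem_mixedPower hx e

variable (M N) in
theorem length_mixedPower_ne_top (hJ : ContainsMaximalPow J) (e : ℕ) :
    Module.length R (M ⧸ mixedPower p s I J e • (⊤ : Submodule R M)) ≠ ⊤ :=
  (hJ.mixedPower e).length_ne_top

theorem exists_mixedColen_le (hJ : ContainsMaximalPow J) (𝔟 : Ideal R) (h𝔟 : 𝔟 ≠ ⊤)
    (hM : 𝔟 • (⊤ : Submodule R M) = ⊥) : ∃ C : ℝ, ∀ e,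
      mixedColen R M p s I J e ≤ C * ((p : ℝ) ^ e) ^ natDim (R ⧸ 𝔟) := by
  obtain ⟨C, hC⟩ := exists_length_quotient_le 𝔟 h𝔟 hM hJ
  refine ⟨C, fun e => ?_⟩
  have h := hC (p ^ e) (mixedPower p s I J e) fun x hx => pow_mem_mixedPower hx e
  rw [← coe_colen (length_mixedPower_ne_top M hJ e)] at h
  have h' : colen (mixedPower p s I J e • (⊤ : Submodule R M)) ≤ C * (p ^ e) ^ natDim (R ⧸ 𝔟) := by
    exact_mod_cast h
  unfold mixedColen
  exact_mod_cast h'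

theorem mixedColen_le_add (hJ : ContainsMaximalPow J) (f : M →ₗ[R] N) (e : ℕ) :
    mixedColen R N p s I J e ≤
      mixedColen R M p s I J e + mixedColen R (N ⧸ LinearMap.range f) p s I J e := by
  have h1 := length_quotient_le_add f (mixedPower p s I J e • (⊤ : Submodule R M))
    (mixedPower p s I J e • (⊤ : Submodule R N)) (by
      rw [← Submodule.map_le_iff_le_comap, Submodule.map_smul'']
      exact Submodule.smul_mono le_rfl le_top)
  have h2 := h1.trans (add_le_add_right
    (length_quotient_smul_sup_le (mixedPower p s I J e) (LinearMap.range f)) _)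
  rw [← coe_colen (length_mixedPower_ne_top N hJ e), ← coe_colen (length_mixedPower_ne_top M hJ e),
    ← coe_colen (length_mixedPower_ne_top (N ⧸ LinearMap.range f) hJ e)] at h2
  have h3 : colen (mixedPower p s I J e • (⊤ : Submodule R N)) ≤
      colen (mixedPower p s I J e • (⊤ : Submodule R M)) +
      colen (mixedPower p s I J e • (⊤ : Submodule R (N ⧸ LinearMap.range f))) := by
    exact_mod_cast h2
  unfold mixedColen
  exact_mod_cast h3

theorem mixedColen_pi {ι : Type*} [Fintype ι] {M : ι → Type*} [∀ i, AddCommGroup (M i)]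
    [∀ i, Module R (M i)] [∀ i, Module.Finite R (M i)] (hJ : ContainsMaximalPow J) (e : ℕ) :
    mixedColen R (∀ i, M i) p s I J e = ∑ i, mixedColen R (M i) p s I J e := by
  have h := length_quotient_smul_pi (M := M) (mixedPower p s I J e)
  rw [← coe_colen (length_mixedPower_ne_top _ hJ e)] at h
  simp_rw [← coe_colen (length_mixedPower_ne_top (M _) hJ e)] at h
  have h' : colen (mixedPower p s I J e • (⊤ : Submodule R (∀ i, M i))) =
      ∑ i, colen (mixedPower p s I J e • (⊤ : Submodule R (M i))) := by exact_mod_cast h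
  simp only [mixedColen, h', Nat.cast_sum]

variable [Fact p.Prime]

theorem one_le_prime_pow (e : ℕ) : (1 : ℝ) ≤ (p : ℝ) ^ e :=
  one_le_pow₀ (by exact_mod_cast (Fact.out : p.Prime).one_le)

/-- A module killed by an element outside all minimal primes has negligible colengths. -/
theorem mixedColen_isBigO_of_smul_eq_zero (hJ : ContainsMaximalPow J) {x : R}
    (hx : ∀ P ∈ minimalPrimes R, x ∉ P) (hM : ∀ m : M, x • m = 0) :
    mixedColen R M p s I J =O[atTop] errorRate p (natDim R) := by
  by_cases hxm : x ∈ maximalIdeal R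
  -- `M` is a module over `R/(x)`, whose dimension is at most `d - 1`, so its colengths are
  -- `O(q^(d-1))`.
  · have hd := natDim_quotient_span_succ_le hx hxm
    obtain ⟨C, hC⟩ := exists_mixedColen_le (p := p) (s := s) (I := I) (M := M) hJ (Ideal.span {x})
      (ne_top_of_le_ne_top (maximalIdeal.isMaximal R).ne_top
        ((Ideal.span_singleton_le_iff_mem _).mpr hxm)) (by
        rw [Submodule.ideal_span_singleton_smul, eq_bot_iff]
        rintro _ ⟨m, _, rfl⟩
        exact hM m)
    have hC0 : 0 ≤ C := by
      have := (mixedColen_nonneg R M p s I J 0).trans (hC 0)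
      simpa using this
    refine IsBigO.of_bound C (Eventually.of_forall fun e => ?_)
    have hq := one_le_prime_pow (p := p) e
    rw [Real.norm_of_nonneg (mixedColen_nonneg R M p s I J e), errorRate,
      Real.norm_of_nonneg (by positivity)]
    refine (hC e).trans (mul_le_mul_of_nonneg_left ?_ hC0)
    rw [le_div_iff₀ (by positivity), ← pow_succ]
    exact pow_le_pow_right₀ hq hd
  · have hu : IsUnit x := by
      by_contra h
      exact hxm ((mem_maximalIdeal x).mpr h)
    have : Subsingleton M := ⟨fun a b => by
      rw [← hu.smul_left_cancel, hM, hM]⟩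
    have h0 : mixedColen R M p s I J = 0 := by
      ext e
      simp [mixedColen, colen]
    rw [h0]
    exact isBigO_zero _ _

/-- Modules which agree up to torsion have the same colengths up to a negligible error. -/
theorem mixedColen_sub_isBigO (hJ : ContainsMaximalPow J) (f : M →ₗ[R] N) (g : N →ₗ[R] M) {x : R}
    (hx : ∀ P ∈ minimalPrimes R, x ∉ P) (hf : ∀ n, x • n ∈ LinearMap.range f)
    (hg : ∀ m, x • m ∈ LinearMap.range g) :
    (fun e => mixedColen R N p s I J e - mixedColen R M p s I J e) =O[atTop]
      errorRate p (natDim R) := by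
  have h1 := mixedColen_isBigO_of_smul_eq_zero (p := p) (s := s) (I := I) hJ hx
    (M := N ⧸ LinearMap.range f) (fun n => by
      obtain ⟨n, rfl⟩ := Submodule.Quotient.mk_surjective _ n
      rw [← Submodule.Quotient.mk_smul, Submodule.Quotient.mk_eq_zero]
      exact hf n)
  have h2 := mixedColen_isBigO_of_smul_eq_zero (p := p) (s := s) (I := I) hJ hx
    (M := M ⧸ LinearMap.range g) (fun n => by
      obtain ⟨n, rfl⟩ := Submodule.Quotient.mk_surjective _ n
      rw [← Submodule.Quotient.mk_smul, Submodule.Quotient.mk_eq_zero]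
      exact hg n)
  refine IsBigO.trans (IsBigO.of_bound 1 (Eventually.of_forall fun e => ?_)) (h1.add h2)
  have h3 := mixedColen_le_add (p := p) (s := s) (I := I) hJ f e
  have h4 := mixedColen_le_add (p := p) (s := s) (I := I) hJ g e
  have h5 := mixedColen_nonneg R (N ⧸ LinearMap.range f) p s I J e
  have h6 := mixedColen_nonneg R (M ⧸ LinearMap.range g) p s I J e
  rw [one_mul, Real.norm_eq_abs, Real.norm_of_nonneg (by positivity), abs_le]
  constructor <;> linarith

end MixedColength

/-! ### Colengths of `M` at level `e + 1` against `F_*M` at level `e` -/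

section FrobeniusComparison
open IsLocalRing Asymptotics

/-- Telescoping: for `n` between `a` and `b`, one increment is at most `C b^d / a`. -/
theorem sub_le_of_increment_mul_le (u : ℕ → ℕ) (C d : ℕ)
    (h : ∀ n, (u (n + 1) - u n) * n ≤ C * n ^ d) (a b : ℝ) (ha : 0 < a)
    (A B : ℕ) (hAB : A ≤ B) (hA : a ≤ A) (hB : (B : ℝ) ≤ b) :
    (u B : ℝ) - u A ≤ ((B : ℝ) - A) * (C * b ^ d / a) := by
  induction B, hAB using Nat.le_induction with
  | base => simp
  | succ B hAB ih =>
    have h1 := ih (le_trans (by simp) hB)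
    have hBA : (A : ℝ) ≤ B := by exact_mod_cast hAB
    have hBb : (B : ℝ) ≤ b := le_trans (by simp) hB
    have h2 : (u (B + 1) : ℝ) - u B ≤ C * b ^ d / a := by
      rw [le_div_iff₀ ha]
      rcases le_or_gt (u (B + 1)) (u B) with hle | hlt
      · have : (u (B + 1) : ℝ) ≤ u B := by exact_mod_cast hle
        have h3 : ((u (B + 1) : ℝ) - u B) * a ≤ 0 :=
          mul_nonpos_of_nonpos_of_nonneg (by linarith) ha.le
        have : 0 ≤ b := le_trans (by positivity) hB
        exact h3.trans (by positivity)
      · have h3 : (((u (B + 1) - u B : ℕ) : ℝ)) * B ≤ C * (B : ℝ) ^ d := by exact_mod_cast h B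
        rw [Nat.cast_sub hlt.le] at h3
        have h4 : (u B : ℝ) ≤ u (B + 1) := by exact_mod_cast hlt.le
        calc ((u (B + 1) : ℝ) - u B) * a ≤ ((u (B + 1) : ℝ) - u B) * B := by
              gcongr
              linarith
          _ ≤ C * (B : ℝ) ^ d := h3
          _ ≤ C * b ^ d := by gcongr
    push_cast
    linarith

theorem ceil_mul_pow_succ_le {p : ℕ} (s : ℝ) (e : ℕ) :
    ⌈s * (p : ℝ) ^ (e + 1)⌉₊ ≤ ⌈s * (p : ℝ) ^ e⌉₊ * p := by
  rw [Nat.ceil_le]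
  push_cast
  calc s * (p : ℝ) ^ (e + 1) = s * (p : ℝ) ^ e * p := by ring
    _ ≤ _ := by gcongr; exact Nat.le_ceil _

variable {R : Type*} [CommRing R] {M : Type*} [AddCommGroup M] [Module R M]
  {p : ℕ} [Fact p.Prime] [CharP R p] {s : ℝ} {I J : Ideal R}

theorem map_frobenius_mixedPower (e : ℕ) : (mixedPower p s I J e).map (frobenius R p) =
    (I ^ ⌈s * (p : ℝ) ^ e⌉₊).map (frobenius R p) ⊔ bracketPower J (p ^ (e + 1)) := by
  rw [mixedPower, Submodule.add_eq_sup, Ideal.map_sup, map_frobenius_bracketPower]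

theorem map_frobenius_le_pow (I : Ideal R) : I.map (frobenius R p) ≤ I ^ p := by
  rw [Ideal.map_le_iff_le_comap]
  exact fun x hx => Ideal.pow_mem_pow hx _

variable [IsNoetherianRing R] [IsLocalRing R] [Module.Finite R M]

/-- Passing from `M` to `F_* M` shifts the colengths up to a negligible error. -/
theorem mixedColen_succ_sub_isBigO (hR : ∀ x : R, ∃ y, x - y ^ p ∈ maximalIdeal R)
    [Module.Finite R (FrobeniusPushforward p M)] (hs : 0 < s)
    (hI : ContainsMaximalPow I) :
    (fun e => mixedColen R M p s I J (e + 1) -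
      mixedColen R (FrobeniusPushforward p M) p s I J e) =O[atTop] errorRate p (natDim R) := by
  obtain ⟨μ, hμ⟩ := exists_pow_mul_add_le p I
  obtain ⟨C, hC⟩ := exists_colen_pow_succ_sub_mul_le (M := M) hI
  set d := natDim R with hd
  have hp : (1 : ℝ) ≤ p := by exact_mod_cast (Fact.out : p.Prime).one_le
  set K : ℝ := p * (s + 1 + μ) with hK
  have hK0 : 0 < K := by positivity
  refine IsBigO.of_bound ((p * (1 + μ)) * (C * K ^ d / s)) (Eventually.of_forall fun e => ?_)
  have hq := one_le_prime_pow (p := p) e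
  set q : ℝ := (p : ℝ) ^ e with hqdef
  set a := ⌈s * q⌉₊ with ha
  set a' := ⌈s * (p : ℝ) ^ (e + 1)⌉₊ with ha'
  have hle : a' ≤ p * (a + μ) := by
    have := ceil_mul_pow_succ_le (p := p) s e
    calc a' ≤ a * p := this
      _ ≤ p * (a + μ) := by rw [mul_comm]; exact Nat.mul_le_mul_left _ (Nat.le_add_right _ _)
  have ha1 : (a : ℝ) < s * q + 1 := Nat.ceil_lt_add_one (by positivity)
  have ha2 : s * (p : ℝ) ^ (e + 1) ≤ a' := Nat.le_ceil _
  have ha2' : s * q * p ≤ a' := by rwa [hqdef, mul_assoc, ← pow_succ]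
  have hμ0 : (0 : ℝ) ≤ μ := by positivity
  set N : Submodule R M := bracketPower J (p ^ (e + 1)) • ⊤ with hN
  have hIfin : ∀ n, Module.length R (M ⧸ I ^ n • (⊤ : Submodule R M)) ≠ ⊤ :=
    fun n => (hI.pow n).length_ne_top
  have e1 : mixedColen R (FrobeniusPushforward p M) p s I J e =
      colen ((I ^ a).map (frobenius R p) • (⊤ : Submodule R M) ⊔ N) := by
    rw [mixedColen, colen, length_frobeniusPushforward_quotient hR, map_frobenius_mixedPower,
      Submodule.sup_smul]
    rfl
  have e2 : mixedColen R M p s I J (e + 1) = colen (I ^ a' • (⊤ : Submodule R M) ⊔ N) := by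
    rw [mixedColen, mixedPower, Submodule.add_eq_sup, Submodule.sup_smul]
  -- Sandwich: `I^(p(a+μ)) ≤ (I^a)^[p] ≤ I^a'`. The two outer exponents differ by at most `p(1 +
  -- μ)`, independently of `e`, and lie between `s q` and `K q`, so the error is a bounded number of
  -- increments of order `q^d / q`.
  have h1 : (colen (I ^ a' • (⊤ : Submodule R M) ⊔ N) : ℝ) ≤
      colen ((I ^ a).map (frobenius R p) • (⊤ : Submodule R M) ⊔ N) := by
    have hsm : (I ^ a).map (frobenius R p) ≤ I ^ a' := by
      refine (map_frobenius_le_pow _).trans ?_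
      rw [← pow_mul]
      exact Ideal.pow_le_pow_right (ceil_mul_pow_succ_le s e)
    refine Nat.cast_le.mpr (colen_anti (sup_le_sup_right (Submodule.smul_mono_left hsm) N) ?_)
    exact length_quotient_ne_top_of_le le_sup_left ((hI.pow a).map_frobenius.length_ne_top)
  have h2 : (colen ((I ^ a).map (frobenius R p) • (⊤ : Submodule R M) ⊔ N) : ℝ) ≤
      colen (I ^ (p * (a + μ)) • (⊤ : Submodule R M) ⊔ N) :=
    Nat.cast_le.mpr (colen_anti (sup_le_sup_right (Submodule.smul_mono_left (hμ a)) N)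
      (length_quotient_ne_top_of_le le_sup_left (hIfin _)))
  have hmono : I ^ (p * (a + μ)) • (⊤ : Submodule R M) ≤ I ^ a' • ⊤ :=
    Submodule.smul_mono_left (Ideal.pow_le_pow_right hle)
  have h3 : (colen (I ^ (p * (a + μ)) • (⊤ : Submodule R M) ⊔ N) : ℝ) ≤
      colen (I ^ a' • (⊤ : Submodule R M) ⊔ N) +
      ((colen (I ^ (p * (a + μ)) • (⊤ : Submodule R M)) : ℝ) -
        colen (I ^ a' • (⊤ : Submodule R M))) := by
    have := colen_sup_le_add hmono N (hIfin _)
    rw [← Nat.cast_sub (colen_anti hmono (hIfin _))]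
    exact_mod_cast this
  have h4 := sub_le_of_increment_mul_le (fun n => colen (I ^ n • (⊤ : Submodule R M))) C d hC
    (s * q) (K * q) (by positivity) a' (p * (a + μ)) hle
    (le_trans (le_mul_of_one_le_right (by positivity) hp) ha2') (by
      push_cast
      calc (p : ℝ) * (a + μ) ≤ p * ((s * q + 1 * q) + μ * q) := by
            gcongr
            · linarith
            · exact le_mul_of_one_le_right hμ0 hq
        _ = K * q := by rw [hK]; ring)
  have h5 : ((p * (a + μ) : ℕ) : ℝ) - a' ≤ p * (1 + μ) := by
    push_cast
    have : (p : ℝ) * (a + μ) ≤ p * (s * q + 1 + μ) := by gcongr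
    nlinarith
  have h6 : (C : ℝ) * (K * q) ^ d / (s * q) = (C * K ^ d / s) * (q ^ d / q) := by
    rw [mul_pow]
    field_simp
  rw [h6] at h4
  have h7 := h4.trans (mul_le_mul_of_nonneg_right h5 (by positivity))
  rw [Real.norm_eq_abs, e1, e2, errorRate, Real.norm_of_nonneg (by positivity), abs_le]
  constructor
  · linarith
  · have : 0 ≤ (p : ℝ) * (1 + μ) * (C * K ^ d / s) * (q ^ d / q) := by positivity
    linarith

end FrobeniusComparison

/-! ### Convergence of approximately geometric sequences -/

section RealSequences
open Asymptotics

theorem exists_lt_of_add_le_succ (w : ℕ → ℝ) (ε : ℝ) (hε : 0 < ε)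
    (h : ∀ᶠ e in atTop, w e + ε ≤ w (e + 1)) (C : ℝ) : ∃ e, C < w e := by
  obtain ⟨e₀, h⟩ := eventually_atTop.mp h
  have h1 : ∀ n : ℕ, w e₀ + n * ε ≤ w (e₀ + n) := by
    intro n
    induction n with
    | zero => simp
    | succ n ih =>
      have := h (e₀ + n) (by omega)
      push_cast
      rw [← add_assoc]
      linarith
  obtain ⟨n, hn⟩ := exists_nat_gt ((C - w e₀) / ε)
  rw [div_lt_iff₀ hε] at hn
  exact ⟨e₀ + n, by linarith [h1 n]⟩

/-- A bounded sequence bounded away from zero that satisfies `v (e + 1) ≈ (ρ / D) v e` with natural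
numbers `ρ` and `D` converges. -/
theorem exists_tendsto_of_ratio (v : ℕ → ℝ) (ρ D : ℕ) (hD : 0 < D) (c C r : ℝ) (hc : 0 < c)
    (hr0 : 0 ≤ r) (hr : r < 1) (hvc : ∀ e, c ≤ v e) (hvC : ∀ e, v e ≤ C)
    (h : (fun e => v (e + 1) - (ρ / D : ℝ) * v e) =O[atTop] fun e : ℕ => r ^ e) :
    ∃ L, Tendsto v atTop (𝓝 L) := by
  have hD' : (0 : ℝ) < D := by exact_mod_cast hD
  obtain ⟨K, hK⟩ := h.bound
  have hK' : ∀ᶠ e in atTop, |v (e + 1) - (ρ / D : ℝ) * v e| ≤ K * r ^ e := by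
    filter_upwards [hK] with e he
    rwa [Real.norm_eq_abs, Real.norm_of_nonneg (by positivity)] at he
  have hsmall : ∀ᶠ e : ℕ in atTop, K * r ^ e < c / D / 2 := by
    have h1 : Tendsto (fun e : ℕ => K * r ^ e) atTop (𝓝 (K * 0)) :=
      (tendsto_pow_atTop_nhds_zero_of_lt_one hr0 hr).const_mul K
    rw [mul_zero] at h1
    exact h1.eventually_lt_const (by positivity)
  -- As `ρ` and `D` are integers, `ρ ≠ D` means that `ρ / D` is at distance at least `1 / D` from 1.
  -- Then `v` would eventually fall or rise by at least `c / D / 2` at each step, against its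
  -- bounds.
  have heq : ρ = D := by
    by_contra hne
    rcases Nat.lt_or_gt_of_ne hne with hlt | hgt
    · obtain ⟨e, he⟩ := exists_lt_of_add_le_succ (fun e => -v e) (c / D / 2) (by positivity) (by
        filter_upwards [hK', hsmall] with e h1 h2
        have h3 : (ρ / D : ℝ) ≤ 1 - 1 / D := by
          rw [le_sub_iff_add_le, ← add_div, div_le_one hD']
          exact_mod_cast hlt
        have h4 : (ρ / D : ℝ) * v e ≤ (1 - 1 / D) * v e :=
          mul_le_mul_of_nonneg_right h3 (hc.le.trans (hvc e))
        have h5 : c / D ≤ 1 / D * v e := by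
          rw [div_mul_eq_mul_div, one_mul]
          exact div_le_div_of_nonneg_right (hvc e) hD'.le
        have h6 := (abs_le.mp h1).2
        linarith) 0
      linarith [hvc e]
    · obtain ⟨e, he⟩ := exists_lt_of_add_le_succ v (c / D / 2) (by positivity) (by
        filter_upwards [hK', hsmall] with e h1 h2
        have h3 : 1 + 1 / D ≤ (ρ / D : ℝ) := by
          rw [← div_self hD'.ne', ← add_div]
          refine div_le_div_of_nonneg_right ?_ hD'.le
          rw [div_self hD'.ne']
          have : D + 1 ≤ ρ := hgt
          exact_mod_cast this
        have h4 : (1 + 1 / D) * v e ≤ (ρ / D : ℝ) * v e :=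
          mul_le_mul_of_nonneg_right h3 (hc.le.trans (hvc e))
        have h5 : c / D ≤ 1 / D * v e := by
          rw [div_mul_eq_mul_div, one_mul]
          exact div_le_div_of_nonneg_right (hvc e) hD'.le
        have h6 := (abs_le.mp h1).1
        linarith) C
      linarith [hvC e]
  obtain ⟨e₀, he₀⟩ := eventually_atTop.mp hK'
  have hcauchy : CauchySeq fun e => v (e + e₀) := by
    refine cauchySeq_of_le_geometric r (K * r ^ e₀) hr fun e => ?_
    have h1 := he₀ (e + e₀) (by omega)
    rw [heq, div_self hD'.ne', one_mul, pow_add] at h1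
    rw [dist_comm, Real.dist_eq, show e + 1 + e₀ = e + e₀ + 1 by ring]
    linarith
  obtain ⟨L, hL⟩ := cauchySeq_tendsto_of_complete hcauchy
  exact ⟨L, (tendsto_add_atTop_iff_nat e₀).mp hL⟩

theorem tendsto_div_of_isBigO_errorRate {p : ℕ} [Fact p.Prime] {d : ℕ} {f : ℕ → ℝ}
    (h : f =O[atTop] errorRate p d) :
    Tendsto (fun e => f e / ((p : ℝ) ^ e) ^ d) atTop (𝓝 0) := by
  have hp : (1 : ℝ) < p := by exact_mod_cast (Fact.out : p.Prime).one_lt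
  have h1 : (fun e => f e / ((p : ℝ) ^ e) ^ d) =O[atTop] fun e : ℕ => ((p : ℝ)⁻¹) ^ e := by
    have h2 := h.mul (isBigO_refl (fun e : ℕ => (((p : ℝ) ^ e) ^ d)⁻¹) atTop)
    refine (h2.congr_left fun e => (div_eq_mul_inv _ _).symm).congr_right fun e => ?_
    rw [errorRate, inv_pow]
    field_simp
  exact h1.trans_tendsto (tendsto_pow_atTop_nhds_zero_of_lt_one (by positivity)
    (inv_lt_one_of_one_lt₀ hp))

end RealSequences

/-! ### Existence of the limit over domains with finite Frobenius -/

section DomainConvergence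
open IsLocalRing Asymptotics

/-- The frobenius endomorphism is finite and the residue field is perfect. -/
structure FrobeniusFinite (R : Type*) [CommRing R] [IsLocalRing R] (p : ℕ) : Prop where
  residue : ∀ x : R, ∃ y, x - y ^ p ∈ maximalIdeal R
  finite : ∃ (n : ℕ) (t : Fin n → R), ∀ x : R, ∃ c : Fin n → R, x = ∑ i, c i ^ p * t i

theorem FrobeniusFinite.of_surjective {R D : Type*} [CommRing R] [IsLocalRing R] [CommRing D]
    [IsLocalRing D] {p : ℕ} (h : FrobeniusFinite R p) (φ : R →+* D) (hφ : Function.Surjective φ) :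
    FrobeniusFinite D p := by
  refine ⟨fun x => ?_, ?_⟩
  · obtain ⟨x, rfl⟩ := hφ x
    obtain ⟨y, hy⟩ := h.residue x
    refine ⟨φ y, ?_⟩
    rw [← map_pow, ← map_sub]
    have := IsLocalHom.of_surjective φ hφ
    exact (map_maximalIdeal_of_surjective φ hφ).le (Ideal.mem_map_of_mem φ hy)
  · obtain ⟨n, t, ht⟩ := h.finite
    refine ⟨n, φ ∘ t, fun x => ?_⟩
    obtain ⟨x, rfl⟩ := hφ x
    obtain ⟨c, rfl⟩ := ht x
    exact ⟨φ ∘ c, by simp⟩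

variable {R : Type*} [CommRing R] {M N : Type*} [AddCommGroup M] [Module R M]
  [AddCommGroup N] [Module R N] {p : ℕ} [Fact p.Prime] {s : ℝ} {I J : Ideal R}

theorem tendsto_hSeq_of_sub_isBigO {a L : ℝ} (h : (fun e => mixedColen R N p s I J e -
    a * mixedColen R M p s I J e) =O[atTop] errorRate p (natDim R))
    (hM : Tendsto (hSeq R M p s I J) atTop (𝓝 L)) :
    Tendsto (hSeq R N p s I J) atTop (𝓝 (a * L)) := by
  have h1 := (tendsto_div_of_isBigO_errorRate h).add (hM.const_mul a)
  rw [zero_add] at h1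
  refine h1.congr fun e => ?_
  rw [hSeq_eq, hSeq_eq]
  ring

theorem bracketPower_le_pow {K : Ideal R} (hJ : J ≤ K) (n : ℕ) : bracketPower J n ≤ K ^ n := by
  rw [bracketPower, Ideal.span_le]
  rintro _ ⟨a, ha, rfl⟩
  exact Ideal.pow_mem_pow (hJ ha) n

/-- If the `t i` generate `R` over its `p`-th powers and the `v j` generate `M`, the products `t i •
v j` generate `F_*M`. -/
theorem FrobeniusFinite.finite_frobeniusPushforward [IsLocalRing R] [CharP R p]
    (h : FrobeniusFinite R p)
    [Module.Finite R M] : Module.Finite R (FrobeniusPushforward p M) := by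
  classical
  obtain ⟨n, t, ht⟩ := h.finite
  obtain ⟨k, v, hv⟩ := Module.Finite.exists_fin (R := R) (M := M)
  let S : Submodule R (FrobeniusPushforward p M) := Submodule.span R
    (Set.range fun ij : Fin n × Fin k => FrobeniusPushforward.of p M (t ij.1 • v ij.2))
  have hS : ∀ (r : R) (m : M), FrobeniusPushforward.of p M (r ^ p • m) =
    r • FrobeniusPushforward.of p M m := fun _ _ => rfl
  have key : ∀ m ∈ Submodule.span R (Set.range v), ∀ r : R,
      FrobeniusPushforward.of p M (r • m) ∈ S := by
    intro m hm
    induction hm using Submodule.span_induction with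
    | mem y hy =>
      obtain ⟨j, rfl⟩ := hy
      intro r
      obtain ⟨c, rfl⟩ := ht r
      rw [Finset.sum_smul, map_sum]
      refine sum_mem fun i _ => ?_
      rw [mul_smul, hS]
      exact S.smul_mem _ (Submodule.subset_span ⟨(i, j), rfl⟩)
    | zero => intro r; rw [smul_zero, map_zero]; exact zero_mem _
    | add y z _ _ hy hz => intro r; rw [smul_add, map_add]; exact add_mem (hy r) (hz r)
    | smul a y _ hy => intro r; rw [smul_smul]; exact hy _
  have hT : S = ⊤ := by
    rw [eq_top_iff]
    intro x _
    have := key ((FrobeniusPushforward.of p M).symm x) (by rw [hv]; trivial) 1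
    rwa [one_smul] at this
  exact ⟨hT ▸ Submodule.fg_span (Set.finite_range _)⟩

variable [IsNoetherianRing R] [IsLocalRing R]

/-- The colengths grow at least like `q ^ d`. -/
theorem exists_le_mixedColen (hs : 0 < s) (hI : I ≤ maximalIdeal R) (hJ : J ≤ maximalIdeal R)
    (hJc : ContainsMaximalPow J) : ∃ c : ℝ, 0 < c ∧ ∀ e,
      c * ((p : ℝ) ^ e) ^ natDim R ≤ mixedColen R R p s I J e := by
  obtain ⟨c, hc, h⟩ := exists_le_colen_pow (R := R)
  refine ⟨c * (min s 1) ^ natDim R, by positivity, fun e => ?_⟩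
  have hq := one_le_prime_pow (p := p) e
  -- Both summands of the mixed power lie in `𝔪^n`, and `n ≥ min s 1 * q` explains the constant.
  set n := min ⌈s * (p : ℝ) ^ e⌉₊ (p ^ e) with hn
  have hn1 : 1 ≤ n := by
    refine le_min ?_ (Nat.one_le_pow _ _ (Fact.out : p.Prime).pos)
    exact Nat.one_le_ceil_iff.mpr (by positivity)
  have hle : mixedPower p s I J e ≤ maximalIdeal R ^ n := by
    rw [mixedPower, Submodule.add_eq_sup]
    refine sup_le ((Ideal.pow_right_mono hI _).trans (Ideal.pow_le_pow_right (min_le_left _ _))) ?_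
    exact (bracketPower_le_pow hJ _).trans (Ideal.pow_le_pow_right (min_le_right _ _))
  have hnq : min s 1 * (p : ℝ) ^ e ≤ n := by
    rw [hn, Nat.cast_min]
    refine le_min ?_ ?_
    · refine le_trans ?_ (Nat.le_ceil _)
      gcongr
      exact min_le_left _ _
    · push_cast
      calc min s 1 * (p : ℝ) ^ e ≤ 1 * (p : ℝ) ^ e := by gcongr; exact min_le_right _ _
        _ = _ := one_mul _
  calc c * (min s 1) ^ natDim R * ((p : ℝ) ^ e) ^ natDim R
      = c * (min s 1 * (p : ℝ) ^ e) ^ natDim R := by rw [mul_pow]; ring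
    _ ≤ c * (n : ℝ) ^ natDim R := by gcongr
    _ ≤ colen (maximalIdeal R ^ n • (⊤ : Submodule R R)) := h n hn1
    _ ≤ _ := Nat.cast_le.mpr (colen_anti (Submodule.smul_mono_left hle)
        (length_mixedPower_ne_top R hJc e))

/-- A finite module over a domain agrees with a free module up to torsion. -/
theorem exists_free_comparison (R M : Type*) [CommRing R] [IsDomain R] [AddCommGroup M]
    [Module R M] [Module.Finite R M] :
    ∃ (n : ℕ) (f : (Fin n → R) →ₗ[R] M) (g : M →ₗ[R] (Fin n → R)) (x : R), x ≠ 0 ∧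
      (∀ m, x • m ∈ LinearMap.range f) ∧ ∀ y : Fin n → R, x • y ∈ LinearMap.range g := by
  classical
  obtain ⟨k, v, hv⟩ := Module.Finite.exists_fin (R := R) (M := M)
  obtain ⟨t, ht, hmax⟩ := exists_maximal_linearIndepOn R v
  have h1 : ∀ i, ∃ a : R, a ≠ 0 ∧ a • v i ∈ Submodule.span R (v '' t) := by
    intro i
    by_cases hi : i ∈ t
    · exact ⟨1, one_ne_zero, by rw [one_smul]; exact Submodule.subset_span ⟨i, hi, rfl⟩⟩
    · exact hmax i hi
  choose a ha0 ha using h1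
  let e : Fin (Fintype.card t) ≃ t := (Fintype.equivFin t).symm
  have hli : LinearIndependent R fun j => v (e j) :=
    (show LinearIndependent R fun j : t => v j from ht).comp e e.injective
  set f : (Fin (Fintype.card t) → R) →ₗ[R] M := Fintype.linearCombination R fun j => v (e j) with hf
  have hfinj : Function.Injective f := by
    exact linearIndependent_iff_injective_fintypeLinearCombination.mp hli
  have hrange : LinearMap.range f = Submodule.span R (v '' t) := by
    rw [hf, Fintype.range_linearCombination]
    congr 1
    ext y
    constructor
    · rintro ⟨j, rfl⟩
      exact ⟨e j, (e j).2, rfl⟩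
    · rintro ⟨i, hi, rfl⟩
      exact ⟨e.symm ⟨i, hi⟩, by simp⟩
  have hx : ∀ m, (∏ i, a i) • m ∈ LinearMap.range f := by
    intro m
    have hm : m ∈ Submodule.span R (Set.range v) := by rw [hv]; trivial
    induction hm using Submodule.span_induction with
    | mem y hy =>
      obtain ⟨i, rfl⟩ := hy
      rw [← Finset.prod_erase_mul _ _ (Finset.mem_univ i), mul_smul, hrange]
      exact Submodule.smul_mem _ _ (ha i)
    | zero => rw [smul_zero]; exact zero_mem _
    | add y z _ _ hy hz => rw [smul_add]; exact add_mem hy hz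
    | smul r y _ hy => rw [smul_comm]; exact Submodule.smul_mem _ _ hy
  -- Multiplication by `∏ a i` sends `M` into the free submodule spanned by a maximal independent
  -- set of generators; `g` reads the result in coordinates.
  let g : M →ₗ[R] (Fin (Fintype.card t) → R) :=
    (LinearEquiv.ofInjective f hfinj).symm.toLinearMap ∘ₗ
      (LinearMap.lsmul R M (∏ i, a i)).codRestrict (LinearMap.range f) hx
  refine ⟨_, f, g, ∏ i, a i, Finset.prod_ne_zero_iff.mpr fun i _ => ha0 i, hx, fun y => ?_⟩
  refine ⟨f y, ?_⟩
  apply (LinearEquiv.ofInjective f hfinj).injective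
  ext
  simp only [g, LinearMap.comp_apply, LinearEquiv.coe_coe, LinearEquiv.apply_symm_apply, map_smul]
  rfl

theorem FrobeniusFinite.of_isAdicComplete [CharP R p] [IsAdicComplete (maximalIdeal R) R]
    (h : ∀ x : R, ∃ y, x - y ^ p ∈ maximalIdeal R) : FrobeniusFinite R p := by
  refine ⟨h, ?_⟩
  have := _root_.finite_frobeniusPushforward (M := R) h
  obtain ⟨n, t, ht⟩ := Module.Finite.exists_fin (R := R) (M := FrobeniusPushforward p R)
  refine ⟨n, fun i => (FrobeniusPushforward.of p R).symm (t i), fun x => ?_⟩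
  have hx : FrobeniusPushforward.of p R x ∈ Submodule.span R (Set.range t) := by rw [ht]; trivial
  obtain ⟨c, hc⟩ := (Submodule.mem_span_range_iff_exists_fun R).mp hx
  exact ⟨c, hc.symm⟩

variable [Module.Finite R M]

theorem mixedColen_sub_card_mul_isBigO [IsDomain R] (hJ : ContainsMaximalPow J) :
    ∃ n : ℕ, (fun e => mixedColen R M p s I J e - n * mixedColen R R p s I J e) =O[atTop]
      errorRate p (natDim R) := by
  obtain ⟨n, f, g, x, hx, hf, hg⟩ := exists_free_comparison R M
  refine ⟨n, ?_⟩
  have h := mixedColen_sub_isBigO (p := p) (s := s) (I := I) hJ f g (x := x) (by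
    intro P hP
    rw [IsDomain.minimalPrimes_eq_singleton_bot, Set.mem_singleton_iff] at hP
    rwa [hP, Ideal.mem_bot]) hf hg
  refine h.congr_left fun e => ?_
  rw [mixedColen_pi hJ, Finset.sum_const, Finset.card_univ, Fintype.card_fin, nsmul_eq_mul]

variable [CharP R p]

/-- Combine the shift by `F_*` with `F_*R ≈ R^ρ`. The value `ρ = p^d` is not computed: the two-sided
bounds on the sequence force it. -/
theorem exists_tendsto_hSeq_self_of_isDomain [IsDomain R] (hR : FrobeniusFinite R p) (hs : 0 < s)
    (hI : I ≤ maximalIdeal R) (hJ : J ≤ maximalIdeal R) (hIc : ContainsMaximalPow I)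
    (hJc : ContainsMaximalPow J) : ∃ L, Tendsto (hSeq R R p s I J) atTop (𝓝 L) := by
  have hp : (1 : ℝ) < p := by exact_mod_cast (Fact.out : p.Prime).one_lt
  have := hR.finite_frobeniusPushforward (M := R)
  obtain ⟨ρ, hρ⟩ := mixedColen_sub_card_mul_isBigO (M := FrobeniusPushforward p R) (p := p) (s := s)
    (I := I) hJc
  have h1 := (mixedColen_succ_sub_isBigO (M := R) (J := J) hR.residue hs hIc).add hρ
  obtain ⟨c, hc, hcl⟩ := exists_le_mixedColen (p := p) hs hI hJ hJc
  obtain ⟨C, hC⟩ := exists_mixedColen_le (M := R) (p := p) (s := s) (I := I) hJc ⊥ bot_ne_top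
    (Submodule.bot_smul _)
  have hdim : natDim (R ⧸ (⊥ : Ideal R)) = natDim R := by
    rw [natDim, natDim, ringKrullDim_eq_of_ringEquiv (RingEquiv.quotientBot R)]
  rw [hdim] at hC
  refine exists_tendsto_of_ratio (hSeq R R p s I J) ρ (p ^ natDim R)
    (pow_pos (Fact.out : p.Prime).pos _) c C (p : ℝ)⁻¹ hc (by positivity)
    (inv_lt_one_of_one_lt₀ hp) (fun e => ?_) (fun e => ?_) ?_
  · rw [hSeq_eq, le_div_iff₀ (by positivity)]
    exact hcl e
  · rw [hSeq_eq, div_le_iff₀ (by positivity)]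
    exact hC e
  · have h2 := h1.mul (isBigO_refl (fun e : ℕ => (((p : ℝ) ^ (e + 1)) ^ natDim R)⁻¹) atTop)
    have h3 : (fun e : ℕ => errorRate p (natDim R) e * (((p : ℝ) ^ (e + 1)) ^ natDim R)⁻¹) =O[atTop]
        fun e : ℕ => ((p : ℝ)⁻¹) ^ e := by
      refine ((isBigO_refl (fun e : ℕ => ((p : ℝ)⁻¹) ^ e) atTop).const_mul_left
        (((p : ℝ) ^ natDim R)⁻¹)).congr_left fun e => ?_
      rw [errorRate, pow_succ, mul_pow, inv_pow]
      field_simp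
    refine (h2.trans h3).congr_left fun e => ?_
    rw [hSeq_eq, hSeq_eq]
    push_cast
    rw [pow_succ, mul_pow]
    field_simp
    ring

theorem exists_tendsto_hSeq_of_isDomain [IsDomain R] (hR : FrobeniusFinite R p) (hs : 0 < s)
    (hI : I ≤ maximalIdeal R) (hJ : J ≤ maximalIdeal R) (hIc : ContainsMaximalPow I)
    (hJc : ContainsMaximalPow J) : ∃ L, Tendsto (hSeq R M p s I J) atTop (𝓝 L) := by
  obtain ⟨L, hL⟩ := exists_tendsto_hSeq_self_of_isDomain hR hs hI hJ hIc hJc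
  obtain ⟨n, hn⟩ := mixedColen_sub_card_mul_isBigO (M := M) (p := p) (s := s) (I := I) hJc
  exact ⟨_, tendsto_hSeq_of_sub_isBigO hn hL⟩

end DomainConvergence

/-! ### From domains to all local rings with finite Frobenius -/

section Reduced
open IsLocalRing Asymptotics

variable {R : Type*} [CommRing R] {M : Type*} [AddCommGroup M] [Module R M]
  {p : ℕ} [Fact p.Prime] {s : ℝ} {I J : Ideal R}

theorem ringHom_map_mixedPower {S : Type*} [CommRing S] [CharP R p] [CharP S p] (φ : R →+* S)
    (e : ℕ) : (mixedPower p s I J e).map φ = mixedPower p s (I.map φ) (J.map φ) e := by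
  rw [mixedPower, mixedPower, Submodule.add_eq_sup, Submodule.add_eq_sup, Ideal.map_sup,
    Ideal.map_pow, bracketPower_eq_map, bracketPower_eq_map, Ideal.map_map, Ideal.map_map]
  congr 2
  ext x
  simp [iterateFrobenius_def]

theorem mem_map_smul_top_iff {D : Type*} [CommRing D] [Module D M] (φ : R →+* D)
    (hφ : Function.Surjective φ) (hsmul : ∀ (r : R) (m : M), φ r • m = r • m) (𝔞 : Ideal R) (m : M) :
    m ∈ 𝔞 • (⊤ : Submodule R M) ↔ m ∈ 𝔞.map φ • (⊤ : Submodule D M) := by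
  constructor
  · intro h
    induction h using Submodule.smul_induction_on' with
    | smul r hr n hn =>
      rw [← hsmul]
      exact Submodule.smul_mem_smul (Ideal.mem_map_of_mem φ hr) trivial
    | add x _ y _ hx hy => exact add_mem hx hy
  · intro h
    induction h using Submodule.smul_induction_on' with
    | smul r hr n hn =>
      obtain ⟨a, ha, rfl⟩ := (Ideal.mem_map_iff_of_surjective φ hφ).mp hr
      rw [hsmul]
      exact Submodule.smul_mem_smul ha trivial
    | add x _ y _ hx hy => exact add_mem hx hy

variable [IsLocalRing R]

theorem mixedColen_eq_of_surjective {D : Type*} [CommRing D] [IsLocalRing D] [CharP R p] [CharP D p]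
    [Module D M] (φ : R →+* D) (hφ : Function.Surjective φ)
    (hsmul : ∀ (r : R) (m : M), φ r • m = r • m) (e : ℕ) :
    mixedColen R M p s I J e = mixedColen D M p s (I.map φ) (J.map φ) e := by
  have := IsLocalHom.of_surjective φ hφ
  rw [mixedColen, mixedColen, colen, colen, ← ringHom_map_mixedPower]
  rw [length_quotient_eq_of_semilinear φ (fun b => by
    obtain ⟨a, rfl⟩ := hφ b
    exact ⟨a, by simp⟩) (AddEquiv.refl M) (fun a x => (hsmul a x).symm) _ _
    (fun x => mem_map_smul_top_iff φ hφ hsmul _ x)]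

theorem ContainsMaximalPow.map_of_surjective {D : Type*} [CommRing D] [IsLocalRing D]
    {𝔞 : Ideal R} (h : ContainsMaximalPow 𝔞) (φ : R →+* D) (hφ : Function.Surjective φ) :
    ContainsMaximalPow (𝔞.map φ) := by
  obtain ⟨c, hc⟩ := h
  refine ⟨c, ?_⟩
  have := IsLocalHom.of_surjective φ hφ
  rw [← map_maximalIdeal_of_surjective φ hφ, ← Ideal.map_pow]
  exact Ideal.map_mono hc

/-- Used when `R/P` has smaller dimension than `R`: the extra factor is constantly 1 or tends to 0.
-/
theorem exists_tendsto_div_pow_of_le {f : ℕ → ℝ} {d' d : ℕ} (hd : d' ≤ d) {L : ℝ}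
    (h : Tendsto (fun e => f e / ((p : ℝ) ^ e) ^ d') atTop (𝓝 L)) :
    ∃ L', Tendsto (fun e => f e / ((p : ℝ) ^ e) ^ d) atTop (𝓝 L') := by
  have hp : (1 : ℝ) < p := by exact_mod_cast (Fact.out : p.Prime).one_lt
  obtain ⟨k, rfl⟩ := Nat.exists_eq_add_of_le hd
  have h1 : ∃ L', Tendsto (fun e : ℕ => (((p : ℝ) ^ k)⁻¹) ^ e) atTop (𝓝 L') := by
    rcases Nat.eq_zero_or_pos k with rfl | hk
    · exact ⟨1, by simp⟩
    · exact ⟨0, tendsto_pow_atTop_nhds_zero_of_lt_one (by positivity)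
        (inv_lt_one_of_one_lt₀ (one_lt_pow₀ hp hk.ne'))⟩
  obtain ⟨L', h1⟩ := h1
  refine ⟨L * L', (h.mul h1).congr fun e => ?_⟩
  rw [inv_pow, pow_right_comm (p : ℝ) k e, pow_add, div_mul_eq_div_div,
    div_eq_mul_inv _ (((p : ℝ) ^ e) ^ k)]

variable [IsNoetherianRing R] [CharP R p]

theorem exists_tendsto_hSeq_of_isPrime [Module.Finite R M] (hR : FrobeniusFinite R p)
    (hs : 0 < s) (hI : I ≤ maximalIdeal R) (hJ : J ≤ maximalIdeal R) (hIc : ContainsMaximalPow I)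
    (hJc : ContainsMaximalPow J) (P : Ideal R) [P.IsPrime] :
    ∃ L, Tendsto (hSeq R (M ⧸ P • (⊤ : Submodule R M)) p s I J) atTop (𝓝 L) := by
  have : IsLocalRing (R ⧸ P) := IsLocalRing.of_surjective' _ Ideal.Quotient.mk_surjective
  have : CharP (R ⧸ P) p := charP_of_charP_algebra (R := R) p
  have hmap : ∀ {K : Ideal R}, K ≤ maximalIdeal R →
      K.map (Ideal.Quotient.mk P) ≤ maximalIdeal (R ⧸ P) := fun {K} hK => by
    have := IsLocalHom.of_surjective (Ideal.Quotient.mk P) Ideal.Quotient.mk_surjective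
    rw [← map_maximalIdeal_of_surjective (Ideal.Quotient.mk P) Ideal.Quotient.mk_surjective]
    exact Ideal.map_mono hK
  have hsmul : ∀ (r : R) (m : M ⧸ P • (⊤ : Submodule R M)), Ideal.Quotient.mk P r • m = r • m := by
    intro r m
    obtain ⟨m, rfl⟩ := Submodule.Quotient.mk_surjective _ m
    rfl
  have : IsScalarTower R (R ⧸ P) (M ⧸ P • (⊤ : Submodule R M)) := by
    refine IsScalarTower.of_algebraMap_smul fun r m => hsmul r m
  have : Module.Finite (R ⧸ P) (M ⧸ P • (⊤ : Submodule R M)) :=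
    Module.Finite.of_restrictScalars_finite R _ _
  obtain ⟨L, hL⟩ := exists_tendsto_hSeq_of_isDomain (M := M ⧸ P • (⊤ : Submodule R M)) (p := p)
    (hR.of_surjective (Ideal.Quotient.mk P) Ideal.Quotient.mk_surjective) hs (hmap hI) (hmap hJ)
    (hIc.map_of_surjective _ Ideal.Quotient.mk_surjective)
    (hJc.map_of_surjective _ Ideal.Quotient.mk_surjective)
  have hdim : natDim (R ⧸ P) ≤ natDim R := by
    have h := ringKrullDim_quotient_le P
    rw [← natDim_eq_ringKrullDim, ← natDim_eq_ringKrullDim] at h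
    exact_mod_cast h
  obtain ⟨L', hL'⟩ := exists_tendsto_div_pow_of_le hdim (hL.congr fun e => hSeq_eq _ _ _ _ _ _ e)
  refine ⟨L', hL'.congr fun e => ?_⟩
  rw [hSeq_eq, mixedColen_eq_of_surjective (Ideal.Quotient.mk P) Ideal.Quotient.mk_surjective hsmul]

/-- Elements outside one of finitely many minimal primes but inside all others. -/
theorem exists_mem_minimalPrimes_separating (R : Type*) [CommRing R] [IsNoetherianRing R] :
    ∃ x : minimalPrimes R → R, (∀ P, x P ∉ P.1) ∧ ∀ P Q, P ≠ Q → x P ∈ Q.1 := by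
  classical
  have : Finite (minimalPrimes R) := minimalPrimes.finite_of_isNoetherianRing R
  let _ := Fintype.ofFinite (minimalPrimes R)
  have h : ∀ P : minimalPrimes R, ∃ x, x ∉ P.1 ∧ ∀ Q, P ≠ Q → x ∈ Q.1 := by
    intro P
    have hP : P.1.IsPrime := P.2.1.1
    have h1 : ∀ Q : minimalPrimes R, ∃ y ∈ Q.1, P ≠ Q → y ∉ P.1 := by
      intro Q
      by_cases hPQ : P = Q
      · exact ⟨0, Q.1.zero_mem, fun h => absurd hPQ h⟩
      · have : ¬ Q.1 ≤ P.1 := fun hle => hPQ (Subtype.ext (le_antisymm (P.2.2 Q.2.1 hle) hle))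
        obtain ⟨y, hy, hy'⟩ := SetLike.not_le_iff_exists.mp this
        exact ⟨y, hy, fun _ => hy'⟩
    choose y hy hy' using h1
    refine ⟨∏ Q ∈ Finset.univ.erase P, y Q, fun hmem => ?_, fun Q hQ => ?_⟩
    · obtain ⟨Q, hQ, hQ'⟩ := (hP.prod_mem_iff).mp hmem
      exact hy' Q (Finset.ne_of_mem_erase hQ).symm hQ'
    · rw [← Finset.mul_prod_erase _ _ (Finset.mem_erase.mpr ⟨hQ.symm, Finset.mem_univ Q⟩)]
      exact Q.1.mul_mem_right _ (hy Q)
  choose x hx hx' using h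
  exact ⟨x, hx, hx'⟩

/-- Since `x_P P` lies in the nilradical, which kills `M`, multiplication by `x_P` factors through
`M/PM`. Summing gives a map `g` from the product of the `M/PM` back to `M`; both composites with the
projections `f` are multiplication by `∑ x_P`, which avoids every minimal prime. -/
theorem exists_tendsto_hSeq_of_nilradical_smul [Module.Finite R M] (hR : FrobeniusFinite R p)
    (hs : 0 < s) (hI : I ≤ maximalIdeal R) (hJ : J ≤ maximalIdeal R) (hIc : ContainsMaximalPow I)
    (hJc : ContainsMaximalPow J) (hM : ∀ r ∈ nilradical R, ∀ m : M, r • m = 0) :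
    ∃ L, Tendsto (hSeq R M p s I J) atTop (𝓝 L) := by
  classical
  have : Finite (minimalPrimes R) := minimalPrimes.finite_of_isNoetherianRing R
  let _ := Fintype.ofFinite (minimalPrimes R)
  obtain ⟨x, hx, hx'⟩ := exists_mem_minimalPrimes_separating R
  have hkill : ∀ P : minimalPrimes R, ∀ r ∈ P.1, ∀ m : M, x P • r • m = 0 := by
    intro P r hr m
    rw [smul_smul]
    refine hM _ ?_ m
    rw [nilradical_eq_sInf, Ideal.mem_sInf]
    intro Q hQ
    have : Q.IsPrime := hQ
    obtain ⟨Q', hQ', hle⟩ := Ideal.exists_minimalPrimes_le (J := Q) (I := ⊥) bot_le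
    refine hle ?_
    by_cases h : P = ⟨Q', hQ'⟩
    · exact Q'.mul_mem_left _ (by rw [h] at hr; exact hr)
    · exact Q'.mul_mem_right _ (hx' P ⟨Q', hQ'⟩ h)
  let f : M →ₗ[R] ∀ P : minimalPrimes R, (M ⧸ P.1 • (⊤ : Submodule R M)) :=
    LinearMap.pi fun P => Submodule.mkQ _
  have hker : ∀ P : minimalPrimes R,
      P.1 • (⊤ : Submodule R M) ≤ LinearMap.ker (LinearMap.lsmul R M (x P)) := by
    intro P
    rw [Submodule.smul_le]
    intro r hr m _
    exact hkill P r hr m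
  let g : (∀ P : minimalPrimes R, (M ⧸ P.1 • (⊤ : Submodule R M))) →ₗ[R] M :=
    ∑ P, (Submodule.liftQ _ _ (hker P)) ∘ₗ LinearMap.proj P
  have hg : ∀ m : minimalPrimes R → M, g (fun P => Submodule.Quotient.mk (m P)) =
      ∑ P, x P • m P := by
    intro m
    simp [g, LinearMap.sum_apply]
  have hsum : ∀ P ∈ minimalPrimes R, ∑ Q, x Q ∉ P := by
    intro P hP hmem
    have : P.IsPrime := hP.1.1
    rw [← Finset.add_sum_erase _ _ (Finset.mem_univ (⟨P, hP⟩ : minimalPrimes R))] at hmem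
    refine hx ⟨P, hP⟩ ((Ideal.add_mem_iff_left _ ?_).mp hmem)
    exact sum_mem fun Q hQ => hx' Q ⟨P, hP⟩ (Finset.ne_of_mem_erase hQ)
  have hO := mixedColen_sub_isBigO (p := p) (s := s) (I := I) hJc g f (x := ∑ P, x P) hsum
    (fun n => ⟨f n, by
      rw [Finset.sum_smul]
      exact hg fun _ => n⟩)
    (fun y => by
      obtain ⟨m, rfl⟩ : ∃ m : minimalPrimes R → M, y = fun P => Submodule.Quotient.mk (m P) :=
        ⟨fun P => (Submodule.Quotient.mk_surjective _ (y P)).choose,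
          funext fun P => (Submodule.Quotient.mk_surjective _ (y P)).choose_spec.symm⟩
      refine ⟨∑ P, x P • m P, funext fun P => ?_⟩
      change Submodule.Quotient.mk _ = Submodule.Quotient.mk _
      rw [Submodule.Quotient.eq]
      change ∑ Q, x Q • m Q - (∑ Q, x Q) • m P ∈ _
      rw [Finset.sum_smul, ← Finset.sum_sub_distrib]
      refine sum_mem fun Q _ => ?_
      by_cases h : Q = P
      · rw [h, sub_self]
        exact zero_mem _
      · rw [← smul_sub]
        exact Submodule.smul_mem_smul (hx' Q P h) trivial)
  have hlim : ∀ P : minimalPrimes R, ∃ L,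
      Tendsto (hSeq R (M ⧸ P.1 • (⊤ : Submodule R M)) p s I J) atTop (𝓝 L) := fun P => by
    have : P.1.IsPrime := P.2.1.1
    exact exists_tendsto_hSeq_of_isPrime hR hs hI hJ hIc hJc P.1
  choose L hL using hlim
  have hpi : Tendsto (hSeq R (∀ P : minimalPrimes R, (M ⧸ P.1 • (⊤ : Submodule R M))) p s I J) atTop
      (𝓝 (∑ P, L P)) := by
    refine (tendsto_finsetSum Finset.univ fun P _ => hL P).congr fun e => ?_
    simp_rw [hSeq_eq, mixedColen_pi hJc, Finset.sum_div]
  refine ⟨_, tendsto_hSeq_of_sub_isBigO (a := 1) (hO.congr_left fun e => ?_) hpi⟩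
  rw [one_mul]

theorem exists_tendsto_hSeq_of_frobeniusPushforward [Module.Finite R M]
    (hR : FrobeniusFinite R p) (hs : 0 < s) (hIc : ContainsMaximalPow I)
    (h : ∃ L, Tendsto (hSeq R (FrobeniusPushforward p M) p s I J) atTop (𝓝 L)) :
    ∃ L, Tendsto (hSeq R M p s I J) atTop (𝓝 L) := by
  obtain ⟨L, hL⟩ := h
  have := hR.finite_frobeniusPushforward (M := M)
  have h1 := (tendsto_div_of_isBigO_errorRate
    (mixedColen_succ_sub_isBigO (M := M) (J := J) hR.residue hs hIc)).add hL
  have h2 := h1.mul_const (((p : ℝ) ^ natDim R)⁻¹)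
  refine ⟨_, (tendsto_add_atTop_iff_nat 1).mp (h2.congr fun e => ?_)⟩
  rw [hSeq_eq, hSeq_eq, pow_succ, mul_pow]
  field_simp
  ring

/-- On `F_*M` an element `r` acts as `r ^ p`, so each pushforward lowers `k` by one, and convergence
for `F_*M` gives it for `M`. -/
theorem exists_tendsto_hSeq_of_nilradical_pow_smul (hR : FrobeniusFinite R p)
    (hs : 0 < s) (hI : I ≤ maximalIdeal R) (hJ : J ≤ maximalIdeal R) (hIc : ContainsMaximalPow I)
    (hJc : ContainsMaximalPow J) (k : ℕ) (M : Type*) [AddCommGroup M] [Module R M]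
    [Module.Finite R M] (hM : ∀ r ∈ nilradical R, ∀ m : M, r ^ p ^ k • m = 0) :
    ∃ L, Tendsto (hSeq R M p s I J) atTop (𝓝 L) := by
  induction k generalizing M with
  | zero =>
    refine exists_tendsto_hSeq_of_nilradical_smul hR hs hI hJ hIc hJc fun r hr m => ?_
    simpa using hM r hr m
  | succ k ih =>
    have := hR.finite_frobeniusPushforward (M := M)
    refine exists_tendsto_hSeq_of_frobeniusPushforward hR hs hIc
      (ih (FrobeniusPushforward p M) fun r hr m => ?_)
    obtain ⟨m, rfl⟩ := (FrobeniusPushforward.of p M).surjective m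
    rw [FrobeniusPushforward.smul_of, ← pow_mul, ← pow_succ, hM r hr, map_zero]

theorem FrobeniusFinite.exists_tendsto_hSeq (hR : FrobeniusFinite R p)
    (hs : 0 < s) (hI : I ≤ maximalIdeal R) (hJ : J ≤ maximalIdeal R) (hIc : ContainsMaximalPow I)
    (hJc : ContainsMaximalPow J) [Module.Finite R M] :
    ∃ L, Tendsto (hSeq R M p s I J) atTop (𝓝 L) := by
  obtain ⟨k, hk⟩ := IsNoetherianRing.isNilpotent_nilradical R
  refine exists_tendsto_hSeq_of_nilradical_pow_smul hR hs hI hJ hIc hJc k M fun r hr m => ?_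
  have h1 : r ^ k = 0 := by
    have := Ideal.pow_mem_pow hr k
    rwa [hk] at this
  rw [pow_eq_zero_of_le (Nat.lt_pow_self (Fact.out : p.Prime).one_lt).le h1, zero_smul]

end Reduced

/-! ### Lengths under base change -/

section BaseChangeLength
open IsLocalRing TensorProduct

theorem length_le_add_of_exact {R A B C : Type*} [CommRing R] [AddCommGroup A] [Module R A]
    [AddCommGroup B] [Module R B] [AddCommGroup C] [Module R C] (f : A →ₗ[R] B) (g : B →ₗ[R] C)
    (hfg : Function.Exact f g) (hg : Function.Surjective g) :
    Module.length R B ≤ Module.length R A + Module.length R C := by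
  rw [Module.length_eq_add_of_exact (LinearMap.ker g).subtype g (Submodule.subtype_injective _) hg
    (LinearMap.exact_subtype_ker_map g), hfg.linearMap_ker_eq]
  exact add_le_add_left
    (Module.length_le_of_surjective f.rangeRestrict f.surjective_rangeRestrict) _

variable {R S : Type*} [CommRing R] [IsLocalRing R] [CommRing S] [IsLocalRing S] [Algebra R S]

/-- Tensoring is right exact and sends the residue field of `R` to that of `S`, so a composition
series yields at most as many factors. -/
theorem length_baseChange_le (h : (maximalIdeal R).map (algebraMap R S) = maximalIdeal S)
    {M : Type*} [AddCommGroup M] [Module R M] (hM : IsFiniteLength R M) :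
    Module.length S (S ⊗[R] M) ≤ Module.length R M := by
  induction hM with
  | of_subsingleton =>
    rw [Module.length_eq_zero]
    exact zero_le
  | @of_simple_quotient M _ _ N hs hN ih =>
    have hex := LinearMap.exact_subtype_mkQ N
    have h1 : Module.length S (S ⊗[R] M) ≤
        Module.length S (S ⊗[R] N) + Module.length S (S ⊗[R] (M ⧸ N)) :=
      length_le_add_of_exact (N.subtype.baseChange S) (N.mkQ.baseChange S)
        (lTensor_exact S hex (Submodule.mkQ_surjective N))
        (LinearMap.lTensor_surjective S (Submodule.mkQ_surjective N))
    have h2 : Module.length S (S ⊗[R] (M ⧸ N)) = 1 := by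
      obtain ⟨m, hm, ⟨e⟩⟩ := isSimpleModule_iff_quot_maximal.mp hs
      obtain rfl := eq_maximalIdeal hm
      rw [(e.baseChange R S _ _).length_eq, ← (Algebra.TensorProduct.quotIdealMapEquivTensorQuot S
        (maximalIdeal R)).toLinearEquiv.length_eq, h, Module.length_eq_one_iff]
      exact isSimpleModule_iff_quot_maximal.mpr
        ⟨_, maximalIdeal.isMaximal S, ⟨LinearEquiv.refl S _⟩⟩
    rw [h2] at h1
    rw [Module.length_eq_add_of_exact N.subtype N.mkQ (Submodule.subtype_injective _)
      (Submodule.mkQ_surjective _) hex, Module.length_eq_one R (M ⧸ N)]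
    exact h1.trans (add_le_add_left ih 1)

/-- No flatness is needed. Write `M` as a quotient of `(R/𝔪^c)^r` with kernel `K`: the middle length
is preserved by `hc`, so the upper bound for `K` gives the lower bound for `M`. -/
theorem length_baseChange_eq [IsNoetherianRing R]
    (h : (maximalIdeal R).map (algebraMap R S) = maximalIdeal S)
    (hc : ∀ c, Module.length S (S ⧸ maximalIdeal S ^ c) = Module.length R (R ⧸ maximalIdeal R ^ c))
    {M : Type*} [AddCommGroup M] [Module R M] [Module.Finite R M] {c : ℕ}
    (hM : maximalIdeal R ^ c • (⊤ : Submodule R M) = ⊥) :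
    Module.length S (S ⊗[R] M) = Module.length R M := by
  have hfin := isFiniteLength_of_pow_smul_eq_bot hM
  refine le_antisymm (length_baseChange_le h hfin) ?_
  obtain ⟨r, v, hv⟩ := Module.Finite.exists_fin (R := R) (M := M)
  let Q := R ⧸ maximalIdeal R ^ c
  have hQ : Module.length S (S ⊗[R] Q) = Module.length R Q := by
    rw [← (Algebra.TensorProduct.quotIdealMapEquivTensorQuot S
        (maximalIdeal R ^ c)).toLinearEquiv.length_eq, Ideal.map_pow, h, hc]
  have hQfin : Module.length R Q ≠ ⊤ := by
    rw [Module.length_ne_top_iff]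
    refine isFiniteLength_of_pow_smul_eq_bot (c := c) ?_
    rw [eq_bot_iff, Submodule.smul_le]
    intro r hr x _
    obtain ⟨x, rfl⟩ := Ideal.Quotient.mk_surjective x
    change Ideal.Quotient.mk _ (r * x) = 0
    exact Ideal.Quotient.eq_zero_iff_mem.mpr (Ideal.mul_mem_right _ _ hr)
  let f : Fin r → (Q →ₗ[R] M) := fun i => Submodule.liftQ _ (LinearMap.toSpanSingleton R M (v i))
    fun x hx => by
      rw [LinearMap.mem_ker, LinearMap.toSpanSingleton_apply, ← Submodule.mem_bot R, ← hM]
      exact Submodule.smul_mem_smul hx trivial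
  let g : (Fin r → Q) →ₗ[R] M := ∑ i, f i ∘ₗ LinearMap.proj i
  have hg : Function.Surjective g := by
    rw [← LinearMap.range_eq_top, eq_top_iff, ← hv, Submodule.span_le]
    rintro _ ⟨i, rfl⟩
    refine ⟨Pi.single i (Submodule.Quotient.mk 1), ?_⟩
    simp only [g, LinearMap.sum_apply, LinearMap.comp_apply, LinearMap.proj_apply]
    rw [Finset.sum_eq_single i (fun j _ hj => by rw [Pi.single_eq_of_ne hj, map_zero])
      (fun hi => absurd (Finset.mem_univ i) hi), Pi.single_eq_same]
    exact one_smul R (v i)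
  have hPfin : Module.length R (Fin r → Q) ≠ ⊤ := by
    rw [Module.length_pi_of_fintype]
    rw [Finset.sum_const, nsmul_eq_mul]
    exact WithTop.mul_ne_top (ENat.natCast_ne_top _) hQfin
  have hP : Module.length S (S ⊗[R] (Fin r → Q)) = Module.length R (Fin r → Q) := by
    rw [(TensorProduct.piRight R S S fun _ : Fin r => Q).length_eq, Module.length_pi_of_fintype,
      Module.length_pi_of_fintype]
    exact Finset.sum_congr rfl fun _ _ => hQ
  have hex := LinearMap.exact_subtype_ker_map g
  have h1 := length_le_add_of_exact ((LinearMap.ker g).subtype.baseChange S) (g.baseChange S)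
    (lTensor_exact S hex hg) (LinearMap.lTensor_surjective S hg)
  have h2 := Module.length_eq_add_of_exact (LinearMap.ker g).subtype g
    (Submodule.subtype_injective _) hg hex
  have hKfin : Module.length R (LinearMap.ker g) ≠ ⊤ :=
    ne_top_of_le_ne_top hPfin (h2 ▸ le_self_add)
  have h3 := length_baseChange_le h (Module.length_ne_top_iff.mp hKfin)
  rw [hP, h2] at h1
  exact (ENat.add_le_add_iff_left hKfin).mp (h1.trans (add_le_add_left h3 _))

theorem length_baseChange_quotient {R S M : Type*} [CommRing R] [CommRing S] [Algebra R S]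
    [AddCommGroup M] [Module R M] (𝔞 : Ideal R) :
    Module.length S ((S ⊗[R] M) ⧸ 𝔞.map (algebraMap R S) • (⊤ : Submodule S (S ⊗[R] M))) =
      Module.length S (S ⊗[R] (M ⧸ 𝔞 • (⊤ : Submodule R M))) := by
  set N := 𝔞 • (⊤ : Submodule R M) with hN
  have hker : LinearMap.ker (N.mkQ.baseChange S) =
      𝔞.map (algebraMap R S) • (⊤ : Submodule S (S ⊗[R] M)) := by
    apply le_antisymm
    · have h1 : ∀ n ∈ N, ∀ a : S, a ⊗ₜ[R] n ∈
          𝔞.map (algebraMap R S) • (⊤ : Submodule S (S ⊗[R] M)) := by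
        intro n hn a
        induction hn using Submodule.smul_induction_on' with
        | smul r hr m _ =>
          rw [TensorProduct.tmul_smul, ← algebraMap_smul S r (a ⊗ₜ[R] m)]
          exact Submodule.smul_mem_smul (Ideal.mem_map_of_mem _ hr) trivial
        | add m _ m' _ h h' =>
          rw [TensorProduct.tmul_add]
          exact add_mem h h'
      intro x hx
      obtain ⟨y, rfl⟩ := (lTensor_exact S (LinearMap.exact_subtype_mkQ N)
        (Submodule.mkQ_surjective N) x).mp hx
      clear hx
      induction y using TensorProduct.induction_on with
      | zero => rw [map_zero]; exact zero_mem _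
      | tmul a n => exact h1 n n.2 a
      | add y z hy hz => rw [map_add]; exact add_mem hy hz
    · rw [Submodule.smul_le]
      intro r hr y _
      refine Submodule.span_induction (p := fun r _ => r • y ∈ LinearMap.ker (N.mkQ.baseChange S))
        ?_ ?_ ?_ ?_ hr
      · rintro _ ⟨a, ha, rfl⟩
        rw [algebraMap_smul]
        induction y using TensorProduct.induction_on with
        | zero => rw [smul_zero]; exact zero_mem _
        | tmul b m =>
          rw [← TensorProduct.tmul_smul, LinearMap.mem_ker, LinearMap.baseChange_tmul,
            Submodule.mkQ_apply, (Submodule.Quotient.mk_eq_zero N).mpr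
              (Submodule.smul_mem_smul ha trivial), TensorProduct.tmul_zero]
        | add y z hy hz => rw [smul_add]; exact add_mem (hy trivial) (hz trivial)
      · rw [zero_smul]; exact zero_mem _
      · intro a b _ _ ha hb
        rw [add_smul]
        exact add_mem ha hb
      · intro a b _ hb
        rw [smul_eq_mul, mul_smul]
        exact Submodule.smul_mem _ _ hb
  rw [← hker]
  exact (LinearMap.quotKerEquivOfSurjective (N.mkQ.baseChange S)
    (LinearMap.lTensor_surjective S (Submodule.mkQ_surjective N))).length_eq

end BaseChangeLength

/-! ### Reduction to complete rings with perfect residue field -/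

section CompleteReduction
open IsLocalRing TensorProduct

theorem le_of_mul_pow_le {a b : ℕ} {c C : ℝ} (hc : 0 < c)
    (h : ∀ n : ℕ, 1 ≤ n → c * (n : ℝ) ^ a ≤ C * (n : ℝ) ^ b) : a ≤ b := by
  by_contra! hlt
  obtain ⟨k, rfl⟩ := Nat.exists_eq_add_of_lt hlt
  obtain ⟨n, hn⟩ := exists_nat_gt (max (C / c) 1)
  have hn1 : (1 : ℝ) < n := (le_max_right _ _).trans_lt hn
  have hn2 : C < n * c := (div_lt_iff₀ hc).mp ((le_max_left _ _).trans_lt hn)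
  have h1 := h n (by exact_mod_cast hn1.le)
  have h2 : (n : ℝ) ≤ (n : ℝ) ^ (k + 1) := le_self_pow₀ hn1.le (by omega)
  have h3 : c * (n : ℝ) ^ (b + k + 1) = (c * (n : ℝ) ^ (k + 1)) * (n : ℝ) ^ b := by ring
  rw [h3] at h1
  have h4 := le_of_mul_le_mul_right h1 (by positivity)
  nlinarith

theorem exists_colen_pow_le {R : Type*} [CommRing R] [IsNoetherianRing R] [IsLocalRing R] :
    ∃ C : ℝ, ∀ n : ℕ, colen (maximalIdeal R ^ n • (⊤ : Submodule R R)) ≤ C * (n : ℝ) ^ natDim R := by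
  obtain ⟨C, hC⟩ := exists_length_quotient_le (M := R) (⊥ : Ideal R) bot_ne_top
    (Submodule.bot_smul _) containsMaximalPow_maximalIdeal
  have hdim : natDim (R ⧸ (⊥ : Ideal R)) = natDim R := by
    rw [natDim, natDim, ringKrullDim_eq_of_ringEquiv (RingEquiv.quotientBot R)]
  rw [hdim] at hC
  refine ⟨C, fun n => ?_⟩
  have := hC n (maximalIdeal R ^ n) fun x hx => Ideal.pow_mem_pow hx n
  rw [← coe_colen (containsMaximalPow_maximalIdeal.pow n).length_ne_top] at this
  exact_mod_cast this

/-- The two-sided bounds make the dimension the degree of growth of `ℓ(R/𝔪^n)`. -/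
theorem natDim_eq_of_length_eq {R S : Type*} [CommRing R] [IsNoetherianRing R] [IsLocalRing R]
    [CommRing S] [IsNoetherianRing S] [IsLocalRing S] (hc : ∀ c,
      Module.length S (S ⧸ maximalIdeal S ^ c) = Module.length R (R ⧸ maximalIdeal R ^ c)) :
    natDim S = natDim R := by
  have h : ∀ n, colen (maximalIdeal S ^ n • (⊤ : Submodule S S)) =
      colen (maximalIdeal R ^ n • (⊤ : Submodule R R)) := by
    intro n
    rw [smul_eq_mul, smul_eq_mul, Ideal.mul_top, Ideal.mul_top, colen, colen, hc]
  obtain ⟨c₁, hc₁, h₁⟩ := exists_le_colen_pow (R := R)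
  obtain ⟨c₂, hc₂, h₂⟩ := exists_le_colen_pow (R := S)
  obtain ⟨C₁, h₃⟩ := exists_colen_pow_le (R := R)
  obtain ⟨C₂, h₄⟩ := exists_colen_pow_le (R := S)
  refine le_antisymm (le_of_mul_pow_le (C := C₁) hc₂ fun n hn => ?_)
    (le_of_mul_pow_le (C := C₂) hc₁ fun n hn => ?_)
  · exact (h₂ n hn).trans (by rw [h]; exact h₃ n)
  · exact (h₁ n hn).trans (by rw [← h]; exact h₄ n)

/-- The limit defining the `h`-function exists for every Noetherian local ring. -/
theorem exists_tendsto_hSeq {R : Type*} [CommRing R] [IsNoetherianRing R] [IsLocalRing R]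
    {M : Type*} [AddCommGroup M] [Module R M] [Module.Finite R M] {p : ℕ} [Fact p.Prime] [CharP R p]
    {s : ℝ} {I J : Ideal R} (hs : 0 < s) (hI : I ≤ maximalIdeal R) (hJ : J ≤ maximalIdeal R)
    (hIc : ContainsMaximalPow I) (hJc : ContainsMaximalPow J) :
    ∃ L, Tendsto (hSeq R M p s I J) atTop (𝓝 L) := by
  obtain ⟨S, _, _, _, _, _, _, hmap, hres, hlen⟩ := exists_complete_extension R p
  have hle : ∀ {K : Ideal R}, K ≤ maximalIdeal R →
      K.map (algebraMap R S) ≤ maximalIdeal S := fun hK => hmap ▸ Ideal.map_mono hK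
  have hcm : ∀ {K : Ideal R}, ContainsMaximalPow K →
      ContainsMaximalPow (K.map (algebraMap R S)) := fun ⟨c, hc⟩ =>
    ⟨c, by rw [← hmap, ← Ideal.map_pow]; exact Ideal.map_mono hc⟩
  obtain ⟨L, hL⟩ := (FrobeniusFinite.of_isAdicComplete hres).exists_tendsto_hSeq
    (M := S ⊗[R] M) hs (hle hI) (hle hJ) (hcm hIc) (hcm hJc)
  refine ⟨L, hL.congr fun e => ?_⟩
  rw [hSeq_eq, hSeq_eq, natDim_eq_of_length_eq hlen]
  congr 1
  obtain ⟨c, hc⟩ := hJc.mixedPower (p := p) (s := s) (I := I) e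
  rw [mixedColen, mixedColen, colen, colen, ← ringHom_map_mixedPower, length_baseChange_quotient,
    length_baseChange_eq hmap hlen (c := c)]
  exact le_bot_iff.mp ((Submodule.smul_mono_left hc).trans (smul_quotient_smul_eq_bot _).le)

end CompleteReduction

/-! ### Lengths and dimension of the idealization -/

section Idealization
open IsLocalRing TrivSqZeroExt

variable {R : Type*} (M : Type*) [CommRing R] [AddCommGroup M] [Module R M]
    [Module Rᵐᵒᵖ M] [IsCentralScalar R M]

/-- As an extension of ideals, `I ⋉ IM` is compatible with powers, sums and Frobenius powers through
`ringHom_map_mixedPower`. -/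
theorem idealizationIdeal_eq_map (I : Ideal R) :
    idealizationIdeal M I = I.map (algebraMap R (TrivSqZeroExt R M)) := by
  apply le_antisymm
  · intro x hx
    have h1 : ∀ m ∈ I • (⊤ : Submodule R M), (inr m : TrivSqZeroExt R M) ∈
        I.map (algebraMap R (TrivSqZeroExt R M)) := by
      intro m hm
      induction hm using Submodule.smul_induction_on' with
      | smul r hr m _ =>
        rw [inr_smul, Algebra.smul_def]
        exact Ideal.mul_mem_right _ _ (Ideal.mem_map_of_mem _ hr)
      | add m _ m' _ h h' => rw [inr_add]; exact add_mem h h'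
    rw [← inl_fst_add_inr_snd_eq x]
    exact add_mem (Ideal.mem_map_of_mem _ hx.1) (h1 _ hx.2)
  · rw [Ideal.map_le_iff_le_comap]
    intro r hr
    exact ⟨by simpa [algebraMap_eq_inl] using hr, by simp [algebraMap_eq_inl]⟩

theorem fstHom_surjective : Function.Surjective (fstHom R R M : TrivSqZeroExt R M →+* R) :=
  fun r => ⟨inl r, rfl⟩

theorem length_quotient_idealizationIdeal (𝔞 : Ideal R) :
    Module.length R (TrivSqZeroExt R M ⧸ idealizationIdeal M 𝔞) =
      Module.length R (R ⧸ 𝔞 • (⊤ : Submodule R R)) +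
        Module.length R (M ⧸ 𝔞 • (⊤ : Submodule R M)) := by
  let f : TrivSqZeroExt R M →ₗ[R]
      (R ⧸ 𝔞 • (⊤ : Submodule R R)) × (M ⧸ 𝔞 • (⊤ : Submodule R M)) :=
    LinearMap.prod ((Submodule.mkQ _) ∘ₗ (fstHom R R M).toLinearMap)
      ((Submodule.mkQ _) ∘ₗ sndHom R M)
  have hf : Function.Surjective f := by
    rintro ⟨a, b⟩
    obtain ⟨a, rfl⟩ := Submodule.mkQ_surjective _ a
    obtain ⟨b, rfl⟩ := Submodule.mkQ_surjective _ b
    exact ⟨inl a + inr b, by simp [f]⟩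
  have hker : LinearMap.ker f = (idealizationIdeal M 𝔞).restrictScalars R := by
    ext x
    rw [LinearMap.mem_ker, Prod.ext_iff]
    change Submodule.Quotient.mk x.fst = 0 ∧ Submodule.Quotient.mk x.snd = 0 ↔
      x.fst ∈ 𝔞 ∧ x.snd ∈ 𝔞 • (⊤ : Submodule R M)
    rw [Submodule.Quotient.mk_eq_zero, Submodule.Quotient.mk_eq_zero, smul_eq_mul, Ideal.mul_top]
  rw [← Module.length_prod, ← (LinearMap.quotKerEquivOfSurjective f hf).length_eq, hker]
  exact (Submodule.Quotient.restrictScalarsEquiv R (idealizationIdeal M 𝔞)).symm.length_eq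

instance isLocalHom_fstHom : IsLocalHom (fstHom R R M : TrivSqZeroExt R M →+* R) where
  map_nonunit _ hx := isUnit_iff_isUnit_fst.mpr hx

theorem inr_mem_of_isPrime (P : Ideal (TrivSqZeroExt R M)) [P.IsPrime] (m : M) : inr m ∈ P := by
  have : (inr m * inr m : TrivSqZeroExt R M) ∈ P := by
    rw [inr_mul_inr]
    exact P.zero_mem
  exact (Ideal.IsPrime.mem_or_mem ‹_› this).elim id id

/-- Every prime contains the square-zero kernel of the projection to `R`, so the spectra coincide.
-/
theorem natDim_trivSqZeroExt : natDim (TrivSqZeroExt R M) = natDim R := by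
  have h : ringKrullDim (TrivSqZeroExt R M) = ringKrullDim R := by
    have h1 := ringKrullDim_eq_of_ringEquiv
      (RingHom.quotientKerEquivOfSurjective (fstHom_surjective (R := R) M))
    rw [← h1, ringKrullDim_quotient]
    have : PrimeSpectrum.zeroLocus
        (RingHom.ker (fstHom R R M : TrivSqZeroExt R M →+* R) : Set (TrivSqZeroExt R M)) =
        Set.univ := by
      rw [Set.eq_univ_iff_forall]
      intro P x hx
      have hx' : x.fst = 0 := hx
      rw [← inl_fst_add_inr_snd_eq x, hx', inl_zero, zero_add]
      exact inr_mem_of_isPrime M P.asIdeal _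
    rw [this]
    exact (Order.krullDim_eq_of_orderIso OrderIso.Set.univ).symm
  rw [natDim, natDim, h]

variable [IsLocalRing R]

instance : IsLocalRing (TrivSqZeroExt R M) :=
  RingHom.domain_isLocalRing (fstHom R R M : TrivSqZeroExt R M →+* R)

theorem mem_maximalIdeal_iff_fst (x : TrivSqZeroExt R M) :
    x ∈ maximalIdeal (TrivSqZeroExt R M) ↔ x.fst ∈ maximalIdeal R := by
  rw [mem_maximalIdeal, mem_maximalIdeal, mem_nonunits_iff, mem_nonunits_iff,
    isUnit_iff_isUnit_fst]

/-- Every element of `R ⋉ M` is congruent to its first component modulo the maximal ideal, so `R → R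
⋉ M` has residue degree 1. -/
theorem length_trivSqZeroExt_quotient (𝔞 : Ideal R) :
    Module.length (TrivSqZeroExt R M)
        (TrivSqZeroExt R M ⧸ idealizationIdeal M 𝔞 •
          (⊤ : Submodule (TrivSqZeroExt R M) (TrivSqZeroExt R M))) =
      Module.length R (TrivSqZeroExt R M ⧸ idealizationIdeal M 𝔞) := by
  have hloc : IsLocalHom (algebraMap R (TrivSqZeroExt R M)) := ⟨fun r hr => by
    have := isUnit_iff_isUnit_fst.mp hr
    simpa [algebraMap_eq_inl] using this⟩
  rw [smul_eq_mul, Ideal.mul_top,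
    ← length_quotient_eq_of_semilinear (algebraMap R (TrivSqZeroExt R M)) (fun b => ⟨b.fst, by
      rw [mem_maximalIdeal_iff_fst]
      simp [algebraMap_eq_inl]⟩) (AddEquiv.refl (TrivSqZeroExt R M))
      (fun r x => Algebra.smul_def r x) ((idealizationIdeal M 𝔞).restrictScalars R) _
      (fun x => Iff.rfl)]
  exact (Submodule.Quotient.restrictScalarsEquiv R (idealizationIdeal M 𝔞)).length_eq

variable [IsNoetherianRing R] [Module.Finite R M]

theorem realLength_idealization_quotient {p : ℕ} {s : ℝ} {I J : Ideal R}
    (hJ : ContainsMaximalPow J) (e : ℕ) :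
    realLength R (TrivSqZeroExt R M ⧸ idealizationIdeal M (mixedPower p s I J e)) =
      mixedColen R R p s I J e + mixedColen R M p s I J e := by
  rw [realLength, length_quotient_idealizationIdeal,
    ENat.toNat_add (length_mixedPower_ne_top R hJ e) (length_mixedPower_ne_top M hJ e)]
  push_cast
  rfl

theorem hSeq_trivSqZeroExt {p : ℕ} [Fact p.Prime] [CharP R p] {s : ℝ} {I J : Ideal R}
    (hJ : ContainsMaximalPow J) (e : ℕ) :
    hSeq (TrivSqZeroExt R M) (TrivSqZeroExt R M) p s (idealizationIdeal M I)
      (idealizationIdeal M J) e = hSeq R R p s I J e + hSeq R M p s I J e := by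
  have : CharP (TrivSqZeroExt R M) p := charP_of_charP_algebra (R := R) p
  rw [hSeq_eq, hSeq_eq, hSeq_eq, natDim_trivSqZeroExt, ← add_div,
    ← realLength_idealization_quotient M hJ, realLength, ← length_trivSqZeroExt_quotient,
    idealizationIdeal_eq_map, idealizationIdeal_eq_map, idealizationIdeal_eq_map,
    ringHom_map_mixedPower]
  rfl

end Idealization

/-! ### Ideals primary to the maximal ideal, and the theorem -/

section MaximalPrimary
open IsLocalRing

variable {R : Type*} [CommRing R] [IsLocalRing R] {I : Ideal R}

theorem IsMaximalPrimary.le_maximalIdeal (h : IsMaximalPrimary I) : I ≤ maximalIdeal R :=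
  Ideal.le_radical.trans h.2.le

theorem IsMaximalPrimary.containsMaximalPow [IsNoetherianRing R] (h : IsMaximalPrimary I) :
    ContainsMaximalPow I := by
  obtain ⟨n, hn⟩ := Ideal.exists_radical_pow_le_of_fg I (IsNoetherian.noetherian _)
  exact ⟨n, h.2 ▸ hn⟩

end MaximalPrimary

theorem theorem4p2 {R M : Type*} [CommRing R] [IsNoetherianRing R] [IsLocalRing R]
    (p : ℕ) [Fact p.Prime] [CharP R p]
    [AddCommGroup M] [Module R M] [Module.Finite R M] [Module Rᵐᵒᵖ M] [IsCentralScalar R M]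
    (I₁ I₂ : Ideal R) (hI₁ : IsMaximalPrimary I₁) (hI₂ : IsMaximalPrimary I₂)
    (s : ℝ) (hs : 0 < s) :
    -- the limits defining the three values of the `h`-function exist
    Tendsto (hSeq R R p s I₁ I₂) atTop (𝓝 (hFunction R R p s I₁ I₂)) ∧
    Tendsto (hSeq R M p s I₁ I₂) atTop (𝓝 (hFunction R M p s I₁ I₂)) ∧
    Tendsto (hSeq (TrivSqZeroExt R M) (TrivSqZeroExt R M) p s
        (idealizationIdeal M I₁) (idealizationIdeal M I₂)) atTop
      (𝓝 (hFunction (TrivSqZeroExt R M) (TrivSqZeroExt R M) p s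
        (idealizationIdeal M I₁) (idealizationIdeal M I₂))) ∧
    -- the formula for the `h`-function of the idealization
    hFunction (TrivSqZeroExt R M) (TrivSqZeroExt R M) p s
        (idealizationIdeal M I₁) (idealizationIdeal M I₂) =
      hFunction R R p s I₁ I₂ + hFunction R M p s I₁ I₂ ∧
    -- the same value as the limit of the normalized lengths over `R`
    Tendsto (fun e : ℕ =>
        realLength R (TrivSqZeroExt R M ⧸ idealizationIdeal M (mixedPower p s I₁ I₂ e)) /
          (p : ℝ) ^ (e * natDim R)) atTop
      (𝓝 (hFunction R R p s I₁ I₂ + hFunction R M p s I₁ I₂)) := by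
  have hR := tendsto_nhds_limUnder (exists_tendsto_hSeq (M := R) (p := p) hs hI₁.le_maximalIdeal
    hI₂.le_maximalIdeal hI₁.containsMaximalPow hI₂.containsMaximalPow)
  have hM := tendsto_nhds_limUnder (exists_tendsto_hSeq (M := M) (p := p) hs hI₁.le_maximalIdeal
    hI₂.le_maximalIdeal hI₁.containsMaximalPow hI₂.containsMaximalPow)
  -- The sequence over `R ⋉ M` is the sum of the other two for every `e`, so its convergence needs
  -- no separate existence argument.
  have hT : Tendsto (hSeq (TrivSqZeroExt R M) (TrivSqZeroExt R M) p s
      (idealizationIdeal M I₁) (idealizationIdeal M I₂)) atTop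
      (𝓝 (hFunction R R p s I₁ I₂ + hFunction R M p s I₁ I₂)) :=
    (hR.add hM).congr fun e => (hSeq_trivSqZeroExt M hI₂.containsMaximalPow e).symm
  have heq : hFunction (TrivSqZeroExt R M) (TrivSqZeroExt R M) p s
      (idealizationIdeal M I₁) (idealizationIdeal M I₂) =
      hFunction R R p s I₁ I₂ + hFunction R M p s I₁ I₂ := hT.limUnder_eq
  refine ⟨hR, hM, heq ▸ hT, heq, (hR.add hM).congr fun e => ?_⟩
  rw [realLength_idealization_quotient M hI₂.containsMaximalPow, hSeq_eq, hSeq_eq, ← add_div,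
    pow_mul]
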